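/- **Theorem (Projective Recollement Theorem).** Let $\mathcal A$ be an exact category (in the sense of Quillen) whose underlying additive category is weakly idempotent complete (every split monomorphism has a cokernel), with enough projectives. A *projective cotorsion pair* $(\mathcal C,\mathcal W)$ in $\mathcal A$ is a complete cotorsion pair with $\mathcal W$ thick and $\mathcal C\cap\mathcal W$ equal to the class of projective objects; it corresponds to the model structure with Hovey triple (cofibrant, trivial, fibrant objects) $(\mathcal C,\mathcal W,\mathcal A)$. In the model structure of a Hovey triple $(\mathcal Q,\mathcal W,\mathcal R)$ the cofibrations (fibrations) are the admissible monomorphisms with cokernel in $\mathcal Q$ (admissible epimorphisms with kernel in $\mathcal R$), and the weak equivalences are the composites of an admissible monomorphism with cokernel in $\mathcal Q\cap\mathcal W$ followed by an admissible epimorphism with kernel in $\mathcal R\cap\mathcal W$. Let $$\mathcal M_1=(\mathcal C_1,\mathcal W_1),\quad \mathcal M_2=(\mathcal C_2,\mathcal W_2),\quad \mathcal M_3=(\mathcal C_3,\mathcal W_3)$$ be three projective cotorsion pairs in $\mathcal A$ with $\mathcal C_2,\mathcal C_3\subseteq\mathcal C_1$. For $k=2,3$ let $\mathcal M_k\backslash\mathcal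 M_1=(\mathcal C_1,\mathcal V_k,\mathcal W_k)$ be the left localization, where $\mathcal V_k$ is the class of all $X$ admitting an admissible short exact sequence $W\rightarrowtail C\twoheadrightarrow X$ with $W\in\mathcal W_1$ and $C\in\mathcal C_k$. For a class $\mathcal D$ of objects let $\mathcal D/{\sim}$ be the full subcategory on $\mathcal D$ modulo the relation $f\sim g$ iff $g-f$ factors through a projective object, and let $\gamma:\mathcal A\to\mathcal A/\mathcal W_3$ be the localization at the weak equivalences of $\mathcal M_3$. A *recollement* $\mathcal T'\xrightarrow{F}\mathcal T\xrightarrow{G}\mathcal T''$ consists of exact functors of triangulated categories, each with a left and a right adjoint (again exact), such that $F$ and both adjoints of $G$ are fully faithful and $GX=0$ iff $X\cong FX'$ for some $X'$. Then $\mathcal W_3\cap\mathcal C_1=\mathcal C_2$ if and only if $\mathcal W_2\cap\mathcal W_3=\mathcal W_1$ and $\mathcal C_2\subseteq\mathcal W_3$. If this holds, then: 1. $\mathcal M_2\backslash\mathcal M_1$ and $\mathcal M_3\backslash\mathcal M_1$ are Hovey triples and the corresponding classes of morphisms form model structures; the identity adjunction is a Quillen equivalence between $\mathcal M_3$ and $\mathcal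 M_2\backslash\mathcal M_1$, and between $\mathcal M_2$ and $\mathcal M_3\backslash\mathcal M_1$ (with left adjoint starting at $\mathcal M_3$, respectively $\mathcal M_2$). 2. $\mathcal C_1/{\sim}$, $\mathcal C_2/{\sim}$ and $\mathcal A/\mathcal W_3$ carry triangulated structures whose exact triangles are, up to isomorphism, exactly the images of the admissible short exact sequences in $\mathcal C_1$, $\mathcal C_2$ and $\mathcal A$, with connecting morphisms natural in the sequence, and there is a recollement $$\mathcal C_2/{\sim}\ \xrightarrow{\ I\ }\ \mathcal C_1/{\sim}\ \xrightarrow{\ Q\ }\ \mathcal A/\mathcal W_3,$$ where $I$ is the inclusion and $Q([f])=\gamma(f)$. The left and right adjoints of $I$ are $E(\mathcal M_3)$ and $C(\mathcal M_2)$, the left and right adjoints of $Q$ are $\lambda=C(\mathcal M_3)$ and $\rho=E(\mathcal M_2)\circ C(\mathcal M_1)$. Here $C(\mathcal M_i)$ sends $X$ to $C$ for a chosen admissible short exact sequence $W\rightarrowtail C\twoheadrightarrow X$ with $C\in\mathcal C_i$, $W\in\mathcal W_i$ (a special precover), $E(\mathcal M_i)$ sends $X$ to $W$ for a chosen $X\rightarrowtail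 W\twoheadrightarrow C$ with $W\in\mathcal W_i$, $C\in\mathcal C_i$ (a special preenvelope), and a morphism is sent to the class of any induced morphism. 3. The essential image of $\lambda$ is $\mathcal C_3/{\sim}$, that of $\rho$ is $(\mathcal W_2\cap\mathcal C_1)/{\sim}$, and $\lambda$ and $\rho$ (precomposed with $Q$) restrict to mutually inverse equivalences $\lambda:(\mathcal W_2\cap\mathcal C_1)/{\sim}\ \longleftrightarrow\ \mathcal C_3/{\sim}:\rho$. -/

import Mathlib

open CategoryTheory Limits Pretriangulated
open scoped ZeroObject

universe v u v' u' v'' u''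

/-! ### Quillen exact categories -/

/-- A Quillen exact structure on an additive category: a class `conf` of kernel-cokernel pairs
(the admissible short exact sequences) which contains the split ones, is closed under
isomorphisms, whose admissible monomorphisms (epimorphisms) are closed under composition, and
which is stable under pushouts of admissible monomorphisms and pullbacks of admissible
epimorphisms along arbitrary morphisms. -/
structure ExactStructure (A : Type u) [Category.{v} A] [Preadditive A] [HasZeroObject A]
    [HasBinaryBiproducts A] where
  /-- the admissible short exact sequences -/
  conf : ObjectProperty (ShortComplex A)
  isKernel : ∀ S, conf S → Nonempty (IsLimit (KernelFork.ofι S.f S.zero))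
  isCokernel : ∀ S, conf S → Nonempty (IsColimit (CokernelCofork.ofπ S.g S.zero))
  conf_of_iso : ∀ {S T : ShortComplex A}, (S ≅ T) → conf S → conf T
  conf_of_splitting : ∀ S : ShortComplex A, S.Splitting → conf S
  mono_comp : ∀ {X Y Z : A} (f : X ⟶ Y) (g : Y ⟶ Z),
    (∃ (C : A) (p : Y ⟶ C) (w : f ≫ p = 0), conf (ShortComplex.mk f p w)) →
    (∃ (C : A) (p : Z ⟶ C) (w : g ≫ p = 0), conf (ShortComplex.mk g p w)) →
    ∃ (C : A) (p : Z ⟶ C) (w : (f ≫ g) ≫ p = 0), conf (ShortComplex.mk (f ≫ g) p w)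
  epi_comp : ∀ {X Y Z : A} (f : X ⟶ Y) (g : Y ⟶ Z),
    (∃ (K : A) (i : K ⟶ X) (w : i ≫ f = 0), conf (ShortComplex.mk i f w)) →
    (∃ (K : A) (i : K ⟶ Y) (w : i ≫ g = 0), conf (ShortComplex.mk i g w)) →
    ∃ (K : A) (i : K ⟶ X) (w : i ≫ f ≫ g = 0), conf (ShortComplex.mk i (f ≫ g) w)
  mono_pushout : ∀ {X Y X' : A} (f : X ⟶ Y) (a : X ⟶ X'),
    (∃ (C : A) (p : Y ⟶ C) (w : f ≫ p = 0), conf (ShortComplex.mk f p w)) →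
    ∃ (Y' : A) (a' : Y ⟶ Y') (f' : X' ⟶ Y'), IsPushout f a a' f' ∧
      ∃ (C : A) (p : Y' ⟶ C) (w : f' ≫ p = 0), conf (ShortComplex.mk f' p w)
  epi_pullback : ∀ {Y Z Z' : A} (g : Y ⟶ Z) (a : Z' ⟶ Z),
    (∃ (K : A) (i : K ⟶ Y) (w : i ≫ g = 0), conf (ShortComplex.mk i g w)) →
    ∃ (Y' : A) (a' : Y' ⟶ Y) (g' : Y' ⟶ Z'), IsPullback a' g' g a ∧
      ∃ (K : A) (i : K ⟶ Y') (w : i ≫ g' = 0), conf (ShortComplex.mk i g' w)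

/-- Weak idempotent completeness: every split monomorphism has a cokernel. -/
def WeaklyIdempotentComplete (A : Type u) [Category.{v} A] [Preadditive A] : Prop :=
  ∀ {X Y : A} (f : X ⟶ Y), IsSplitMono f → HasCokernel f

namespace ExactStructure

variable {A : Type u} [Category.{v} A] [Preadditive A] [HasZeroObject A] [HasBinaryBiproducts A]
variable (E : ExactStructure A)

/-- Admissible monomorphisms with cokernel in `Q`. -/
def admMono (Q : ObjectProperty A) : MorphismProperty A := fun _ Y f =>
  ∃ (C : A) (p : Y ⟶ C) (w : f ≫ p = 0), E.conf (ShortComplex.mk f p w) ∧ Q C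

/-- Admissible epimorphisms with kernel in `R`. -/
def admEpi (R : ObjectProperty A) : MorphismProperty A := fun X _ f =>
  ∃ (K : A) (i : K ⟶ X) (w : i ≫ f = 0), E.conf (ShortComplex.mk i f w) ∧ R K

/-- Projective objects: those which lift over all admissible epimorphisms. -/
def projectives : ObjectProperty A := fun P =>
  ∀ {X Y : A} (e : X ⟶ Y), E.admEpi ⊤ e → ∀ f : P ⟶ Y, ∃ g : P ⟶ X, g ≫ e = f

/-- Every object is the target of an admissible epimorphism from a projective object. -/
def HasEnoughProjectives : Prop :=
  ∀ X : A, ∃ (P : A) (e : P ⟶ X), E.projectives P ∧ E.admEpi ⊤ e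

/-! ### Cotorsion pairs and Hovey triples -/

/-- The vanishing of the Yoneda group `Ext¹(X, Y)`: all extensions of `X` by `Y` split. -/
def ExtVanishes (X Y : A) : Prop :=
  ∀ (B : A) (i : Y ⟶ B) (p : B ⟶ X) (w : i ≫ p = 0), E.conf (ShortComplex.mk i p w) →
    Nonempty (ShortComplex.mk i p w).Splitting

/-- `C = ⊥W` and `W = C⊥` with respect to `Ext¹`. -/
structure IsCotorsionPair (C W : ObjectProperty A) : Prop where
  left_iff : ∀ X, C X ↔ ∀ Y, W Y → E.ExtVanishes X Y
  right_iff : ∀ Y, W Y ↔ ∀ X, C X → E.ExtVanishes X Y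

/-- A cotorsion pair with enough projectives and enough injectives: every `X` has a special
`C`-precover and a special `W`-preenvelope. -/
structure IsCompleteCotorsionPair (C W : ObjectProperty A) : Prop
    extends E.IsCotorsionPair C W where
  precover : ∀ X : A, ∃ (Y : A) (p : Y ⟶ X), C Y ∧ E.admEpi W p
  preenvelope : ∀ X : A, ∃ (Y : A) (j : X ⟶ Y), W Y ∧ E.admMono C j

/-- Thick classes: closed under retracts and with the two out of three property for admissible
short exact sequences. -/
structure IsThick (W : ObjectProperty A) : Prop where
  retract : W.IsStableUnderRetracts
  ext₁ : ∀ S, E.conf S → W S.X₂ → W S.X₃ → W S.X₁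
  ext₂ : ∀ S, E.conf S → W S.X₁ → W S.X₃ → W S.X₂
  ext₃ : ∀ S, E.conf S → W S.X₁ → W S.X₂ → W S.X₃

/-- A projective cotorsion pair: complete, with `W` thick and `C ∩ W` the projectives. -/
structure IsProjectiveCotorsionPair (C W : ObjectProperty A) : Prop
    extends E.IsCompleteCotorsionPair C W where
  thick : E.IsThick W
  inf_eq : C ⊓ W = E.projectives

end ExactStructure

/-- Three classes of objects: `Q` (cofibrant), `W` (trivial), `R` (fibrant). -/
structure ObjectTriple (A : Type u) [Category.{v} A] where
  Q : ObjectProperty A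
  W : ObjectProperty A
  R : ObjectProperty A

/-- Three classes of morphisms on a category. -/
structure ModelData (A : Type u) [Category.{v} A] where
  cof : MorphismProperty A
  fib : MorphismProperty A
  weq : MorphismProperty A

/-- The axioms of a closed model structure (on a category that is not assumed bicomplete). -/
structure ModelData.IsModelStructure {A : Type u} [Category.{v} A] (M : ModelData A) : Prop where
  two_out_of_three : M.weq.HasTwoOutOfThreeProperty
  retract_cof : M.cof.IsStableUnderRetracts
  retract_fib : M.fib.IsStableUnderRetracts
  retract_weq : M.weq.IsStableUnderRetracts
  lift_trivialCof : ∀ {X Y Z T : A} (i : X ⟶ Y) (p : Z ⟶ T),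
    (M.cof ⊓ M.weq) i → M.fib p → HasLiftingProperty i p
  lift_trivialFib : ∀ {X Y Z T : A} (i : X ⟶ Y) (p : Z ⟶ T),
    M.cof i → (M.fib ⊓ M.weq) p → HasLiftingProperty i p
  fac_trivialCof : MorphismProperty.HasFactorization (M.cof ⊓ M.weq) M.fib
  fac_trivialFib : MorphismProperty.HasFactorization M.cof (M.fib ⊓ M.weq)

/-- `F ⊣ G` is a Quillen equivalence from the model structure `M` to the model structure `N`:
`F` preserves cofibrations and trivial cofibrations, and for `X` cofibrant and `Y` fibrant a map
`F X ⟶ Y` is a weak equivalence iff its adjoint `X ⟶ G Y` is one. -/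
structure IsQuillenEquivalence {A : Type u} [Category.{v} A] [HasZeroMorphisms A]
    {B : Type u'} [Category.{v'} B] [HasZeroMorphisms B]
    (M : ModelData A) (N : ModelData B) {F : A ⥤ B} {G : B ⥤ A} (adj : F ⊣ G) : Prop where
  source : M.IsModelStructure
  target : N.IsModelStructure
  map_cof : ∀ {X Y : A} (f : X ⟶ Y), M.cof f → N.cof (F.map f)
  map_trivialCof : ∀ {X Y : A} (f : X ⟶ Y), (M.cof ⊓ M.weq) f → (N.cof ⊓ N.weq) (F.map f)
  weq_iff : ∀ (X : A) (Y : B),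
    (∃ Z : A, IsZero Z ∧ M.cof (0 : Z ⟶ X)) → (∃ Z : B, IsZero Z ∧ N.fib (0 : Y ⟶ Z)) →
    ∀ f : F.obj X ⟶ Y, N.weq f ↔ M.weq (adj.homEquiv X Y f)

namespace ExactStructure

variable {A : Type u} [Category.{v} A] [Preadditive A] [HasZeroObject A] [HasBinaryBiproducts A]
variable (E : ExactStructure A)

/-- Hovey triples `(Q, W, R)`. -/
structure IsHoveyTriple (M : ObjectTriple A) : Prop where
  thick : E.IsThick M.W
  cof_trivFib : E.IsCompleteCotorsionPair M.Q (M.R ⊓ M.W)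
  trivCof_fib : E.IsCompleteCotorsionPair (M.Q ⊓ M.W) M.R

/-- The cofibrations, fibrations and weak equivalences attached to a Hovey triple; a weak
equivalence is a composite of an admissible monomorphism with cokernel in `Q ∩ W` and an
admissible epimorphism with kernel in `R ∩ W`. -/
def model (M : ObjectTriple A) : ModelData A where
  cof := E.admMono M.Q
  fib := E.admEpi M.R
  weq := fun X Y f => ∃ (Z : A) (i : X ⟶ Z) (p : Z ⟶ Y),
    E.admMono (M.Q ⊓ M.W) i ∧ E.admEpi (M.R ⊓ M.W) p ∧ i ≫ p = f

end ExactStructure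

/-- The Hovey triple of a projective cotorsion pair `(C, W)`: every object is fibrant. -/
def projTriple {A : Type u} [Category.{v} A] (C W : ObjectProperty A) : ObjectTriple A :=
  ⟨C, W, ⊤⟩

namespace ExactStructure

variable {A : Type u} [Category.{v} A] [Preadditive A] [HasZeroObject A] [HasBinaryBiproducts A]
variable (E : ExactStructure A)

/-- The left localization `M' \ M = (C, W'', W')` of `M = (C, W)` by `M' = (C', W')`, where `W''`
is the class of all `X` that admit an admissible short exact sequence `V ↣ Y ↠ X` with
`V` in `W` and `Y` in `C'`. -/
def leftLocalization (C' W' C W : ObjectProperty A) : ObjectTriple A where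
  Q := C
  W := fun X => ∃ (Y : A) (p : Y ⟶ X), C' Y ∧ E.admEpi W p
  R := W'

/-! ### Stable categories and the localization `A / W` -/

/-- `f ∼ g` iff `g - f` factors through a projective object of the ambient exact category. -/
def stableRel (C : ObjectProperty A) : HomRel C.FullSubcategory := fun X Y f g =>
  ∃ (P : A) (t : X.obj ⟶ P) (s : P ⟶ Y.obj), E.projectives P ∧ g.hom - f.hom = t ≫ s

/-- The category `C/∼`. -/
abbrev StableCat (C : ObjectProperty A) : Type u := CategoryTheory.Quotient (E.stableRel C)

/-- The functor `C ⥤ C/∼`. -/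
abbrev toStable (C : ObjectProperty A) : C.FullSubcategory ⥤ E.StableCat C :=
  CategoryTheory.Quotient.functor (E.stableRel C)

/-- The inclusion `C/∼ ⥤ C'/∼` for `C ⊆ C'`. -/
def stableIncl {C C' : ObjectProperty A} (h : C ≤ C') : E.StableCat C ⥤ E.StableCat C' :=
  CategoryTheory.Quotient.lift (E.stableRel C) (ObjectProperty.ιOfLE h ⋙ E.toStable C') (by
    rintro X Y f g ⟨P, t, s, hP, hfg⟩
    exact CategoryTheory.Quotient.sound (E.stableRel C') ⟨P, t, s, hP, hfg⟩)

/-- The category `A / W` for a projective cotorsion pair `(C, W)`: the localization of `A` at the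
weak equivalences of the corresponding model structure. -/
abbrev HoCat (C W : ObjectProperty A) : Type u := (E.model (projTriple C W)).weq.Localization

/-- The localization functor `γ : A ⥤ A / W`. -/
abbrev toHo (C W : ObjectProperty A) : A ⥤ E.HoCat C W := (E.model (projTriple C W)).weq.Q

variable {E} in
lemma IsProjectiveCotorsionPair.weq_fst {C W : ObjectProperty A}
    (h : E.IsProjectiveCotorsionPair C W) (X P : A) (hP : E.projectives P) :
    (E.model (projTriple C W)).weq (biprod.fst : X ⊞ P ⟶ X) := by
  have hW : ∀ Q, E.projectives Q → (C ⊓ W) Q := fun Q hQ => h.inf_eq ▸ hQ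
  have h0 : E.projectives (0 : A) := fun e _ f =>
    ⟨0, (isZero_zero A).eq_of_src _ _⟩
  refine ⟨X ⊞ P, 𝟙 _, biprod.fst, ⟨0, 0, by simp, ?_, hW _ h0⟩,
    ⟨P, biprod.inr, by simp, ?_, ⟨trivial, (hW _ hP).2⟩⟩, by simp⟩
  · exact E.conf_of_splitting _
      { r := 𝟙 _, s := 0, f_r := by simp, s_g := by simp, id := by simp }
  · exact E.conf_of_splitting _
      { r := biprod.snd, s := biprod.inl, f_r := by simp, s_g := by simp,
        id := by simp [add_comm] }

variable {E} in
lemma IsProjectiveCotorsionPair.toHo_map_eq {C W : ObjectProperty A}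
    (h : E.IsProjectiveCotorsionPair C W) {X Y P : A} (f g : X ⟶ Y) (t : X ⟶ P) (s : P ⟶ Y)
    (hP : E.projectives P) (hfg : g - f = t ≫ s) :
    (E.toHo C W).map f = (E.toHo C W).map g := by
  have hw : IsIso ((E.toHo C W).map (biprod.fst : X ⊞ P ⟶ X)) :=
    (E.model (projTriple C W)).weq.Q_inverts _ (h.weq_fst X P hP)
  have key : (E.toHo C W).map (biprod.lift (𝟙 X) (0 : X ⟶ P)) =
      (E.toHo C W).map (biprod.lift (𝟙 X) t) := by
    rw [← cancel_mono ((E.toHo C W).map (biprod.fst : X ⊞ P ⟶ X)), ← Functor.map_comp,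
      ← Functor.map_comp, biprod.lift_fst, biprod.lift_fst]
  have hf : f = biprod.lift (𝟙 X) (0 : X ⟶ P) ≫ biprod.desc f s := by simp
  have hg : g = biprod.lift (𝟙 X) t ≫ biprod.desc f s := by
    rw [biprod.lift_desc, Category.id_comp, ← hfg]; abel
  calc (E.toHo C W).map f
      = (E.toHo C W).map (biprod.lift (𝟙 X) (0 : X ⟶ P) ≫ biprod.desc f s) := by rw [← hf]
    _ = (E.toHo C W).map (biprod.lift (𝟙 X) t ≫ biprod.desc f s) := by
      rw [Functor.map_comp, Functor.map_comp, key]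
    _ = (E.toHo C W).map g := by rw [← hg]

/-- The quotient functor `D/∼ ⥤ A / W`, `[f] ↦ γ f`. -/
noncomputable def quotientFunctor {C W : ObjectProperty A}
    (h : E.IsProjectiveCotorsionPair C W) (D : ObjectProperty A) :
    E.StableCat D ⥤ E.HoCat C W :=
  CategoryTheory.Quotient.lift (E.stableRel D) (D.ι ⋙ E.toHo C W) (by
    rintro X Y f g ⟨P, t, s, hP, hfg⟩
    exact h.toHo_map_eq f.hom g.hom t s hP hfg)

/-- The admissible short exact sequences with all terms in the full subcategory `C`. -/
def confOn (C : ObjectProperty A) : ObjectProperty (ShortComplex C.FullSubcategory) :=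
  fun S => E.conf (S.map C.ι)

/-! ### Functors given by special precovers and special preenvelopes -/

/-- `F : D ⥤ C/∼` takes special `P`-precovers (with kernels in `K`) of the objects `J X`: for
each `X` a special precover `p X : cov X ↠ J X` with `cov X` in `C` is chosen such that, up to
the isomorphisms `iso`, `F` sends `X` to `cov X` and `f` to the class of any lift of `J f`. -/
structure PrecoverPresentation (P K : ObjectProperty A) {D : Type u'} [Category.{v'} D]
    (J : D ⥤ A) {C : ObjectProperty A} (F : D ⥤ E.StableCat C) where
  cov : D → C.FullSubcategory
  cov_mem : ∀ X, P (cov X).obj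
  p : ∀ X, (cov X).obj ⟶ J.obj X
  p_adm : ∀ X, E.admEpi K (p X)
  iso : ∀ X, F.obj X ≅ (E.toStable C).obj (cov X)
  map_eq : ∀ {X Y : D} (f : X ⟶ Y) (g : cov X ⟶ cov Y), g.hom ≫ p Y = p X ≫ J.map f →
    F.map f ≫ (iso Y).hom = (iso X).hom ≫ (E.toStable C).map g

/-- `F : D ⥤ C/∼` takes special `P`-preenvelopes (with cokernels in `K`) of the objects `J X`. -/
structure PreenvelopePresentation (P K : ObjectProperty A) {D : Type u'} [Category.{v'} D]
    (J : D ⥤ A) {C : ObjectProperty A} (F : D ⥤ E.StableCat C) where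
  env : D → C.FullSubcategory
  env_mem : ∀ X, P (env X).obj
  j : ∀ X, J.obj X ⟶ (env X).obj
  j_adm : ∀ X, E.admMono K (j X)
  iso : ∀ X, F.obj X ≅ (E.toStable C).obj (env X)
  map_eq : ∀ {X Y : D} (f : X ⟶ Y) (g : env X ⟶ env Y), j X ≫ g.hom = J.map f ≫ j Y →
    F.map f ≫ (iso Y).hom = (iso X).hom ≫ (E.toStable C).map g

end ExactStructure

/-! ### Triangulated categories and recollements -/

/-- A triangulated structure (including the octahedral axiom) on a category. -/
class TriangulatedStructure (T : Type u) [Category.{v} T] where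
  preadditive : Preadditive T
  hasZeroObject : HasZeroObject T
  hasShift : HasShift T ℤ
  shift_additive : ∀ n : ℤ, (shiftFunctor T n).Additive
  pretriangulated : Pretriangulated T
  isTriangulated : IsTriangulated T

attribute [reducible] TriangulatedStructure.preadditive TriangulatedStructure.hasShift
  TriangulatedStructure.pretriangulated

section

attribute [local instance] TriangulatedStructure.preadditive TriangulatedStructure.hasZeroObject
  TriangulatedStructure.hasShift TriangulatedStructure.shift_additive
  TriangulatedStructure.pretriangulated TriangulatedStructure.isTriangulated

/-- The triangulated structure of `T` is the one induced by the additive functor `γ : D ⥤ T` and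
the class `conf` of short exact sequences in `D`: there are connecting morphisms `δ`, natural in
the short exact sequence, such that the distinguished triangles are exactly those isomorphic to
`γ X₁ ⟶ γ X₂ ⟶ γ X₃ ⟶ (γ X₁)⟦1⟧` for `X₁ ↣ X₂ ↠ X₃` in `conf`. In particular `(γ X)⟦1⟧` is
identified with `γ Y` whenever there is `X ↣ I ↠ Y` in `conf` with `γ I = 0`. -/
def IsInducedTriangulation {D : Type u'} [Category.{v'} D] [Preadditive D]
    (conf : ObjectProperty (ShortComplex D)) {T : Type u} [Category.{v} T]
    [TriangulatedStructure T] (γ : D ⥤ T) : Prop :=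
  γ.Additive ∧
  ∃ δ : ∀ S : ShortComplex D, conf S → (γ.obj S.X₃ ⟶ (γ.obj S.X₁)⟦(1 : ℤ)⟧),
    (∀ (S S' : ShortComplex D) (hS : conf S) (hS' : conf S') (φ : S ⟶ S'),
      δ S hS ≫ (γ.map φ.τ₁)⟦(1 : ℤ)⟧' = γ.map φ.τ₃ ≫ δ S' hS') ∧
    ∀ Δ : Triangle T, Δ ∈ distTriang T ↔
      ∃ (S : ShortComplex D) (hS : conf S),
        Nonempty (Δ ≅ Triangle.mk (γ.map S.f) (γ.map S.g) (δ S hS))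

/-- Exact (that is, triangulated) functors. -/
def IsExactFunctor {T : Type u} [Category.{v} T] [TriangulatedStructure T]
    {T' : Type u'} [Category.{v'} T'] [TriangulatedStructure T'] (F : T ⥤ T') : Prop :=
  ∃ _ : F.CommShift ℤ, F.IsTriangulated

/-- A recollement `T' ⥤ T ⥤ T''` of triangulated categories: exact functors `i` and `j` with left
adjoints `iL`, `jL` and right adjoints `iR`, `jR`, with `i`, `jL`, `jR` fully faithful, and such
that the objects killed by `j` are those isomorphic to some `i X'`. -/
structure IsRecollement {T' : Type u'} [Category.{v'} T'] [TriangulatedStructure T']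
    {T : Type u} [Category.{v} T] [TriangulatedStructure T]
    {T'' : Type u''} [Category.{v''} T''] [TriangulatedStructure T'']
    (i : T' ⥤ T) (iL iR : T ⥤ T') (j : T ⥤ T'') (jL jR : T'' ⥤ T) : Prop where
  exact_i : IsExactFunctor i
  exact_iL : IsExactFunctor iL
  exact_iR : IsExactFunctor iR
  exact_j : IsExactFunctor j
  exact_jL : IsExactFunctor jL
  exact_jR : IsExactFunctor jR
  adj_iL : Nonempty (iL ⊣ i)
  adj_iR : Nonempty (i ⊣ iR)
  adj_jL : Nonempty (jL ⊣ j)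
  adj_jR : Nonempty (j ⊣ jR)
  full_i : i.Full
  faithful_i : i.Faithful
  full_jL : jL.Full
  faithful_jL : jL.Faithful
  full_jR : jR.Full
  faithful_jR : jR.Faithful
  isZero_iff : ∀ X : T, IsZero (j.obj X) ↔ i.essImage X

end

/-! Two facts carry the theorem: a morphism from `C` to `W` of a projective cotorsion pair factors
through a projective, and `W₃ ⊓ C₁ = C₂` says which objects of `C₁` die in `A / W₃`.

Model structures. A morphism `f : X ⟶ Y` extends to an admissible epimorphism `X ⊞ P ⟶ Y` with `P`
in `W`; whether its kernel lies in the thick class `W` does not depend on the extension, and for a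
Hovey triple this is the condition of being a weak equivalence (`IsHoveyTriple.weq_eq`). Two out of
three for morphisms thus becomes two out of three for objects, and a Quillen equivalence becomes a
comparison of two classes on one kernel. The trivial class of a left localization is tested on
special precovers; the horseshoe lemma `exists_horseshoe` turns its thickness into closure
properties of the smaller left class.

Triangulations. Projectives lie in `W₁ = C₁⊥`, so `C₁` is a Frobenius exact category and `C₁/∼` is
triangulated with conflations as triangles. Special precovers and preenvelopes are unique up to
morphisms through projectives, so they give adjoint functors between stable categories. In
particular `C(M₃)` embeds `A / W₃` in `C₁/∼` with essential image that of `C₃/∼`. The triangulations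
of `C₂/∼` and `A / W₃` are pulled back along full embeddings in `C₁/∼`, and adjoints of exact
functors are exact.

Recollement. It remains to find the right adjoint of `Q`. For `X` in `C₁` the kernel of a special
`C₃`-precover lies in `W₃ ⊓ C₁ = C₂`, and neither this kernel nor its shift has nonzero stable
morphisms to `W₂`. Hence `Q` is bijective on morphisms into objects of `W₂ ⊓ C₁`
(`quotientFunctor_map_bijective`). Special `W₂`-preenvelopes have cokernel in `C₂ ≤ W₃`, so they do
not change the image under `Q`. Therefore `Q` is the reflection `E(M₂)` followed by an equivalence
`(W₂ ⊓ C₁)/∼ ≌ A / W₃`, whose inverse followed by the inclusion is `ρ`. -/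

set_option linter.unusedSectionVars false

/-! ### Exact categories -/

namespace ExactStructure

variable {A : Type u} [Category.{v} A] [Preadditive A] [HasZeroObject A] [HasBinaryBiproducts A]
variable (E : ExactStructure A)

/-- `X ⟶ Y ⟶ Z` is an admissible short exact sequence. -/
def Conf {X Y Z : A} (f : X ⟶ Y) (g : Y ⟶ Z) : Prop :=
  ∃ w : f ≫ g = 0, E.conf (ShortComplex.mk f g w)

/-- Admissible monomorphisms. -/
def Infl {X Y : A} (f : X ⟶ Y) : Prop := ∃ (C : A) (p : Y ⟶ C), E.Conf f p

/-- Admissible epimorphisms. -/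
def Defl {X Y : A} (f : X ⟶ Y) : Prop := ∃ (K : A) (i : K ⟶ X), E.Conf i f

variable {E}

lemma Conf.infl {X Y Z : A} {f : X ⟶ Y} {g : Y ⟶ Z} (h : E.Conf f g) : E.Infl f := ⟨_, _, h⟩

lemma Conf.defl {X Y Z : A} {f : X ⟶ Y} {g : Y ⟶ Z} (h : E.Conf f g) : E.Defl g := ⟨_, _, h⟩

lemma conf_mk_iff {X Y Z : A} {f : X ⟶ Y} {g : Y ⟶ Z} (w : f ≫ g = 0) :
    E.conf (ShortComplex.mk f g w) ↔ E.Conf f g := ⟨fun h => ⟨w, h⟩, fun h => h.2⟩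

lemma conf_iff (S : ShortComplex A) : E.conf S ↔ E.Conf S.f S.g := conf_mk_iff S.zero

lemma admMono_iff {Q : ObjectProperty A} {X Y : A} {f : X ⟶ Y} :
    E.admMono Q f ↔ ∃ (C : A) (p : Y ⟶ C), E.Conf f p ∧ Q C :=
  ⟨fun ⟨C, p, w, h, hC⟩ => ⟨C, p, ⟨w, h⟩, hC⟩, fun ⟨C, p, ⟨w, h⟩, hC⟩ => ⟨C, p, w, h, hC⟩⟩

lemma admEpi_iff {Q : ObjectProperty A} {X Y : A} {f : X ⟶ Y} :
    E.admEpi Q f ↔ ∃ (K : A) (i : K ⟶ X), E.Conf i f ∧ Q K :=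
  ⟨fun ⟨C, p, w, h, hC⟩ => ⟨C, p, ⟨w, h⟩, hC⟩, fun ⟨C, p, ⟨w, h⟩, hC⟩ => ⟨C, p, w, h, hC⟩⟩

lemma Defl.admEpi_top {X Y : A} {f : X ⟶ Y} (h : E.Defl f) : E.admEpi ⊤ f :=
  let ⟨K, i, hi⟩ := h
  admEpi_iff.2 ⟨K, i, hi, trivial⟩

lemma defl_of_admEpi {R : ObjectProperty A} {X Y : A} {f : X ⟶ Y} (h : E.admEpi R f) :
    E.Defl f :=
  let ⟨K, i, hi, _⟩ := admEpi_iff.1 h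
  ⟨K, i, hi⟩

namespace Conf

section

variable {X Y Z : A} {f : X ⟶ Y} {g : Y ⟶ Z} (h : E.Conf f g)
include h

lemma zero : f ≫ g = 0 := h.1

lemma exists_lift {T : A} (k : T ⟶ Y) (hk : k ≫ g = 0) : ∃ l : T ⟶ X, l ≫ f = k := by
  obtain ⟨w, h⟩ := h
  obtain ⟨hl⟩ := E.isKernel _ h
  exact ⟨hl.lift (KernelFork.ofι k hk), Fork.IsLimit.lift_ι hl⟩

lemma exists_desc {T : A} (k : Y ⟶ T) (hk : f ≫ k = 0) : ∃ l : Z ⟶ T, g ≫ l = k := by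
  obtain ⟨w, h⟩ := h
  obtain ⟨hl⟩ := E.isCokernel _ h
  exact ⟨hl.desc (CokernelCofork.ofπ k hk), Cofork.IsColimit.π_desc hl⟩

lemma mono : Mono f := by
  obtain ⟨w, h⟩ := h
  obtain ⟨hl⟩ := E.isKernel _ h
  exact mono_of_isLimit_fork hl

lemma epi : Epi g := by
  obtain ⟨w, h⟩ := h
  obtain ⟨hl⟩ := E.isCokernel _ h
  exact epi_of_isColimit_cofork hl

lemma of_iso {X' Y' Z' : A} {f' : X' ⟶ Y'} {g' : Y' ⟶ Z'} (e₁ : X ≅ X') (e₂ : Y ≅ Y')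
    (e₃ : Z ≅ Z') (h₁ : e₁.hom ≫ f' = f ≫ e₂.hom) (h₂ : e₂.hom ≫ g' = g ≫ e₃.hom) :
    E.Conf f' g' := by
  obtain ⟨w, h⟩ := h
  have w' : f' ≫ g' = 0 := by
    rw [← cancel_epi e₁.hom, reassoc_of% h₁, h₂, reassoc_of% w, zero_comp, comp_zero]
  exact ⟨w', E.conf_of_iso (S := ShortComplex.mk f g w) (T := ShortComplex.mk f' g' w')
    (ShortComplex.isoMk e₁ e₂ e₃ h₁ h₂) h⟩

lemma of_isCokernel {Z' : A} (g' : Y ⟶ Z') [Epi g'] (w' : f ≫ g' = 0)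
    (hg' : ∀ {T : A} (t : Y ⟶ T), f ≫ t = 0 → ∃ l, g' ≫ l = t) : E.Conf f g' := by
  obtain ⟨a, ha⟩ := h.exists_desc g' w'
  obtain ⟨b, hb⟩ := hg' g h.zero
  have := h.epi
  refine h.of_iso (Iso.refl _) (Iso.refl _) ⟨a, b, ?_, ?_⟩ (by simp) (by simp [ha])
  · rw [← cancel_epi g, reassoc_of% ha, hb, Category.comp_id]
  · rw [← cancel_epi g', reassoc_of% hb, ha, Category.comp_id]

end

lemma of_splitting {X Y Z : A} {f : X ⟶ Y} {g : Y ⟶ Z} (w : f ≫ g = 0) (r : Y ⟶ X) (s : Z ⟶ Y)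
    (hr : f ≫ r = 𝟙 X) (hs : s ≫ g = 𝟙 Z) (h : r ≫ f + g ≫ s = 𝟙 Y) : E.Conf f g :=
  ⟨w, E.conf_of_splitting _ { r := r, s := s, f_r := hr, s_g := hs, id := h }⟩

variable (E) in
lemma inl_snd (X Y : A) : E.Conf (biprod.inl : X ⟶ X ⊞ Y) biprod.snd :=
  of_splitting (by simp) biprod.fst biprod.inr (by simp) (by simp) (by simp)

variable (E) in
lemma id_zero {X Z : A} (hZ : IsZero Z) : E.Conf (𝟙 X) (0 : X ⟶ Z) :=
  of_splitting (by simp) (𝟙 X) 0 (by simp) (hZ.eq_of_src _ _) (by simp)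

variable (E) in
lemma zero_id {X Z : A} (hZ : IsZero Z) : E.Conf (0 : Z ⟶ X) (𝟙 X) :=
  of_splitting (by simp) 0 (𝟙 X) (hZ.eq_of_src _ _) (by simp) (by simp)

end Conf

lemma Infl.comp {X Y Z : A} {f : X ⟶ Y} {g : Y ⟶ Z} (hf : E.Infl f) (hg : E.Infl g) :
    E.Infl (f ≫ g) := by
  obtain ⟨C, p, w, h⟩ := hf
  obtain ⟨C', p', w', h'⟩ := hg
  obtain ⟨D, q, w, h⟩ := E.mono_comp f g ⟨C, p, w, h⟩ ⟨C', p', w', h'⟩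
  exact ⟨D, q, w, h⟩

lemma Defl.comp {X Y Z : A} {f : X ⟶ Y} {g : Y ⟶ Z} (hf : E.Defl f) (hg : E.Defl g) :
    E.Defl (f ≫ g) := by
  obtain ⟨C, p, w, h⟩ := hf
  obtain ⟨C', p', w', h'⟩ := hg
  obtain ⟨D, q, w, h⟩ := E.epi_comp f g ⟨C, p, w, h⟩ ⟨C', p', w', h'⟩
  exact ⟨D, q, w, h⟩

/-! ### Duality, pushouts, pullbacks and Noether isomorphisms -/

/-- The opposite exact structure. -/
def op (E : ExactStructure A) : ExactStructure Aᵒᵖ where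
  conf S := E.conf S.unop
  isKernel S h := (E.isCokernel _ h).map fun hl => CokernelCofork.IsColimit.ofπOp _ _ hl
  isCokernel S h := (E.isKernel _ h).map fun hl => KernelFork.IsLimit.ofιOp _ _ hl
  conf_of_iso {S T} e h := E.conf_of_iso (S := S.unop) (T := T.unop) (ShortComplex.isoMk
    (ShortComplex.π₃.mapIso e).unop.symm (ShortComplex.π₂.mapIso e).unop.symm
    (ShortComplex.π₁.mapIso e).unop.symm
    (congrArg Quiver.Hom.unop e.inv.comm₂₃.symm) (congrArg Quiver.Hom.unop e.inv.comm₁₂.symm)) h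
  conf_of_splitting S s := E.conf_of_splitting _ s.unop
  mono_comp := by
    rintro X Y Z f g ⟨C, p, w, h⟩ ⟨C', p', w', h'⟩
    obtain ⟨D, q, w, h⟩ := E.epi_comp g.unop f.unop
      ⟨_, p'.unop, congrArg Quiver.Hom.unop w', h'⟩ ⟨_, p.unop, congrArg Quiver.Hom.unop w, h⟩
    exact ⟨.op D, q.op, congrArg Quiver.Hom.op w, h⟩
  epi_comp := by
    rintro X Y Z f g ⟨C, p, w, h⟩ ⟨C', p', w', h'⟩
    obtain ⟨D, q, w, h⟩ := E.mono_comp g.unop f.unop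
      ⟨_, p'.unop, congrArg Quiver.Hom.unop w', h'⟩ ⟨_, p.unop, congrArg Quiver.Hom.unop w, h⟩
    exact ⟨.op D, q.op, congrArg Quiver.Hom.op w, h⟩
  mono_pushout := by
    rintro X Y X' f a ⟨C, p, w, h⟩
    obtain ⟨Y', a', f', sq, D, q, w, h⟩ := E.epi_pullback f.unop a.unop
      ⟨_, p.unop, congrArg Quiver.Hom.unop w, h⟩
    exact ⟨.op Y', a'.op, f'.op, sq.op.flip, .op D, q.op, congrArg Quiver.Hom.op w, h⟩
  epi_pullback := by
    rintro X Y X' f a ⟨C, p, w, h⟩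
    obtain ⟨Y', a', f', sq, D, q, w, h⟩ := E.mono_pushout f.unop a.unop
      ⟨_, p.unop, congrArg Quiver.Hom.unop w, h⟩
    exact ⟨.op Y', a'.op, f'.op, sq.op.flip, .op D, q.op, congrArg Quiver.Hom.op w, h⟩

lemma Conf.op {X Y Z : A} {f : X ⟶ Y} {g : Y ⟶ Z} (h : E.Conf f g) : E.op.Conf g.op f.op :=
  ⟨congrArg Quiver.Hom.op h.1, h.2⟩

lemma Conf.unop {X Y Z : Aᵒᵖ} {f : X ⟶ Y} {g : Y ⟶ Z} (h : E.op.Conf f g) :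
    E.Conf g.unop f.unop :=
  ⟨congrArg Quiver.Hom.unop h.1, h.2⟩

/-- The axiom provides only some cokernel of `f'`. The universal property of the square turns `p`
and `0` into a morphism `d` to `Z`; it is a cokernel of `f'` too, because a morphism that kills `f'`
restricts along `a'` to one that kills `f`. -/
lemma Conf.exists_pushout {X Y Z X' : A} {f : X ⟶ Y} {p : Y ⟶ Z} (h : E.Conf f p) (a : X ⟶ X') :
    ∃ (Y' : A) (a' : Y ⟶ Y') (f' : X' ⟶ Y') (p' : Y' ⟶ Z),
      IsPushout f a a' f' ∧ E.Conf f' p' ∧ a' ≫ p' = p := by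
  obtain ⟨w, h'⟩ := id h
  obtain ⟨Y', a', f', sq, C, q, w', hq⟩ := E.mono_pushout f a ⟨Z, p, w, h'⟩
  obtain ⟨d, hd, hd'⟩ : ∃ d, a' ≫ d = p ∧ f' ≫ d = 0 :=
    ⟨sq.desc p 0 (by simp [w]), by simp, by simp⟩
  have hq : E.Conf f' q := ⟨w', hq⟩
  have := h.epi
  have : Epi d := epi_of_epi_fac hd
  refine ⟨Y', a', f', d, sq, hq.of_isCokernel _ hd' ?_, hd⟩
  intro T t ht
  obtain ⟨l, hl⟩ := h.exists_desc (a' ≫ t) (by simp [sq.w_assoc, ht])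
  exact ⟨l, sq.hom_ext (by simp [hl, reassoc_of% hd]) (by simp [ht, reassoc_of% hd'])⟩

lemma Conf.exists_pullback {X Y Z Z' : A} {f : X ⟶ Y} {p : Y ⟶ Z} (h : E.Conf f p) (a : Z' ⟶ Z) :
    ∃ (Y' : A) (a' : Y' ⟶ Y) (p' : Y' ⟶ Z') (f' : X ⟶ Y'),
      IsPullback a' p' p a ∧ E.Conf f' p' ∧ f' ≫ a' = f := by
  obtain ⟨Y', a', p', f', sq, hc, hf⟩ := h.op.exists_pushout a.op
  exact ⟨Y'.unop, a'.unop, p'.unop, f'.unop, sq.unop.flip, hc.unop,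
    congrArg Quiver.Hom.unop hf⟩

/-- The pullback of two admissible epimorphisms. -/
lemma Conf.exists_pullback₂ {X Y Z X' Y' : A} {f : X ⟶ Y} {g : Y ⟶ Z} (h : E.Conf f g)
    {f' : X' ⟶ Y'} {g' : Y' ⟶ Z} (h' : E.Conf f' g') :
    ∃ (D : A) (a : D ⟶ Y) (a' : D ⟶ Y') (i : X ⟶ D) (i' : X' ⟶ D),
      IsPullback a a' g g' ∧ E.Conf i a' ∧ E.Conf i' a ∧ i ≫ a = f ∧ i' ≫ a' = f' := by
  obtain ⟨D, a, a', i, sq, hc, hi⟩ := h.exists_pullback g'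
  refine ⟨D, a, a', i, sq.lift 0 f' (by simp [h'.zero]), sq, hc, ?_, hi, by simp⟩
  -- The same pullback formed with the two epimorphisms exchanged; comparing the squares yields the
  -- second conflation.
  obtain ⟨D₂, b', b, j, sq₂, hc₂, hj⟩ := h'.exists_pullback g
  let e : D₂ ≅ D := sq₂.flip.isoIsPullback _ _ sq
  refine hc₂.of_iso (Iso.refl _) e (Iso.refl _) ?_ (by simp [e])
  refine sq.hom_ext ?_ ?_
  · simp [e, hc₂.zero]
  · simp [e, hj]

/-- A morphism of conflations which is the identity on cokernels gives a conflation. -/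
lemma Conf.mappingCone {X Y Z X' Y' : A} {f : X ⟶ Y} {g : Y ⟶ Z} (h : E.Conf f g)
    {f' : X' ⟶ Y'} {g' : Y' ⟶ Z} (h' : E.Conf f' g') (u : X ⟶ X') (v : Y ⟶ Y')
    (h₁ : f ≫ v = u ≫ f') (h₂ : v ≫ g' = g) :
    E.Conf (biprod.lift f u) (biprod.desc v (-f')) := by
  obtain ⟨D, a, a', i, i', sq, hi, hi', hia, hia'⟩ := h.exists_pullback₂ h'
  -- The pullback `D` of `g` and `g'` is split over `Y` by `(1, v)`, so `D ≅ Y ⊞ X'`. Under this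
  -- isomorphism the conflation with maps `i` and `a'` becomes the claimed one; the sign of `r` is
  -- chosen so that `a'` becomes `(v, -f')`.
  let s : Y ⟶ D := sq.lift (𝟙 Y) v (by simp [h₂])
  obtain ⟨r, hr⟩ := hi'.exists_lift (a ≫ s - 𝟙 D) (by simp [s])
  have := hi'.mono
  have hsr : s ≫ r = 0 := by
    rw [← cancel_mono i', Category.assoc, hr]; simp [s]
  have hir : i' ≫ r = -𝟙 _ := by
    rw [← cancel_mono i', Category.assoc, hr]; simp [s, reassoc_of% hi'.zero]
  have hiu : i ≫ r = u := by
    have := h'.mono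
    rw [← cancel_mono i', Category.assoc, hr]
    refine sq.hom_ext ?_ ?_
    · simp [s, hia, hi'.zero]
    · simp [s, reassoc_of% hia, hi.zero, hia', h₁]
  refine hi.of_iso (Iso.refl _) ⟨biprod.lift a r, biprod.desc s (-i'), ?_, ?_⟩ (Iso.refl _) ?_ ?_
  · simp [hr]
  · ext <;> simp [hsr, hir, s, hi'.zero]
  · ext <;> simp [hia, hiu]
  · have : r ≫ f' = a ≫ v - a' := by rw [← hia', reassoc_of% hr]; simp [s]
    simp [this]

/-- A morphism of conflations which is the identity on kernels gives a conflation. -/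
lemma Conf.mappingCocone {X Y Z Y' Z' : A} {f : X ⟶ Y} {g : Y ⟶ Z} (h : E.Conf f g)
    {f' : X ⟶ Y'} {g' : Y' ⟶ Z'} (h' : E.Conf f' g') (v : Y ⟶ Y') (w : Z ⟶ Z')
    (h₁ : f ≫ v = f') (h₂ : v ≫ g' = g ≫ w) :
    E.Conf (biprod.lift v g) (biprod.desc g' (-w)) := by
  -- The dual of `mappingCone`, with the roles of the two conflations exchanged. What remains is to
  -- identify the biproduct of the opposite category, read in `A`, with the biproduct of `A`.
  have H := (h'.op.mappingCone h.op w.op v.op (congrArg Quiver.Hom.op h₂)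
    (congrArg Quiver.Hom.op h₁)).unop
  have e₁ : (biprod.inl : Opposite.op Y' ⟶ Opposite.op Y' ⊞ Opposite.op Z).unop ≫
    (biprod.fst : Opposite.op Y' ⊞ Opposite.op Z ⟶ _).unop + biprod.inr.unop ≫ biprod.snd.unop =
      𝟙 _ := congrArg Quiver.Hom.unop (biprod.total (X := Opposite.op Y') (Y := Opposite.op Z))
  have e₂ : (biprod.fst : Opposite.op Y' ⊞ Opposite.op Z ⟶ _).unop ≫ biprod.inl.unop = 𝟙 Y' :=
    congrArg Quiver.Hom.unop (biprod.inl_fst (X := Opposite.op Y') (Y := Opposite.op Z))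
  have e₃ : (biprod.fst : Opposite.op Y' ⊞ Opposite.op Z ⟶ _).unop ≫ biprod.inr.unop = 0 :=
    congrArg Quiver.Hom.unop (biprod.inr_fst (X := Opposite.op Y') (Y := Opposite.op Z))
  have e₄ : (biprod.snd : Opposite.op Y' ⊞ Opposite.op Z ⟶ _).unop ≫ biprod.inl.unop = 0 :=
    congrArg Quiver.Hom.unop (biprod.inl_snd (X := Opposite.op Y') (Y := Opposite.op Z))
  have e₅ : (biprod.snd : Opposite.op Y' ⊞ Opposite.op Z ⟶ _).unop ≫ biprod.inr.unop = 𝟙 Z :=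
    congrArg Quiver.Hom.unop (biprod.inr_snd (X := Opposite.op Y') (Y := Opposite.op Z))
  have e₆ := congrArg Quiver.Hom.unop (biprod.inl_desc v.op (-g.op))
  have e₇ := congrArg Quiver.Hom.unop (biprod.inr_desc v.op (-g.op))
  have e₈ : (biprod.lift g'.op w.op).unop = biprod.inl.unop ≫ g' + biprod.inr.unop ≫ w := by
    rw [biprod.lift_eq]; rfl
  dsimp at e₆ e₇
  -- The sign on the second summand moves the minus of the dual cone from `g` to `w`.
  refine H.of_iso (Iso.refl _) ⟨biprod.lift biprod.inl.unop (-biprod.inr.unop),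
    biprod.desc biprod.fst.unop (-biprod.snd.unop), ?_, ?_⟩ (Iso.refl _) ?_ ?_
  · simpa using e₁
  · ext <;> simp [e₂, e₃, e₄, e₅]
  · ext <;> simp [e₆, e₇]
  · simp [e₈]

lemma Conf.exists_cokernelIso {X Y Z Z' : A} {f : X ⟶ Y} {p : Y ⟶ Z} {p' : Y ⟶ Z'}
    (h : E.Conf f p) (h' : E.Conf f p') : ∃ e : Z ≅ Z', p ≫ e.hom = p' := by
  obtain ⟨a, ha⟩ := h.exists_desc p' h'.zero
  obtain ⟨b, hb⟩ := h'.exists_desc p h.zero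
  have := h.epi
  have := h'.epi
  refine ⟨⟨a, b, ?_, ?_⟩, ha⟩
  · rw [← cancel_epi p, reassoc_of% ha, hb, Category.comp_id]
  · rw [← cancel_epi p', reassoc_of% hb, ha, Category.comp_id]

lemma Conf.exists_kernelIso {X X' Y Z : A} {f : X ⟶ Y} {f' : X' ⟶ Y} {p : Y ⟶ Z}
    (h : E.Conf f p) (h' : E.Conf f' p) : ∃ e : X ≅ X', e.hom ≫ f' = f := by
  obtain ⟨e, he⟩ := h'.op.exists_cokernelIso h.op
  exact ⟨e.unop, congrArg Quiver.Hom.unop he⟩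

/-- Noether's isomorphism theorem `(Z/X)/(Y/X) = Z/Y`. -/
lemma Conf.noether {X Y Z C D N : A} {f : X ⟶ Y} {p : Y ⟶ C} {g : Y ⟶ Z} {q : Z ⟶ D} {r : Z ⟶ N}
    (h₁ : E.Conf f p) (h₂ : E.Conf g q) (h₃ : E.Conf (f ≫ g) r) :
    ∃ (c : C ⟶ N) (d : N ⟶ D), E.Conf c d ∧ p ≫ c = g ≫ r ∧ r ≫ d = q := by
  -- The pushout of `g` along `p` has cokernel `D`. Its leg `a` is a cokernel of `f ≫ g`, so the
  -- pushout is `N`.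
  obtain ⟨N', a, g', q', sq, hc, hq⟩ := h₂.exists_pushout p
  have := h₁.epi
  have : Epi a := ⟨fun t t' ht => sq.hom_ext ht (by
    rw [← cancel_epi p, ← sq.w_assoc, ht, sq.w_assoc])⟩
  have h₄ : E.Conf (f ≫ g) a := by
    refine h₃.of_isCokernel a (by simp [sq.w, reassoc_of% h₁.zero]) ?_
    intro T t ht
    obtain ⟨l, hl⟩ := h₁.exists_desc (g ≫ t) (by simpa using ht)
    exact ⟨sq.desc t l hl.symm, by simp⟩
  obtain ⟨e, he⟩ := h₄.exists_cokernelIso h₃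
  refine ⟨g' ≫ e.hom, e.inv ≫ q', hc.of_iso (Iso.refl _) e (Iso.refl _) (by simp) (by simp),
    ?_, ?_⟩
  · rw [← sq.w_assoc, he]
  · rw [← he]; simp [hq]

lemma Conf.noether' {X Y Z K L N : A} {f : X ⟶ Y} {k : K ⟶ X} {g : Y ⟶ Z} {l : L ⟶ Y} {n : N ⟶ X}
    (h₁ : E.Conf k f) (h₂ : E.Conf l g) (h₃ : E.Conf n (f ≫ g)) :
    ∃ (c : K ⟶ N) (d : N ⟶ L), E.Conf c d ∧ c ≫ n = k ∧ d ≫ l = n ≫ f := by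
  obtain ⟨d, c, hc, h, h'⟩ := Conf.noether (E := E.op) (r := n.op) h₂.op h₁.op h₃.op
  exact ⟨c.unop, d.unop, hc.unop, congrArg Quiver.Hom.unop h', congrArg Quiver.Hom.unop h⟩

/-- The morphism `(f, e)` is `1 ⊞ e : X ⊞ P ⟶ X ⊞ Y` followed by `(f, 1)`. The first factor is a
pullback of `e` along the projection to `Y`, the second is a split epimorphism with kernel `X`. -/
lemma Defl.biprodDesc {X P Y : A} (f : X ⟶ Y) {e : P ⟶ Y} (he : E.Defl e) :
    E.Defl (biprod.desc f e) := by
  obtain ⟨K, i, h⟩ := he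
  obtain ⟨D, a, a', j, sq, hc, hj⟩ := h.exists_pullback (biprod.snd : X ⊞ Y ⟶ Y)
  have h₁ : E.Defl (biprod.desc f (𝟙 Y)) :=
    ⟨X, biprod.lift (𝟙 X) (-f), Conf.of_splitting (by simp) biprod.fst biprod.inr (by simp)
      (by simp) (by ext <;> simp)⟩
  have h₂ : a' ≫ biprod.desc f (𝟙 Y) =
    biprod.lift (a' ≫ biprod.fst) a ≫ biprod.desc f e := by
    have : biprod.desc f (𝟙 Y) = biprod.fst ≫ f + biprod.snd := by ext <;> simp
    simp [this, sq.w]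
  obtain ⟨K', i', h'⟩ := hc.defl.comp h₁
  refine ⟨K', i' ≫ biprod.lift (a' ≫ biprod.fst) a, h'.of_iso (Iso.refl _)
    ⟨biprod.lift (a' ≫ biprod.fst) a, sq.lift biprod.snd
      (biprod.lift biprod.fst (biprod.snd ≫ e)) (by simp), ?_, ?_⟩ (Iso.refl _) (by simp) (by
      simp [h₂])⟩
  · refine sq.hom_ext (by simp) ?_
    ext <;> simp [sq.w]
  · ext <;> simp

lemma Infl.biprodLift {X Y Z : A} {m : X ⟶ Z} (hm : E.Infl m) (f : X ⟶ Y) :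
    E.Infl (biprod.lift m f) := by
  obtain ⟨C, p, h⟩ := hm
  obtain ⟨Y', a, f', p', sq, hc, hp⟩ := h.exists_pushout f
  exact (h.mappingCone hc f a sq.w hp).infl

/-- The idempotent `1 - r ≫ s` factors through the cokernel of `s`, which is therefore also the
kernel of `r` and a complement of `X`. -/
lemma Conf.of_retraction (hA : WeaklyIdempotentComplete A) {X Y : A} (s : X ⟶ Y) (r : Y ⟶ X)
    (h : s ≫ r = 𝟙 X) : ∃ (D : A) (c : Y ⟶ D) (t : D ⟶ Y), E.Conf s c ∧ E.Conf t r ∧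
      t ≫ c = 𝟙 D ∧ r ≫ s + c ≫ t = 𝟙 Y := by
  have : HasCokernel s := hA s ⟨⟨⟨r, h⟩⟩⟩
  let t := cokernel.desc s (𝟙 Y - r ≫ s) (by simp [reassoc_of% h])
  have ht : t ≫ cokernel.π s = 𝟙 _ := by
    rw [← cancel_epi (cokernel.π s)]
    simp [t]
  have htr : t ≫ r = 0 := by
    rw [← cancel_epi (cokernel.π s)]
    simp [t, h]
  exact ⟨cokernel s, cokernel.π s, t, of_splitting (by simp) r t h ht (by simp [t]),
    of_splitting htr (cokernel.π s) s ht h (by simp [t]), ht, by simp [t]⟩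

/-- Dually, a split epimorphism must have a kernel: the cokernel of a section serves as one. -/
lemma _root_.WeaklyIdempotentComplete.op (hA : WeaklyIdempotentComplete A) :
    WeaklyIdempotentComplete Aᵒᵖ := by
  rintro X Y f ⟨⟨r, h⟩⟩
  let E₀ : ∃ (D : A) (t : D ⟶ Y.unop) (c : Y.unop ⟶ D), t ≫ f.unop = 0 ∧ t ≫ c = 𝟙 D ∧
      f.unop ≫ r.unop + c ≫ t = 𝟙 _ := by
    have : HasCokernel r.unop := hA r.unop ⟨⟨⟨f.unop, congrArg Quiver.Hom.unop h⟩⟩⟩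
    have h' : r.unop ≫ f.unop = 𝟙 _ := congrArg Quiver.Hom.unop h
    let t := cokernel.desc r.unop (𝟙 _ - f.unop ≫ r.unop) (by simp [reassoc_of% h'])
    refine ⟨_, t, cokernel.π r.unop, ?_, ?_, by simp [t]⟩
    · rw [← cancel_epi (cokernel.π r.unop)]
      simp [t, h']
    · rw [← cancel_epi (cokernel.π r.unop)]
      simp [t]
  obtain ⟨D, t, c, h₁, h₂, h₃⟩ := E₀
  have : Mono t := mono_of_mono_fac h₂
  refine ⟨⟨⟨CokernelCofork.ofπ t.op (congrArg Quiver.Hom.op h₁), ?_⟩⟩⟩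
  refine KernelFork.IsLimit.ofιOp (f := f.unop) t h₁ (KernelFork.IsLimit.ofι' t h₁ fun k hk =>
    ⟨k ≫ c, ?_⟩)
  simpa [reassoc_of% hk] using congrArg (fun t => k ≫ t) h₃

/-- First `(f ≫ g, f) : X ⟶ Z ⊞ Y` is an admissible monomorphism, and an automorphism of `Z ⊞ Y`
turns it into `(0, f)`. The summand `Z` injects as a retract in the cokernel of `(0, f)`, with
complement `D'`. Pulling the conflation back to `D'` cuts the middle term down to `Y`. -/
lemma Infl.of_comp (hA : WeaklyIdempotentComplete A) {X Y Z : A} {f : X ⟶ Y} {g : Y ⟶ Z}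
    (h : E.Infl (f ≫ g)) : E.Infl f := by
  obtain ⟨D, q, hq⟩ := h.biprodLift f
  let e : Z ⊞ Y ≅ Z ⊞ Y :=
    { hom := biprod.lift (biprod.fst - biprod.snd ≫ g) biprod.snd
      inv := biprod.lift (biprod.fst + biprod.snd ≫ g) biprod.snd
      hom_inv_id := by ext <;> simp
      inv_hom_id := by ext <;> simp }
  have hq' : E.Conf (biprod.lift (0 : X ⟶ Z) f) (e.inv ≫ q) := by
    refine hq.of_iso (Iso.refl _) e (Iso.refl _) ?_ (by simp)
    ext <;> simp [e]
  obtain ⟨ρ, hρ⟩ := hq'.exists_desc biprod.fst (by simp)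
  obtain ⟨D', -, τ, -, hτ, -⟩ := Conf.of_retraction (E := E) hA (biprod.inl ≫ e.inv ≫ q) ρ
    (by rw [Category.assoc, hρ, biprod.inl_fst])
  obtain ⟨Y', a, p, f', sq, hc, hf'⟩ := hq'.exists_pullback τ
  have ha : a ≫ biprod.fst = 0 := by rw [← hρ, sq.w_assoc, hτ.zero, comp_zero]
  obtain ⟨l, hl⟩ := hτ.exists_lift (biprod.inr ≫ e.inv ≫ q) (by
    rw [Category.assoc, hρ, biprod.inr_fst])
  have hb : a = (a ≫ biprod.snd) ≫ biprod.inr := by ext <;> simp [ha]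
  refine ⟨D', l, hc.of_iso (Iso.refl _) ⟨a ≫ biprod.snd, sq.lift biprod.inr l hl.symm, ?_, ?_⟩
    (Iso.refl _) ?_ ?_⟩
  · refine sq.hom_ext (by simpa using hb.symm) ?_
    have := hτ.mono
    rw [← cancel_mono τ]
    simp only [Category.assoc, sq.lift_snd, hl]
    rw [← Category.assoc, ← Category.assoc, ← hb, sq.w, Category.id_comp]
  · simp
  · simp [reassoc_of% hf']
  · have := hτ.mono
    rw [← cancel_mono τ]
    simp only [Category.assoc, hl, Iso.refl_hom, Category.comp_id, ← sq.w]
    rw [← Category.assoc, ← Category.assoc, ← hb]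

end ExactStructure

/-! ### Cotorsion pairs -/

namespace ExactStructure

variable {A : Type u} [Category.{v} A] [Preadditive A] [HasZeroObject A] [HasBinaryBiproducts A]
variable {E : ExactStructure A}

lemma Conf.exists_pushout₂ {X Y Z Y' Z' : A} {f : X ⟶ Y} {g : Y ⟶ Z} (h : E.Conf f g)
    {f' : X ⟶ Y'} {g' : Y' ⟶ Z'} (h' : E.Conf f' g') :
    ∃ (D : A) (a : Y ⟶ D) (a' : Y' ⟶ D) (p : D ⟶ Z) (p' : D ⟶ Z'),
      IsPushout f f' a a' ∧ E.Conf a' p ∧ E.Conf a p' ∧ a ≫ p = g ∧ a' ≫ p' = g' := by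
  obtain ⟨D, a, a', p, p', sq, h₁, h₂, h₃, h₄⟩ := h.op.exists_pullback₂ h'.op
  exact ⟨_, _, _, _, _, sq.unop.flip, h₁.unop, h₂.unop, congrArg Quiver.Hom.unop h₃,
    congrArg Quiver.Hom.unop h₄⟩

lemma projectives.exists_lift {P : A} (hP : E.projectives P) {X Y : A} {e : X ⟶ Y} (he : E.Defl e)
    (f : P ⟶ Y) : ∃ g : P ⟶ X, g ≫ e = f := hP e he.admEpi_top f

lemma HasEnoughProjectives.exists_conf (hE : E.HasEnoughProjectives) (X : A) :
    ∃ (K P : A) (i : K ⟶ P) (e : P ⟶ X), E.projectives P ∧ E.Conf i e := by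
  obtain ⟨P, e, hP, he⟩ := hE X
  obtain ⟨K, i, hi⟩ := defl_of_admEpi he
  exact ⟨K, P, i, e, hP, hi⟩

/-- Splitting of a conflation by a section. -/
lemma Conf.exists_retraction {X Y Z : A} {f : X ⟶ Y} {g : Y ⟶ Z} (h : E.Conf f g) {s : Z ⟶ Y}
    (hs : s ≫ g = 𝟙 Z) : ∃ r : Y ⟶ X, f ≫ r = 𝟙 X ∧ s ≫ r = 0 ∧ r ≫ f + g ≫ s = 𝟙 Y := by
  obtain ⟨r, hr⟩ := h.exists_lift (𝟙 Y - g ≫ s) (by simp [hs])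
  have := h.mono
  refine ⟨r, ?_, ?_, by simp [hr]⟩
  · rw [← cancel_mono f, Category.assoc, hr]
    simp [reassoc_of% h.zero]
  · rw [← cancel_mono f, Category.assoc, hr]
    simp [reassoc_of% hs]

lemma Conf.exists_section {X Y Z : A} {f : X ⟶ Y} {g : Y ⟶ Z} (h : E.Conf f g) {r : Y ⟶ X}
    (hr : f ≫ r = 𝟙 X) : ∃ s : Z ⟶ Y, s ≫ g = 𝟙 Z ∧ s ≫ r = 0 ∧ r ≫ f + g ≫ s = 𝟙 Y := by
  obtain ⟨s, hs⟩ := h.exists_desc (𝟙 Y - r ≫ f) (by simp [reassoc_of% hr])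
  have := h.epi
  refine ⟨s, ?_, ?_, by simp [hs]⟩
  · rw [← cancel_epi g, reassoc_of% hs]
    simp [h.zero]
  · rw [← cancel_epi g, reassoc_of% hs]
    simp [hr]

namespace ExtVanishes

lemma exists_section {X Y B : A} (h : E.ExtVanishes X Y) {i : Y ⟶ B} {p : B ⟶ X}
    (hc : E.Conf i p) : ∃ s : X ⟶ B, s ≫ p = 𝟙 X := by
  obtain ⟨w, hc⟩ := hc
  obtain ⟨s⟩ := h B i p w hc
  exact ⟨s.s, s.s_g⟩

lemma exists_retraction {X Y B : A} (h : E.ExtVanishes X Y) {i : Y ⟶ B} {p : B ⟶ X}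
    (hc : E.Conf i p) : ∃ r : B ⟶ Y, i ≫ r = 𝟙 Y := by
  obtain ⟨s, hs⟩ := h.exists_section hc
  obtain ⟨r, hr, -⟩ := hc.exists_retraction hs
  exact ⟨r, hr⟩

lemma of_section {X Y : A} (h : ∀ {B : A} {i : Y ⟶ B} {p : B ⟶ X}, E.Conf i p →
    ∃ s : X ⟶ B, s ≫ p = 𝟙 X) : E.ExtVanishes X Y := by
  intro B i p w hc
  obtain ⟨s, hs⟩ := h ⟨w, hc⟩
  obtain ⟨r, hr, -, h⟩ := Conf.exists_retraction ⟨w, hc⟩ hs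
  exact ⟨{ r := r, s := s, f_r := hr, s_g := hs, id := h }⟩

/-- Extension of morphisms along admissible monomorphisms. -/
lemma exists_extension {X Y Z W : A} {f : X ⟶ Y} {g : Y ⟶ Z} (hc : E.Conf f g)
    (h : E.ExtVanishes Z W) (u : X ⟶ W) : ∃ t : Y ⟶ W, f ≫ t = u := by
  obtain ⟨D, a, f', p, sq, hD, -⟩ := hc.exists_pushout u
  obtain ⟨r, hr⟩ := h.exists_retraction hD
  exact ⟨a ≫ r, by rw [sq.w_assoc, hr, Category.comp_id]⟩

/-- Lifting of morphisms along admissible epimorphisms. -/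
lemma exists_lift {W B Y X : A} {i : W ⟶ B} {p : B ⟶ Y} (hc : E.Conf i p)
    (h : E.ExtVanishes X W) (u : X ⟶ Y) : ∃ t : X ⟶ B, t ≫ p = u := by
  obtain ⟨D, a, p', i', sq, hD, -⟩ := hc.exists_pullback u
  obtain ⟨s, hs⟩ := h.exists_section hD
  exact ⟨s ≫ a, by rw [Category.assoc, sq.w, reassoc_of% hs]⟩

/-- The lifting property of an admissible monomorphism with respect to an admissible
epimorphism, when the extensions of the cokernel by the kernel split. -/
lemma exists_diagonal {X Y Z W B T : A} {f : X ⟶ Y} {g : Y ⟶ Z} (hf : E.Conf f g)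
    {i : W ⟶ B} {p : B ⟶ T} (hp : E.Conf i p) (h : E.ExtVanishes Z W) (u : X ⟶ B) (v : Y ⟶ T)
    (w : u ≫ p = f ≫ v) : ∃ t : Y ⟶ B, f ≫ t = u ∧ t ≫ p = v := by
  -- After pulling `p` back along `v`, a diagonal is a section of `p'` that extends the partial
  -- section `s` over `X`. The part `N` of `D` over `X` is an extension of `X` by `W`, split by `s`.
  obtain ⟨D, a, p', i', sq, hD, hi'⟩ := hp.exists_pullback v
  let s := sq.lift u f w
  obtain ⟨N, n, hn⟩ := hD.defl.comp hf.defl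
  obtain ⟨c, d, hcd, hc, hd⟩ := hD.noether' hf hn
  have hs : s ≫ p' ≫ g = 0 := by simp [s, hf.zero]
  obtain ⟨s', hs'⟩ := hn.exists_lift s hs
  have hs'd : s' ≫ d = 𝟙 X := by
    have := hf.mono
    rw [← cancel_mono f, Category.assoc, hd, reassoc_of% hs']
    simp [s]
  obtain ⟨r, hr, hsr, -⟩ := hcd.exists_retraction hs'd
  -- The retraction of `N` on `W` extends to `D`, since `D/N = Z` has only split extensions by `W`.
  -- The section complementary to the extended retraction agrees with `s` on `X`.
  obtain ⟨ρ, hρ⟩ := h.exists_extension hn r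
  obtain ⟨σ, hσ, -, hσ'⟩ := hD.exists_section (r := ρ) (by rw [← hc, Category.assoc, hρ, hr])
  have h₁ : s ≫ ρ = 0 := by rw [← hs', Category.assoc, hρ, hsr]
  have h₂ : f ≫ σ = s := by
    have := congrArg (fun t => s ≫ t) hσ'
    simp only [Preadditive.comp_add, reassoc_of% h₁, zero_comp, zero_add, Category.comp_id] at this
    rw [← this]
    simp [s]
  exact ⟨σ ≫ a, by rw [reassoc_of% h₂]; simp [s], by rw [Category.assoc, sq.w, reassoc_of% hσ]⟩

end ExtVanishes

lemma projectives.extVanishes {P : A} (hP : E.projectives P) (Y : A) : E.ExtVanishes P Y :=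
  .of_section fun hc => hP.exists_lift hc.defl (𝟙 P)

lemma projectives_of_isZero {X : A} (hX : IsZero X) : E.projectives X :=
  fun _ _ _ => ⟨0, hX.eq_of_src _ _⟩

lemma projectives_of_retract {X P : A} (h : Retract X P) (hP : E.projectives P) :
    E.projectives X := by
  intro Y Z e he f
  obtain ⟨g, hg⟩ := hP e he (h.r ≫ f)
  exact ⟨h.i ≫ g, by rw [Category.assoc, hg, h.retract_assoc]⟩

lemma projectives_biprod {P Q : A} (hP : E.projectives P) (hQ : E.projectives Q) :
    E.projectives (P ⊞ Q) := by
  intro Y Z e he f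
  obtain ⟨g, hg⟩ := hP e he (biprod.inl ≫ f)
  obtain ⟨g', hg'⟩ := hQ e he (biprod.inr ≫ f)
  exact ⟨biprod.desc g g', by ext <;> simp [hg, hg']⟩

namespace IsCotorsionPair

variable {C W : ObjectProperty A} (h : E.IsCotorsionPair C W)
include h

lemma ext {X Y : A} (hX : C X) (hY : W Y) : E.ExtVanishes X Y := (h.left_iff X).1 hX Y hY

lemma left_of_lift {X : A} (hX : ∀ {Y B : A} {i : Y ⟶ B} {p : B ⟶ X}, W Y → E.Conf i p →
    ∃ s : X ⟶ B, s ≫ p = 𝟙 X) : C X :=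
  (h.left_iff X).2 fun _ hY => .of_section fun hc => hX hY hc

lemma projectives_le : E.projectives ≤ C := fun _ hP =>
  (h.left_iff _).2 fun Y _ => hP.extVanishes Y

lemma left_of_retract {X Y : A} (r : Retract X Y) (hY : C Y) : C X :=
  h.left_of_lift fun hW hc => by
    obtain ⟨t, ht⟩ := (h.ext hY hW).exists_lift hc r.r
    exact ⟨r.i ≫ t, by rw [Category.assoc, ht, r.retract]⟩

lemma right_of_retract {X Y : A} (r : Retract X Y) (hY : W Y) : W X :=
  (h.right_iff X).2 fun Z hZ => .of_section fun {B i p} hc => by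
    obtain ⟨t, ht⟩ := (h.ext hZ hY).exists_extension hc r.i
    obtain ⟨s, hs, -⟩ := hc.exists_section (r := t ≫ r.r) (by rw [reassoc_of% ht, r.retract])
    exact ⟨s, hs⟩

lemma left_isStableUnderRetracts : C.IsStableUnderRetracts := ⟨fun r => h.left_of_retract r⟩

lemma right_isStableUnderRetracts : W.IsStableUnderRetracts := ⟨fun r => h.right_of_retract r⟩

lemma left_ext {X Y Z : A} {f : X ⟶ Y} {g : Y ⟶ Z} (hc : E.Conf f g) (hX : C X) (hZ : C Z) :
    C Y :=
  h.left_of_lift fun hW hc' => by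
    obtain ⟨u, hu⟩ := (h.ext hX hW).exists_lift hc' f
    obtain ⟨t, -, ht⟩ := (h.ext hZ hW).exists_diagonal hc hc' u (𝟙 Y) (by simp [hu])
    exact ⟨t, ht⟩

lemma left_biprod {X Y : A} (hX : C X) (hY : C Y) : C (X ⊞ Y) :=
  h.left_ext (Conf.inl_snd E X Y) hX hY

end IsCotorsionPair

lemma IsCompleteCotorsionPair.exists_precover {C W : ObjectProperty A}
    (h : E.IsCompleteCotorsionPair C W) (X : A) :
    ∃ (K Y : A) (i : K ⟶ Y) (p : Y ⟶ X), C Y ∧ W K ∧ E.Conf i p := by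
  obtain ⟨Y, p, hY, hp⟩ := h.precover X
  obtain ⟨K, i, hi, hK⟩ := admEpi_iff.1 hp
  exact ⟨K, Y, i, p, hY, hK, hi⟩

lemma IsCompleteCotorsionPair.exists_preenvelope {C W : ObjectProperty A}
    (h : E.IsCompleteCotorsionPair C W) (X : A) :
    ∃ (Y Z : A) (j : X ⟶ Y) (p : Y ⟶ Z), W Y ∧ C Z ∧ E.Conf j p := by
  obtain ⟨Y, p, hY, hp⟩ := h.preenvelope X
  obtain ⟨K, i, hi, hK⟩ := admMono_iff.1 hp
  exact ⟨Y, K, p, i, hY, hK, hi⟩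

/-- A morphism factors as an admissible monomorphism with cokernel in `C` followed by an
admissible epimorphism with kernel in `W`. -/
lemma IsCompleteCotorsionPair.exists_factorization {C W : ObjectProperty A}
    (h : E.IsCompleteCotorsionPair C W) (hE : E.HasEnoughProjectives) {X Y : A} (f : X ⟶ Y) :
    ∃ (Z D K : A) (i : X ⟶ Z) (q : Z ⟶ D) (k : K ⟶ Z) (p : Z ⟶ Y), E.Conf i q ∧ C D ∧
      E.Conf k p ∧ W K ∧ i ≫ p = f := by
  -- A projective summand makes `f` an admissible epimorphism. Its kernel is then enlarged by
  -- pushout along a special preenvelope, which puts the new kernel in `W` and adds only an object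
  -- of `C` to the middle term.
  obtain ⟨_, P, _, e, hP, he⟩ := hE.exists_conf Y
  obtain ⟨K, k, hk⟩ := he.defl.biprodDesc f
  obtain ⟨R, Q, j, q, hR, hQ, hj⟩ := h.exists_preenvelope K
  obtain ⟨Z, a, a', p, p', sq, h₁, h₂, h₃, h₄⟩ := hk.exists_pushout₂ hj
  -- The cokernel of `X ⟶ X ⊞ P ⟶ Z` is an extension of `Q` by `P`, hence in `C`.
  obtain ⟨N, n, hn⟩ := (Conf.inl_snd E X P).infl.comp h₂.infl
  obtain ⟨c, d, hcd, -⟩ := (Conf.inl_snd E X P).noether h₂ hn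
  exact ⟨Z, N, R, _, n, a', p, hn, h.left_ext hcd (h.projectives_le _ hP) hQ, h₁, hR, by simp [h₃]⟩

namespace IsProjectiveCotorsionPair

variable {C W : ObjectProperty A} (h : E.IsProjectiveCotorsionPair C W)
include h

lemma projectives_le_right : E.projectives ≤ W := fun P hP => by
  have : (C ⊓ W) P := h.inf_eq ▸ hP
  exact this.2

lemma projectives_of_mem {X : A} (hX : C X) (hX' : W X) : E.projectives X := by
  rw [← h.inf_eq]; exact ⟨hX, hX'⟩

lemma right_X₁ {X Y Z : A} {f : X ⟶ Y} {g : Y ⟶ Z} (hc : E.Conf f g) (hY : W Y) (hZ : W Z) :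
    W X := h.thick.ext₁ _ hc.2 hY hZ

lemma right_X₂ {X Y Z : A} {f : X ⟶ Y} {g : Y ⟶ Z} (hc : E.Conf f g) (hX : W X) (hZ : W Z) :
    W Y := h.thick.ext₂ _ hc.2 hX hZ

lemma right_X₃ {X Y Z : A} {f : X ⟶ Y} {g : Y ⟶ Z} (hc : E.Conf f g) (hX : W X) (hY : W Y) :
    W Z := h.thick.ext₃ _ hc.2 hX hY

/-- The left class is closed under kernels of admissible epimorphisms. -/
lemma left_X₁ {X Y Z : A} {f : X ⟶ Y} {g : Y ⟶ Z} (hc : E.Conf f g) (hY : C Y) (hZ : C Z) :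
    C X := by
  refine h.left_of_lift fun {K B i p} hK hp => ?_
  -- To split an extension `B` of `X` by `K`, embed `B` in `V` with `V` in `W`; then `N = V/K` is in
  -- `W` and contains `X = B/K`. The inclusion of `X` in `N` extends to `Y` because `Z` is in `C`,
  -- and the extension lifts to `V` because `Y` is in `C`. Restricted to `X`, the lift lands in `B`.
  obtain ⟨V, D, j, q, hV, hD, hj⟩ := h.exists_preenvelope B
  obtain ⟨N, n, hn⟩ := hp.infl.comp hj.infl
  obtain ⟨c, d, hcd, hc₁, hd₁⟩ := hp.noether hj hn
  have hN : W N := h.right_X₃ hn hK hV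
  obtain ⟨t, ht⟩ := (h.ext hZ hN).exists_extension hc c
  obtain ⟨t', ht'⟩ := (h.ext hY hK).exists_lift hn t
  obtain ⟨s, hs⟩ := hj.exists_lift (f ≫ t') (by
    rw [← hd₁, Category.assoc, reassoc_of% ht', reassoc_of% ht, hcd.zero])
  refine ⟨s, ?_⟩
  have := hcd.mono
  rw [← cancel_mono c, Category.assoc, hc₁, reassoc_of% hs, ht', ht, Category.id_comp]

/-- Conflations between objects in the left class have an embedding in projectives. -/
lemma exists_embedding {X : A} (hX : C X) : ∃ (P Y : A) (j : X ⟶ P) (q : P ⟶ Y),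
    E.projectives P ∧ C Y ∧ E.Conf j q := by
  obtain ⟨V, D, j, q, hV, hD, hj⟩ := h.exists_preenvelope X
  exact ⟨V, D, j, q, h.projectives_of_mem (h.left_ext hj hX hD) hV, hD, hj⟩

/-- A morphism from the left class to the right class factors through a projective. -/
lemma exists_factor (hE : E.HasEnoughProjectives) {X Y : A} (hX : C X) (hY : W Y) (f : X ⟶ Y) :
    ∃ (P : A) (t : X ⟶ P) (s : P ⟶ Y), E.projectives P ∧ f = t ≫ s := by
  obtain ⟨K, P, i, e, hP, hc⟩ := hE.exists_conf Y
  obtain ⟨t, ht⟩ := (h.ext hX (h.right_X₁ hc (h.projectives_le_right _ hP) hY)).exists_lift hc f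
  exact ⟨P, t, e, hP, ht.symm⟩

end IsProjectiveCotorsionPair

/-! ### Weak equivalences attached to a thick class -/

lemma Conf.biprodMap_id {K Z Y : A} {i : K ⟶ Z} {d : Z ⟶ Y} (h : E.Conf i d) (P : A) :
    E.Conf (i ≫ biprod.inl) (biprod.map d (𝟙 P)) := by
  obtain ⟨D, a, p, j, sq, hc, hj⟩ := h.exists_pullback (biprod.fst : Y ⊞ P ⟶ Y)
  refine hc.of_iso (Iso.refl _) ⟨biprod.lift a (p ≫ biprod.snd), sq.lift biprod.fst
    (biprod.map d (𝟙 P)) (by simp), ?_, ?_⟩ (Iso.refl _) ?_ ?_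
  · refine sq.hom_ext (by simp) ?_
    ext <;> simp [sq.w]
  · ext <;> simp
  · ext <;> simp [hj, reassoc_of% hc.zero]
  · ext <;> simp [sq.w]

/-- The kernel of `(d, e)` is the pullback of `d` along `-e`, so an additional summand `P` changes
the kernel by an extension by `P`. -/
lemma Conf.exists_conf_biprodDesc {K Z Y P : A} {i : K ⟶ Z} {d : Z ⟶ Y} (h : E.Conf i d)
    (e : P ⟶ Y) : ∃ (L : A) (l : L ⟶ Z ⊞ P) (a : K ⟶ L) (b : L ⟶ P),
      E.Conf l (biprod.desc d e) ∧ E.Conf a b := by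
  obtain ⟨D, a, p, j, sq, hc, hj⟩ := h.exists_pullback (-e)
  have := hc.mappingCocone h a (-e) hj sq.w
  exact ⟨D, _, j, p, by simpa using this, hc⟩

namespace IsThick

variable {W : ObjectProperty A} (hW : E.IsThick W)
include hW

lemma X₁ {X Y Z : A} {f : X ⟶ Y} {g : Y ⟶ Z} (hc : E.Conf f g) (hY : W Y) (hZ : W Z) :
    W X := hW.ext₁ _ hc.2 hY hZ

lemma X₂ {X Y Z : A} {f : X ⟶ Y} {g : Y ⟶ Z} (hc : E.Conf f g) (hX : W X) (hZ : W Z) :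
    W Y := hW.ext₂ _ hc.2 hX hZ

lemma X₃ {X Y Z : A} {f : X ⟶ Y} {g : Y ⟶ Z} (hc : E.Conf f g) (hX : W X) (hY : W Y) :
    W Z := hW.ext₃ _ hc.2 hX hY

lemma of_iso {X Y : A} (e : X ≅ Y) (hX : W X) : W Y :=
  hW.retract.of_retract (X := Y) (Y := X) ⟨e.inv, e.hom, by simp⟩ hX

lemma biprod {X Y : A} (hX : W X) (hY : W Y) : W (X ⊞ Y) :=
  hW.X₂ (Conf.inl_snd E X Y) hX hY

end IsThick

variable (E) in
/-- `f : X ⟶ Y` is an equivalence relative to `W` if it extends to an admissible epimorphism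
`X ⊞ P ⟶ Y` with `P` in `W` and kernel in `W`. -/
def RelEquiv (W : ObjectProperty A) : MorphismProperty A := fun X Y f =>
  ∃ (P K : A) (e : P ⟶ Y) (i : K ⟶ X ⊞ P), W P ∧ W K ∧ E.Conf i (biprod.desc f e)

namespace IsThick

variable {W : ObjectProperty A} (hW : E.IsThick W)
include hW

/-- Any single presentation decides the matter. The kernels of `(f, e)` and `(f, e')` both embed in
the kernel of `(f, e, e')`, with cokernels `P'` and `P` in `W`; thickness carries membership from
one to the other. -/
lemma relEquiv_iff {X Y P K : A} {f : X ⟶ Y} {e : P ⟶ Y} {i : K ⟶ X ⊞ P} (hP : W P)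
    (h : E.Conf i (biprod.desc f e)) : E.RelEquiv W f ↔ W K := by
  refine ⟨?_, fun hK => ⟨P, K, e, i, hP, hK, h⟩⟩
  rintro ⟨P', K', e', i', hP', hK', h'⟩
  obtain ⟨L, l, a, b, hl, hab⟩ := h.exists_conf_biprodDesc e'
  obtain ⟨L', l', a', b', hl', hab'⟩ := h'.exists_conf_biprodDesc e
  have hL' : W L' := hW.X₂ hab' hK' hP
  let φ : (X ⊞ P) ⊞ P' ≅ (X ⊞ P') ⊞ P :=
    { hom := biprod.lift (biprod.map biprod.fst (𝟙 _)) (biprod.fst ≫ biprod.snd)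
      inv := biprod.lift (biprod.map biprod.fst (𝟙 _)) (biprod.fst ≫ biprod.snd)
      hom_inv_id := by ext <;> simp
      inv_hom_id := by ext <;> simp }
  have hl'' : E.Conf (l ≫ φ.hom) (biprod.desc (biprod.desc f e') e) :=
    hl.of_iso (Iso.refl _) φ (Iso.refl _) (by simp) (by
      ext <;> simp [φ])
  obtain ⟨ε, -⟩ := hl'.exists_kernelIso hl''
  exact hW.X₁ hab (hW.of_iso ε hL') hP'

lemma exists_presentation (hE : E.HasEnoughProjectives) (hP : E.projectives ≤ W) {X Y : A}
    (f : X ⟶ Y) : ∃ (P K : A) (e : P ⟶ Y) (i : K ⟶ X ⊞ P), W P ∧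
      E.Conf i (biprod.desc f e) := by
  obtain ⟨_, P, _, e, hP', he⟩ := hE.exists_conf Y
  obtain ⟨K, k, hk⟩ := he.defl.biprodDesc f
  exact ⟨P, K, e, k, hP _ hP', hk⟩

/-- Presentations of `f` and `g` compose to one of `f ≫ g`, and Noether's theorem puts the three
kernels in a conflation. This is what reduces two out of three for morphisms to two out of three for
objects. -/
lemma exists_presentation_comp (hE : E.HasEnoughProjectives) (hP : E.projectives ≤ W) {X Y Z : A}
    (f : X ⟶ Y) (g : Y ⟶ Z) : ∃ (K L M : A) (a : K ⟶ L) (b : L ⟶ M), E.Conf a b ∧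
      (E.RelEquiv W f ↔ W K) ∧ (E.RelEquiv W g ↔ W M) ∧ (E.RelEquiv W (f ≫ g) ↔ W L) := by
  obtain ⟨P, K, e, i, hP', hi⟩ := hW.exists_presentation hE hP f
  obtain ⟨Q, M, e', j, hQ, hj⟩ := hW.exists_presentation hE hP g
  have h₁ := hi.biprodMap_id Q
  obtain ⟨L, l, hl⟩ := h₁.defl.comp hj.defl
  obtain ⟨c, d, hcd, -⟩ := h₁.noether' hj hl
  refine ⟨K, L, M, c, d, hcd, hW.relEquiv_iff hP' hi, hW.relEquiv_iff hQ hj, ?_⟩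
  let φ : (X ⊞ P) ⊞ Q ≅ X ⊞ (P ⊞ Q) :=
    { hom := biprod.lift (biprod.fst ≫ biprod.fst) (biprod.map biprod.snd (𝟙 _))
      inv := biprod.lift (biprod.map (𝟙 _) biprod.fst) (biprod.snd ≫ biprod.snd)
      hom_inv_id := by ext <;> simp
      inv_hom_id := by ext <;> simp }
  have hl' : E.Conf (l ≫ φ.hom) (biprod.desc (f ≫ g) (biprod.desc (e ≫ g) e')) :=
    hl.of_iso (Iso.refl _) φ (Iso.refl _) (by simp) (by ext <;> simp [φ])
  exact hW.relEquiv_iff (hW.biprod hP' hQ) hl'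

lemma relEquiv_twoOutOfThree (hE : E.HasEnoughProjectives) (hP : E.projectives ≤ W) :
    (E.RelEquiv W).HasTwoOutOfThreeProperty where
  comp_mem f g hf hg := by
    obtain ⟨K, L, M, a, b, hab, h₁, h₂, h₃⟩ := hW.exists_presentation_comp hE hP f g
    exact h₃.2 (hW.X₂ hab (h₁.1 hf) (h₂.1 hg))
  of_postcomp f g hg hfg := by
    obtain ⟨K, L, M, a, b, hab, h₁, h₂, h₃⟩ := hW.exists_presentation_comp hE hP f g
    exact h₁.2 (hW.X₁ hab (h₃.1 hfg) (h₂.1 hg))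
  of_precomp f g hf hfg := by
    obtain ⟨K, L, M, a, b, hab, h₁, h₂, h₃⟩ := hW.exists_presentation_comp hE hP f g
    exact h₂.2 (hW.X₃ hab (h₁.1 hf) (h₃.1 hfg))

lemma relEquiv_defl_iff (hP : E.projectives ≤ W) {X Y K : A} {i : K ⟶ X} {p : X ⟶ Y}
    (h : E.Conf i p) : E.RelEquiv W p ↔ W K := by
  refine hW.relEquiv_iff (P := 0) (e := 0) (i := i ≫ biprod.inl)
    (hP _ (projectives_of_isZero (isZero_zero A))) ?_
  refine h.of_iso (Iso.refl _) ⟨biprod.inl, biprod.fst, by simp, ?_⟩ (Iso.refl _) (by simp)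
    (by simp)
  refine biprod.hom_ext' _ _ (by simp) ((isZero_zero A).eq_of_src _ _)

/-- With `P ⟶ Y` an admissible epimorphism from a projective, the kernel of `X ⊞ P ⟶ Y` is the
kernel of `P ⟶ Y ⟶ C`. As `P` is in `W`, it lies in `W` exactly when `C` does. -/
lemma relEquiv_infl_iff (hE : E.HasEnoughProjectives) (hP : E.projectives ≤ W) {X Y C : A}
    {i : X ⟶ Y} {p : Y ⟶ C} (h : E.Conf i p) : E.RelEquiv W i ↔ W C := by
  obtain ⟨_, P, _, e, hP', he⟩ := hE.exists_conf Y
  obtain ⟨N, n, hn⟩ := he.defl.comp h.defl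
  obtain ⟨u, hu⟩ := h.exists_lift (n ≫ e) (by simpa using hn.zero)
  have H := hn.mappingCone h u e hu.symm rfl
  let φ : P ⊞ X ≅ X ⊞ P :=
    { hom := biprod.lift (-biprod.snd) biprod.fst
      inv := biprod.lift biprod.snd (-biprod.fst)
      hom_inv_id := by ext <;> simp
      inv_hom_id := by ext <;> simp }
  have H' : E.Conf (biprod.lift n u ≫ φ.hom) (biprod.desc i e) :=
    H.of_iso (Iso.refl _) φ (Iso.refl _) (by simp) (by ext <;> simp [φ])
  rw [hW.relEquiv_iff (hP _ hP') H']
  exact ⟨fun hN => hW.X₃ hn hN (hP _ hP'), fun hC => hW.X₁ hn (hP _ hP') hC⟩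

end IsThick

end ExactStructure

/-! ### Model structures from Hovey triples -/

namespace ExactStructure

variable {A : Type u} [Category.{v} A] [Preadditive A] [HasZeroObject A] [HasBinaryBiproducts A]
variable {E : ExactStructure A}

/-- The split monomorphism `i₁` is admissible by weak idempotent completeness, so `f ≫ i₂ = i₁ ≫ g`
is admissible, and `Infl.of_comp` cancels `i₂`. -/
lemma Conf.exists_retract_cokernel (hA : WeaklyIdempotentComplete A) {X Y X' Y' C' : A}
    {f : X ⟶ Y} {g : X' ⟶ Y'} {c' : Y' ⟶ C'} (h : E.Conf g c') {i₁ : X ⟶ X'} {r₁ : X' ⟶ X}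
    {i₂ : Y ⟶ Y'} {r₂ : Y' ⟶ Y} (h₁ : i₁ ≫ r₁ = 𝟙 X) (h₂ : i₂ ≫ r₂ = 𝟙 Y)
    (hi : i₁ ≫ g = f ≫ i₂) (hr : r₁ ≫ f = g ≫ r₂) :
    ∃ (C : A) (c : Y ⟶ C), E.Conf f c ∧ Nonempty (Retract C C') := by
  obtain ⟨D, d, t, hd, -⟩ := Conf.of_retraction (E := E) hA i₁ r₁ h₁
  have hf : E.Infl (f ≫ i₂) := hi ▸ hd.infl.comp h.infl
  obtain ⟨C, c, hc⟩ := hf.of_comp hA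
  obtain ⟨a, ha⟩ := hc.exists_desc (i₂ ≫ c') (by rw [← reassoc_of% hi, h.zero, comp_zero])
  obtain ⟨b, hb⟩ := h.exists_desc (r₂ ≫ c) (by rw [← reassoc_of% hr, hc.zero, comp_zero])
  have := hc.epi
  refine ⟨C, c, hc, ⟨⟨a, b, ?_⟩⟩⟩
  rw [← cancel_epi c, reassoc_of% ha, hb, reassoc_of% h₂, Category.comp_id]

lemma Conf.exists_retract_kernel (hA : WeaklyIdempotentComplete A) {X Y X' Y' K' : A}
    {f : X ⟶ Y} {g : X' ⟶ Y'} {k' : K' ⟶ X'} (h : E.Conf k' g) {i₁ : X ⟶ X'} {r₁ : X' ⟶ X}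
    {i₂ : Y ⟶ Y'} {r₂ : Y' ⟶ Y} (h₁ : i₁ ≫ r₁ = 𝟙 X) (h₂ : i₂ ≫ r₂ = 𝟙 Y)
    (hi : i₁ ≫ g = f ≫ i₂) (hr : r₁ ≫ f = g ≫ r₂) :
    ∃ (K : A) (k : K ⟶ X), E.Conf k f ∧ Nonempty (Retract K K') := by
  obtain ⟨K, k, hk, ⟨r⟩⟩ := h.op.exists_retract_cokernel hA.op (f := f.op) (i₁ := r₂.op)
    (r₁ := i₂.op) (i₂ := r₁.op) (r₂ := i₁.op) (congrArg Quiver.Hom.op h₂)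
    (congrArg Quiver.Hom.op h₁) (congrArg Quiver.Hom.op hr.symm) (congrArg Quiver.Hom.op hi.symm)
  exact ⟨_, _, hk.unop, ⟨⟨r.r.unop, r.i.unop, congrArg Quiver.Hom.unop r.retract⟩⟩⟩

lemma admMono_isStableUnderRetracts (hA : WeaklyIdempotentComplete A) {Q : ObjectProperty A}
    (hQ : Q.IsStableUnderRetracts) : (E.admMono Q).IsStableUnderRetracts where
  of_retract r hg := by
    obtain ⟨C', c', hc', hQ'⟩ := admMono_iff.1 hg
    obtain ⟨C, c, hc, ⟨r'⟩⟩ := hc'.exists_retract_cokernel hA r.left.retract r.right.retract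
      r.i_w r.r_w
    exact admMono_iff.2 ⟨C, c, hc, hQ.of_retract r' hQ'⟩

lemma admEpi_isStableUnderRetracts (hA : WeaklyIdempotentComplete A) {R : ObjectProperty A}
    (hR : R.IsStableUnderRetracts) : (E.admEpi R).IsStableUnderRetracts where
  of_retract r hg := by
    obtain ⟨C', c', hc', hQ'⟩ := admEpi_iff.1 hg
    obtain ⟨C, c, hc, ⟨r'⟩⟩ := hc'.exists_retract_kernel hA r.left.retract r.right.retract
      r.i_w r.r_w
    exact admEpi_iff.2 ⟨C, c, hc, hR.of_retract r' hQ'⟩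

lemma IsThick.relEquiv_isStableUnderRetracts (hA : WeaklyIdempotentComplete A)
    (hE : E.HasEnoughProjectives) {W : ObjectProperty A} (hW : E.IsThick W)
    (hP : E.projectives ≤ W) : (E.RelEquiv W).IsStableUnderRetracts where
  of_retract {X Y X' Y' f g} r hg := by
    obtain ⟨_, P, _, e, hPP, he⟩ := hE.exists_conf Y
    obtain ⟨_, Q, _, e', hQ, he'⟩ := hE.exists_conf Y'
    -- The presentation of `g` receives the summand `P` as well, so that `(f, e)` is a retract of
    -- it; `l` is what makes the retraction compatible on the summand `Q`.
    obtain ⟨l, hl⟩ := hQ.exists_lift he.defl (e' ≫ r.right.r)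
    obtain ⟨K, k, hk⟩ := (he'.defl.biprodDesc (e ≫ r.right.i)).biprodDesc g
    have hr₂ : r.right.i ≫ r.right.r = 𝟙 Y := r.right.retract
    obtain ⟨K', k', hk', ⟨r'⟩⟩ := hk.exists_retract_kernel hA (f := biprod.desc f e)
      (i₁ := biprod.map r.left.i biprod.inl) (r₁ := biprod.map r.left.r (biprod.desc (𝟙 P) l))
      (i₂ := r.right.i) (r₂ := r.right.r) (by ext <;> simp) hr₂ (by ext <;> simp)
      (by ext <;> simp [hl])
    rw [hW.relEquiv_iff (hP _ (projectives_biprod hPP hQ)) hk] at hg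
    rw [hW.relEquiv_iff (hP _ hPP) hk']
    exact hW.retract.of_retract r' hg

namespace IsHoveyTriple

variable {M : ObjectTriple A} (hM : E.IsHoveyTriple M) (hE : E.HasEnoughProjectives)
  (hP : E.projectives ≤ M.W)
include hM hE hP

/-- Weak equivalences depend only on the trivial class. One inclusion is closure under composition.
For the other, factor with the pair `(Q ∩ W, R)`: by two out of three the epimorphic factor is an
equivalence, so its kernel is trivial. -/
lemma weq_eq : (E.model M).weq = E.RelEquiv M.W := by
  have := hM.thick.relEquiv_twoOutOfThree hE hP
  ext X Y f
  constructor
  · rintro ⟨Z, i, p, hi, hp, rfl⟩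
    obtain ⟨C, c, hc, hC⟩ := admMono_iff.1 hi
    obtain ⟨K, k, hk, hK⟩ := admEpi_iff.1 hp
    exact (E.RelEquiv M.W).comp_mem _ _ ((hM.thick.relEquiv_infl_iff hE hP hc).2 hC.2)
      ((hM.thick.relEquiv_defl_iff hP hk).2 hK.2)
  · intro hf
    obtain ⟨Z, D, K, i, q, k, p, hi, hD, hk, hK, rfl⟩ := hM.trivCof_fib.exists_factorization hE f
    exact ⟨Z, i, p, admMono_iff.2 ⟨_, _, hi, hD⟩, admEpi_iff.2 ⟨_, _, hk, hK,
      (hM.thick.relEquiv_defl_iff hP hk).1 ((E.RelEquiv M.W).of_precomp _ _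
        ((hM.thick.relEquiv_infl_iff hE hP hi).2 hD.2) hf)⟩, rfl⟩

lemma trivialCof_eq : (E.model M).cof ⊓ (E.model M).weq = E.admMono (M.Q ⊓ M.W) := by
  rw [hM.weq_eq hE hP]
  ext X Y f
  constructor
  · rintro ⟨hf, hf'⟩
    obtain ⟨C, c, hc, hC⟩ := admMono_iff.1 hf
    exact admMono_iff.2 ⟨C, c, hc, hC, (hM.thick.relEquiv_infl_iff hE hP hc).1 hf'⟩
  · intro hf
    obtain ⟨C, c, hc, hC⟩ := admMono_iff.1 hf
    exact ⟨admMono_iff.2 ⟨C, c, hc, hC.1⟩, (hM.thick.relEquiv_infl_iff hE hP hc).2 hC.2⟩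

lemma trivialFib_eq : (E.model M).fib ⊓ (E.model M).weq = E.admEpi (M.R ⊓ M.W) := by
  rw [hM.weq_eq hE hP]
  ext X Y f
  constructor
  · rintro ⟨hf, hf'⟩
    obtain ⟨C, c, hc, hC⟩ := admEpi_iff.1 hf
    exact admEpi_iff.2 ⟨C, c, hc, hC, (hM.thick.relEquiv_defl_iff hP hc).1 hf'⟩
  · intro hf
    obtain ⟨C, c, hc, hC⟩ := admEpi_iff.1 hf
    exact ⟨admEpi_iff.2 ⟨C, c, hc, hC.1⟩, (hM.thick.relEquiv_defl_iff hP hc).2 hC.2⟩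

omit hP hM hE in
lemma hasLiftingProperty {C W : ObjectProperty A} (h : E.IsCotorsionPair C W) {X Y Z T : A}
    {i : X ⟶ Y} {p : Z ⟶ T} (hi : E.admMono C i) (hp : E.admEpi W p) : HasLiftingProperty i p where
  sq_hasLift {f g} sq := by
    obtain ⟨C, c, hc, hC⟩ := admMono_iff.1 hi
    obtain ⟨K, k, hk, hK⟩ := admEpi_iff.1 hp
    obtain ⟨t, ht, ht'⟩ := (h.ext hC hK).exists_diagonal hc hk f g sq.w
    exact ⟨⟨⟨t, ht, ht'⟩⟩⟩

omit hP hM in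
lemma hasFactorization {C W : ObjectProperty A} (h : E.IsCompleteCotorsionPair C W) :
    MorphismProperty.HasFactorization (E.admMono C) (E.admEpi W) where
  nonempty_mapFactorizationData f := by
    obtain ⟨Z, D, K, i, q, k, p, hi, hD, hk, hK, hf⟩ := h.exists_factorization hE f
    exact ⟨⟨Z, i, p, hf, admMono_iff.2 ⟨_, _, hi, hD⟩, admEpi_iff.2 ⟨_, _, hk, hK⟩⟩⟩

/-- A Hovey triple defines a model structure. -/
theorem isModelStructure (hA : WeaklyIdempotentComplete A) : (E.model M).IsModelStructure where
  two_out_of_three := hM.weq_eq hE hP ▸ hM.thick.relEquiv_twoOutOfThree hE hP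
  retract_cof := admMono_isStableUnderRetracts hA hM.cof_trivFib.left_isStableUnderRetracts
  retract_fib := admEpi_isStableUnderRetracts hA hM.trivCof_fib.right_isStableUnderRetracts
  retract_weq := hM.weq_eq hE hP ▸ hM.thick.relEquiv_isStableUnderRetracts hA hE hP
  lift_trivialCof i p hi hp := by
    rw [hM.trivialCof_eq hE hP] at hi
    exact hasLiftingProperty hM.trivCof_fib.toIsCotorsionPair hi hp
  lift_trivialFib i p hi hp := by
    rw [hM.trivialFib_eq hE hP] at hp
    exact hasLiftingProperty hM.cof_trivFib.toIsCotorsionPair hi hp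
  fac_trivialCof := hM.trivialCof_eq hE hP ▸ hasFactorization hE hM.trivCof_fib
  fac_trivialFib := hM.trivialFib_eq hE hP ▸ hasFactorization hE hM.cof_trivFib

end IsHoveyTriple

/-! ### Projective model structures and the horseshoe lemma -/

namespace IsProjectiveCotorsionPair

variable {C W : ObjectProperty A} (h : E.IsProjectiveCotorsionPair C W)
  (hE : E.HasEnoughProjectives)
include h

include hE in
-- The second cotorsion pair is that of projectives and all objects; it is complete because there
-- are enough projectives, and identities serve as preenvelopes.
lemma isHoveyTriple : E.IsHoveyTriple (projTriple C W) where
  thick := h.thick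
  cof_trivFib := by
    simpa only [projTriple, top_inf_eq] using h.toIsCompleteCotorsionPair
  trivCof_fib := by
    have hCW : (projTriple C W).Q ⊓ (projTriple C W).W = E.projectives := h.inf_eq
    rw [hCW]
    refine ⟨⟨fun X => ⟨fun hX Y _ => hX.extVanishes Y, fun hX Y Z e he f => ?_⟩,
      fun Y => ⟨fun _ X hX => hX.extVanishes Y, fun _ => trivial⟩⟩, fun X => ?_, fun X => ?_⟩
    · obtain ⟨K, i, hi⟩ := defl_of_admEpi he
      exact (hX K trivial).exists_lift hi f
    · obtain ⟨P, e, hP, he⟩ := hE X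
      exact ⟨P, e, hP, he⟩
    · exact ⟨X, 𝟙 X, trivial, admMono_iff.2 ⟨0, 0, Conf.id_zero E (isZero_zero A),
        projectives_of_isZero (isZero_zero A)⟩⟩

include hE in
lemma weq_eq : (E.model (projTriple C W)).weq = E.RelEquiv W :=
  (h.isHoveyTriple hE).weq_eq hE h.projectives_le_right

/-- A conflation has a special precover by a conflation. -/
lemma exists_horseshoe (hE : E.HasEnoughProjectives) (hA : WeaklyIdempotentComplete A)
    {X Y Z : A} {f : X ⟶ Y} {g : Y ⟶ Z}
    (hc : E.Conf f g) : ∃ (X' Y' Z' : A) (f' : X' ⟶ Y') (g' : Y' ⟶ Z') (a : X' ⟶ X) (b : Y' ⟶ Y)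
      (c : Z' ⟶ Z), E.Conf f' g' ∧ C X' ∧ C Y' ∧ C Z' ∧ f' ≫ b = a ≫ f ∧ g' ≫ c = b ≫ g ∧
        E.admEpi W a ∧ E.admEpi W b ∧ E.admEpi W c := by
  have := h.thick.relEquiv_twoOutOfThree hE h.projectives_le_right
  obtain ⟨K, X', k, a, hX', hK, ha⟩ := h.exists_precover X
  -- The middle and right terms come together, by factoring `X' ⟶ X ⟶ Y` into an admissible
  -- monomorphism with cokernel `Z'` in `C` and an admissible epimorphism with kernel in `W`.
  obtain ⟨Y', Z', V, f', g', v, b, hf', hZ', hb, hV, hf'b⟩ := h.exists_factorization hE (a ≫ f)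
  obtain ⟨N, n, hn⟩ := hb.defl.comp hc.defl
  obtain ⟨c₀, d₀, hcd, hc₀, hd₀⟩ := hb.noether' hc hn
  obtain ⟨m, hm⟩ := hn.exists_lift f' (by rw [reassoc_of% hf'b, hc.zero, comp_zero])
  have hmd : m ≫ d₀ = a := by
    have := hc.mono
    rw [← cancel_mono f, Category.assoc, hd₀, reassoc_of% hm, hf'b]
  -- Here `N` is the kernel of `Y' ⟶ Y ⟶ Z`. The admissible monomorphism `f'` factors through it,
  -- and weak idempotent completeness makes the first factor `m` admissible.
  obtain ⟨R, r, hr⟩ := Infl.of_comp hA (f := m) (g := n) (by rw [hm]; exact hf'.infl)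
  -- Both `a = m ≫ d₀` and `d₀` have kernel in `W`, so `m` is an equivalence relative to `W`. Its
  -- cokernel `R` is the kernel of `Z' ⟶ Z`, by Noether's theorem.
  have hR : W R := by
    rw [← h.thick.relEquiv_infl_iff hE h.projectives_le_right hr]
    refine (E.RelEquiv W).of_postcomp m d₀
      ((h.thick.relEquiv_defl_iff h.projectives_le_right hcd).2 hV) ?_
    rw [hmd]
    exact (h.thick.relEquiv_defl_iff h.projectives_le_right ha).2 hK
  obtain ⟨s, c, hsc, hs, hc'⟩ := hr.noether hn (hm ▸ hf')
  exact ⟨X', Y', Z', f', g', a, b, c, hf', hX', h.left_ext hf' hX' hZ', hZ', hf'b, hc',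
    admEpi_iff.2 ⟨K, k, ha, hK⟩, admEpi_iff.2 ⟨V, v, hb, hV⟩, admEpi_iff.2 ⟨R, s, hsc, hR⟩⟩

/-- For `X ↣ Y ↠ Z` in a larger left class, `X` and `Y` in `C` imply `Z` in `C`. -/
lemma left_X₃ {C₁ W₁ : ObjectProperty A} (h₁ : E.IsProjectiveCotorsionPair C₁ W₁)
    {X Y Z : A} {f : X ⟶ Y} {g : Y ⟶ Z} (hc : E.Conf f g) (hX : C X) (hY : C Y) (hZ : C₁ Z) :
    C Z := by
  obtain ⟨P, X', j, q, hP, hX', hj⟩ := h.exists_embedding hX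
  -- The pushout `D` is an extension of `X'` by `Y`, hence in `C`, and an extension of `Z` by the
  -- projective `P`. The latter splits because `Z` is in `C₁` and `P` in `W₁`, so `Z` is a retract
  -- of `D`.
  obtain ⟨D, a, a', p, p', -, h₂, h₃, -⟩ := hc.exists_pushout₂ hj
  obtain ⟨s, hs⟩ := (h₁.ext hZ (h₁.projectives_le_right _ hP)).exists_section h₂
  exact h.left_of_retract ⟨s, p, hs⟩ (h.left_ext h₃ hY hX')

/-- Two special precovers of the same object are stably isomorphic. -/
lemma retract_of_precovers (hE : E.HasEnoughProjectives) {X Y Y' : A} {p : Y ⟶ X} {p' : Y' ⟶ X}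
    (hY : C Y) (hp : E.admEpi W p) (hY' : C Y') (hp' : E.admEpi W p') :
    ∃ P, E.projectives P ∧ Nonempty (Retract Y' (Y ⊞ P)) := by
  obtain ⟨K, k, hk, hK⟩ := admEpi_iff.1 hp
  obtain ⟨K', k', hk', hK'⟩ := admEpi_iff.1 hp'
  obtain ⟨a, ha⟩ := (h.ext hY hK').exists_lift hk' p
  obtain ⟨b, hb⟩ := (h.ext hY' hK).exists_lift hk p'
  -- The endomorphism `1 - b ≫ a` is killed by `p'`, so it passes through `K'` in `W` and hence
  -- through a projective.
  obtain ⟨l, hl⟩ := hk'.exists_lift (𝟙 Y' - b ≫ a) (by simp [ha, hb])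
  obtain ⟨P, t, s, hP, hts⟩ := h.exists_factor hE hY' hK' l
  exact ⟨P, hP, ⟨⟨biprod.lift b t, biprod.desc a (s ≫ k'), by
    rw [biprod.lift_desc, ← reassoc_of% hts, hl]; simp⟩⟩⟩

end IsProjectiveCotorsionPair

/-! ### Left localizations -/

section LeftLocalization

variable {C W C' W' : ObjectProperty A} (h : E.IsProjectiveCotorsionPair C W)
  (h' : E.IsProjectiveCotorsionPair C' W')

include h in
lemma IsProjectiveCotorsionPair.right_anti (h' : E.IsProjectiveCotorsionPair C' W')
    (hC : C' ≤ C) : W ≤ W' :=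
  fun Y hY => (h'.right_iff Y).2 fun _ hX => h.ext (hC _ hX) hY

/-- Two special precovers differ only by retracts and projective summands, and `C'` is closed under
these; membership may therefore be tested on any one of them. -/
lemma mem_leftLocalization_iff (hE : E.HasEnoughProjectives) (h : E.IsProjectiveCotorsionPair C W)
    (h' : E.IsProjectiveCotorsionPair C' W') (hC : C' ≤ C) {X Y : A} {p : Y ⟶ X} (hY : C Y)
    (hp : E.admEpi W p) : (E.leftLocalization C' W' C W).W X ↔ C' Y := by
  refine ⟨?_, fun hY' => ⟨Y, p, hY', hp⟩⟩
  rintro ⟨Y', p', hY', hp'⟩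
  obtain ⟨P, hP, ⟨r⟩⟩ := h.retract_of_precovers hE (hC _ hY') hp' hY hp
  exact h'.left_of_retract r (h'.left_biprod hY' (h'.projectives_le _ hP))

include h h'

/-- For `X` in `C` a special precover splits, so `X` is a retract of an object of `C'`. -/
lemma leftLocalization_inf_left (hC : C' ≤ C) : C ⊓ (E.leftLocalization C' W' C W).W = C' := by
  ext X
  constructor
  · rintro ⟨hX, Y, p, hY, hp⟩
    obtain ⟨K, k, hk, hK⟩ := admEpi_iff.1 hp
    obtain ⟨s, hs⟩ := (h.ext hX hK).exists_section hk
    exact h'.left_of_retract ⟨s, p, hs⟩ hY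
  · intro hX
    exact ⟨hC _ hX, X, 𝟙 X, hX, admEpi_iff.2 ⟨0, 0, Conf.zero_id E (isZero_zero A),
      h.projectives_le_right _ (projectives_of_isZero (isZero_zero A))⟩⟩

/-- If `X` is in `W'`, then the precover `Y` in `C'` is also in `W'`, hence projective; so `X` is
the cokernel of a monomorphism between objects of `W`. -/
lemma leftLocalization_inf_right (hE : E.HasEnoughProjectives) (hC : C' ≤ C) :
    W' ⊓ (E.leftLocalization C' W' C W).W = W := by
  have hW := h.right_anti h' hC
  ext X
  constructor
  · rintro ⟨hX, Y, p, hY, hp⟩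
    obtain ⟨K, k, hk, hK⟩ := admEpi_iff.1 hp
    have hP : E.projectives Y := h'.projectives_of_mem hY (h'.right_X₂ hk (hW _ hK) hX)
    exact h.right_X₃ hk hK (h.projectives_le_right _ hP)
  · intro hX
    obtain ⟨K, P, i, e, hP, hc⟩ := hE.exists_conf X
    exact ⟨hW _ hX, P, e, h'.projectives_le _ hP, admEpi_iff.2 ⟨K, i, hc,
      h.right_X₁ hc (h.projectives_le_right _ hP) hX⟩⟩

lemma projectives_le_leftLocalization (hC : C' ≤ C) :
    E.projectives ≤ (E.leftLocalization C' W' C W).W := fun P hP => by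
  have : (C ⊓ (E.leftLocalization C' W' C W).W) P := by
    rw [leftLocalization_inf_left h h' hC]
    exact h'.projectives_le _ hP
  exact this.2

/-- The horseshoe lemma replaces a conflation by one in `C`, where membership means membership in
`C'`. There `C'` is closed under kernels and extensions, and also under cokernels that lie in `C`
(`left_X₃`). For retracts, the composite of the lifted morphisms is the identity up to a morphism
through a projective. -/
lemma leftLocalization_isThick (hE : E.HasEnoughProjectives) (hA : WeaklyIdempotentComplete A)
    (hC : C' ≤ C) : E.IsThick (E.leftLocalization C' W' C W).W where
  retract := ⟨fun {X Y} r hY => by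
    obtain ⟨K, X', k, p, hX', hK, hp⟩ := h.exists_precover X
    obtain ⟨L, Y', l, q, hY', hL, hq⟩ := h.exists_precover Y
    rw [mem_leftLocalization_iff hE h h' hC hY' (admEpi_iff.2 ⟨L, l, hq, hL⟩)] at hY
    refine ⟨X', p, ?_, admEpi_iff.2 ⟨K, k, hp, hK⟩⟩
    obtain ⟨a, ha⟩ := (h.ext hX' hL).exists_lift hq (p ≫ r.i)
    obtain ⟨b, hb⟩ := (h.ext hY' hK).exists_lift hp (q ≫ r.r)
    obtain ⟨m, hm⟩ := hp.exists_lift (𝟙 X' - a ≫ b) (by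
      simp [hb, reassoc_of% ha])
    obtain ⟨P, t, s, hP, hts⟩ := h.exists_factor hE hX' hK m
    refine h'.left_of_retract (Y := Y' ⊞ P) ⟨biprod.lift a t, biprod.desc b (s ≫ k), ?_⟩
      (h'.left_biprod hY (h'.projectives_le _ hP))
    rw [biprod.lift_desc, ← reassoc_of% hts, hm]
    simp⟩
  ext₁ S hS h₂ h₃ := by
    obtain ⟨X', Y', Z', f', g', a, b, c, hc, hX', hY', hZ', -, -, ha, hb, hc'⟩ :=
      h.exists_horseshoe hE hA ((conf_iff S).1 hS)
    rw [mem_leftLocalization_iff hE h h' hC hY' hb] at h₂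
    rw [mem_leftLocalization_iff hE h h' hC hZ' hc'] at h₃
    exact ⟨X', a, h'.left_X₁ hc h₂ h₃, ha⟩
  ext₂ S hS h₁ h₃ := by
    obtain ⟨X', Y', Z', f', g', a, b, c, hc, hX', hY', hZ', -, -, ha, hb, hc'⟩ :=
      h.exists_horseshoe hE hA ((conf_iff S).1 hS)
    rw [mem_leftLocalization_iff hE h h' hC hX' ha] at h₁
    rw [mem_leftLocalization_iff hE h h' hC hZ' hc'] at h₃
    exact ⟨Y', b, h'.left_ext hc h₁ h₃, hb⟩
  ext₃ S hS h₁ h₂ := by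
    obtain ⟨X', Y', Z', f', g', a, b, c, hc, hX', hY', hZ', -, -, ha, hb, hc'⟩ :=
      h.exists_horseshoe hE hA ((conf_iff S).1 hS)
    rw [mem_leftLocalization_iff hE h h' hC hX' ha] at h₁
    rw [mem_leftLocalization_iff hE h h' hC hY' hb] at h₂
    exact ⟨Z', c, h'.left_X₃ h hc h₁ h₂ hZ', hc'⟩

/-- The left localization is a Hovey triple. -/
theorem leftLocalization_isHoveyTriple (hE : E.HasEnoughProjectives)
    (hA : WeaklyIdempotentComplete A) (hC : C' ≤ C) :
    E.IsHoveyTriple (E.leftLocalization C' W' C W) where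
  thick := leftLocalization_isThick h h' hE hA hC
  cof_trivFib := (leftLocalization_inf_right h h' hE hC).symm ▸ h.toIsCompleteCotorsionPair
  trivCof_fib := (leftLocalization_inf_left h h' hC).symm ▸ h'.toIsCompleteCotorsionPair

/-- A left localization of a projective model structure is Quillen equivalent to another
projective model structure if the trivial objects agree on the relevant subclasses. -/
theorem isQuillenEquivalence_leftLocalization (hE : E.HasEnoughProjectives)
    (hA : WeaklyIdempotentComplete A) (hC : C' ≤ C) {D V : ObjectProperty A}
    (hD : E.IsProjectiveCotorsionPair D V) (hDC : D ≤ C)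
    (hV : ∀ {K X P Y : A} {i : K ⟶ X ⊞ P} {p : X ⊞ P ⟶ Y}, E.Conf i p → D X → E.projectives P →
      W' Y → ((E.leftLocalization C' W' C W).W K ↔ V K)) :
    IsQuillenEquivalence (E.model (projTriple D V)) (E.model (E.leftLocalization C' W' C W))
      (Adjunction.id (C := A)) := by
  have hM := hD.isHoveyTriple hE
  have hN := leftLocalization_isHoveyTriple h h' hE hA hC
  have hP := projectives_le_leftLocalization h h' hC
  refine ⟨hM.isModelStructure hE hD.projectives_le_right hA, hN.isModelStructure hE hP hA, ?_, ?_,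
    ?_⟩
  · intro X Y f hf
    obtain ⟨Z, c, hc, hZ⟩ := admMono_iff.1 hf
    exact admMono_iff.2 ⟨Z, c, hc, hDC _ hZ⟩
  · intro X Y f hf
    rw [hM.trivialCof_eq hE hD.projectives_le_right] at hf
    rw [hN.trivialCof_eq hE hP]
    obtain ⟨Z, c, hc, hZ⟩ := admMono_iff.1 hf
    -- The cokernel of a trivial cofibration of the source lies in `D ∩ V`, so it is projective and
    -- thereby trivial in the target.
    refine admMono_iff.2 ⟨Z, c, hc, hDC _ hZ.1, hP _ (hD.projectives_of_mem hZ.1 hZ.2)⟩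
  · rintro X Y ⟨Z, hZ, hX⟩ ⟨T, hT, hY⟩ f
    change X ⟶ Y at f
    have e₁ : (Adjunction.id (C := A)).homEquiv X Y f = f := by
      rw [Adjunction.homEquiv_unit]
      exact Category.id_comp f
    rw [e₁, hD.weq_eq hE, hN.weq_eq hE hP]
    have hX' : D X := by
      obtain ⟨X', c, hc, hX'⟩ := admMono_iff.1 hX
      obtain ⟨r, hr⟩ := hc.exists_desc (𝟙 X) (by simp)
      exact hD.left_of_retract ⟨c, r, hr⟩ hX'
    have hY' : W' Y := by
      obtain ⟨Y', k, hk, hY'⟩ := admEpi_iff.1 hY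
      obtain ⟨r, hr⟩ := hk.exists_lift (𝟙 Y) (by simp)
      exact h'.right_of_retract ⟨r, k, hr⟩ hY'
    -- One presentation of `f` tests both notions of weak equivalence, so only its kernel has to be
    -- compared in the two trivial classes.
    obtain ⟨_, P, _, e, hP', he⟩ := hE.exists_conf Y
    obtain ⟨K, k, hk⟩ := he.defl.biprodDesc f
    rw [hN.thick.relEquiv_iff (hP _ hP') hk,
      hD.thick.relEquiv_iff (hD.projectives_le_right _ hP') hk]
    exact hV hk hX' hP' hY'

end LeftLocalization

/-! ### Three projective cotorsion pairs -/

section ThreePairs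

variable {C₁ W₁ C₂ W₂ C₃ W₃ : ObjectProperty A} (h₁ : E.IsProjectiveCotorsionPair C₁ W₁)
  (h₂ : E.IsProjectiveCotorsionPair C₂ W₂) (h₃ : E.IsProjectiveCotorsionPair C₃ W₃)
  (h₂₁ : C₂ ≤ C₁) (h₃₁ : C₃ ≤ C₁)
include h₁ h₂ h₃ h₂₁ h₃₁

/-- A special `C₁`-precover of `X` in `W₂ ⊓ W₃` lies in `W₃ ⊓ C₁ = C₂` and in `W₂`, so it is
projective; then `X` is in `W₁` by thickness. -/
lemma inf_eq_of_inf_eq (h : W₃ ⊓ C₁ = C₂) : W₂ ⊓ W₃ = W₁ := by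
  have hW₂ := h₁.right_anti h₂ h₂₁
  have hW₃ := h₁.right_anti h₃ h₃₁
  ext X
  refine ⟨?_, fun hX => ⟨hW₂ _ hX, hW₃ _ hX⟩⟩
  rintro ⟨hX₂, hX₃⟩
  obtain ⟨K, Y, i, p, hY, hK, hc⟩ := h₁.exists_precover X
  have hY₂ : C₂ Y := h ▸ ⟨h₃.right_X₂ hc (hW₃ _ hK) hX₃, hY⟩
  have hP : E.projectives Y := h₂.projectives_of_mem hY₂ (h₂.right_X₂ hc (hW₂ _ hK) hX₂)
  exact h₁.right_X₃ hc hK (h₁.projectives_le_right _ hP)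

/-- For the converse, the kernel of a special `C₂`-precover of `X` in `W₃ ⊓ C₁` lies in `W₂ ⊓ W₃ =
W₁`. The precover therefore splits, and `X` is a retract of an object of `C₂`. -/
theorem inf_eq_iff : W₃ ⊓ C₁ = C₂ ↔ (W₂ ⊓ W₃ = W₁ ∧ C₂ ≤ W₃) := by
  refine ⟨fun h => ⟨inf_eq_of_inf_eq h₁ h₂ h₃ h₂₁ h₃₁ h, h ▸ inf_le_left⟩, ?_⟩
  rintro ⟨h, hC₂⟩
  ext X
  refine ⟨?_, fun hX => ⟨hC₂ _ hX, h₂₁ _ hX⟩⟩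
  rintro ⟨hX₃, hX₁⟩
  obtain ⟨K, Y, i, p, hY, hK, hc⟩ := h₂.exists_precover X
  have hK₁ : W₁ K := h ▸ ⟨hK, h₃.right_X₁ hc (hC₂ _ hY) hX₃⟩
  obtain ⟨s, hs⟩ := (h₁.ext hX₁ hK₁).exists_section hc
  exact h₂.left_of_retract ⟨s, p, hs⟩ hY

/-- A special `C₁`-precover has kernel in `W₁ ≤ W₃`, so it lies in `W₃` exactly when its target
does; on `C₁` this means lying in `C₂`. Hence `M₃` and the localization of `M₁` by `M₂` have the
same weak equivalences. -/
lemma leftLocalization_eq (h : W₃ ⊓ C₁ = C₂) : (E.leftLocalization C₂ W₂ C₁ W₁).W = W₃ := by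
  have hW₃ := h₁.right_anti h₃ h₃₁
  ext X
  constructor
  · rintro ⟨Y, p, hY, hp⟩
    obtain ⟨K, k, hk, hK⟩ := admEpi_iff.1 hp
    have hY' : (W₃ ⊓ C₁) Y := h ▸ hY
    exact h₃.right_X₃ hk (hW₃ _ hK) hY'.1
  · intro hX
    obtain ⟨K, Y, i, p, hY, hK, hc⟩ := h₁.exists_precover X
    exact ⟨Y, p, h ▸ ⟨h₃.right_X₂ hc (hW₃ _ hK) hX, hY⟩, admEpi_iff.2 ⟨K, i, hc, hK⟩⟩

theorem quillenEquivalence₃ (hE : E.HasEnoughProjectives) (hA : WeaklyIdempotentComplete A)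
    (h : W₃ ⊓ C₁ = C₂) : IsQuillenEquivalence (E.model (projTriple C₃ W₃))
      (E.model (E.leftLocalization C₂ W₂ C₁ W₁)) (Adjunction.id (C := A)) := by
  refine isQuillenEquivalence_leftLocalization h₁ h₂ hE hA h₂₁ h₃ h₃₁ fun _ _ _ _ => ?_
  rw [leftLocalization_eq h₁ h₂ h₃ h₂₁ h₃₁ h]

/-- Here the trivial classes differ in general. But for `X` in `C₂ ≤ W₃` and `Y` in `W₃` the kernel
to be tested lies in `W₃`, and within `W₃` both `W₂` and the trivial class of the localization cut
out `W₁`. -/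
theorem quillenEquivalence₂ (hE : E.HasEnoughProjectives) (hA : WeaklyIdempotentComplete A)
    (h : W₃ ⊓ C₁ = C₂) : IsQuillenEquivalence (E.model (projTriple C₂ W₂))
      (E.model (E.leftLocalization C₃ W₃ C₁ W₁)) (Adjunction.id (C := A)) := by
  refine isQuillenEquivalence_leftLocalization h₁ h₃ hE hA h₃₁ h₂ h₂₁
    fun {K X P Y i p} hc hX hP hY => ?_
  have hX' : (W₃ ⊓ C₁) X := h ▸ hX
  have hK : W₃ K := h₃.right_X₁ hc
    (h₃.thick.biprod hX'.1 (h₃.projectives_le_right _ hP)) hY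
  have e₁ : (W₃ ⊓ (E.leftLocalization C₃ W₃ C₁ W₁).W) K ↔ W₁ K := by
    rw [leftLocalization_inf_right h₁ h₃ hE h₃₁]
  have e₂ : (W₂ ⊓ W₃) K ↔ W₁ K := by
    rw [inf_eq_of_inf_eq h₁ h₂ h₃ h₂₁ h₃₁ h]
  exact ⟨fun hK' => (e₂.2 (e₁.1 ⟨hK, hK'⟩)).1, fun hK' => (e₁.2 (e₂.1 ⟨hK', hK⟩)).2⟩

end ThreePairs

end ExactStructure

/-! ### The shift by integers attached to an autoequivalence -/

/-- Recursion in both directions from `0`, with the inverse equivalences on negative integers. -/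
lemma Int.exists_section_of_equiv {α : ℤ → Sort*} (e : ∀ n, α n ≃ α (n + 1)) (a : α 0) :
    ∃ f : ∀ n, α n, f 0 = a ∧ ∀ n, e n (f n) = f (n + 1) := by
  let p : ∀ n : ℕ, α (Int.ofNat n) := fun n => Nat.rec a (fun k x => e (Int.ofNat k) x) n
  let q : ∀ n : ℕ, α (Int.negSucc n) := fun n =>
    Nat.rec ((e (Int.negSucc 0)).symm a) (fun k x => (e (Int.negSucc (k + 1))).symm x) n
  refine ⟨fun n => match n with
    | Int.ofNat n => p n
    | Int.negSucc n => q n, rfl, ?_⟩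
  rintro (n | _ | n)
  · rfl
  · exact (e (Int.negSucc 0)).apply_symm_apply a
  · exact (e (Int.negSucc (n + 1))).apply_symm_apply (q n)

/-- Sequences of objects `X n` indexed by the integers, together with isomorphisms
`S (X n) ≅ X (n + 1)`. -/
structure ShiftSpectrum {T : Type u} [Category.{v} T] (S : T ⥤ T) where
  obj : ℤ → T
  iso : ∀ n, S.obj (obj n) ≅ obj (n + 1)

namespace ShiftSpectrum

variable {T : Type u} [Category.{v} T] {S : T ⥤ T}

/-- Morphisms of spectra. -/
@[ext]
structure Hom (X Y : ShiftSpectrum S) where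
  hom : ∀ n, X.obj n ⟶ Y.obj n
  comm : ∀ n, S.map (hom n) ≫ (Y.iso n).hom = (X.iso n).hom ≫ hom (n + 1)

instance : Category (ShiftSpectrum S) where
  Hom := Hom
  id X := { hom := fun _ => 𝟙 _, comm := by simp }
  comp f g :=
    { hom := fun n => f.hom n ≫ g.hom n
      comm := fun n => by
        rw [S.map_comp, Category.assoc, g.comm, reassoc_of% f.comm n] }
  id_comp f := Hom.ext (funext fun _ => Category.id_comp _)
  comp_id f := Hom.ext (funext fun _ => Category.comp_id _)
  assoc f g h := Hom.ext (funext fun _ => Category.assoc _ _ _)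

@[ext]
lemma hom_ext {X Y : ShiftSpectrum S} {f g : X ⟶ Y} (h : ∀ n, f.hom n = g.hom n) : f = g :=
  Hom.ext (funext h)

@[simp]
lemma id_hom (X : ShiftSpectrum S) (n : ℤ) : Hom.hom (𝟙 X) n = 𝟙 _ := rfl

@[simp]
lemma comp_hom {X Y Z : ShiftSpectrum S} (f : X ⟶ Y) (g : Y ⟶ Z) (n : ℤ) :
    (f ≫ g).hom n = f.hom n ≫ g.hom n := rfl

@[simp]
lemma eqToHom_hom {X Y : ShiftSpectrum S} (h : X = Y) (n : ℤ) :
    (eqToHom h).hom n = eqToHom (by rw [h]) := by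
  subst h; rfl

/-- The identification `X n ≅ X m` for `n = m`. -/
abbrev cast (X : ShiftSpectrum S) {n m : ℤ} (h : n = m) : X.obj n ≅ X.obj m :=
  eqToIso (congrArg X.obj h)

lemma cast_trans (X : ShiftSpectrum S) {n m k : ℤ} (h : n = m) (h' : m = k) :
    (X.cast h).hom ≫ (X.cast h').hom = (X.cast (h.trans h')).hom :=
  eqToHom_trans (congrArg X.obj h) (congrArg X.obj h')

lemma map_cast (X : ShiftSpectrum S) {n m : ℤ} (h : n = m) :
    S.map (X.cast h).hom ≫ (X.iso m).hom = (X.iso n).hom ≫ (X.cast (by rw [h])).hom := by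
  subst h; simp

lemma hom_cast {X Y : ShiftSpectrum S} (f : X ⟶ Y) {n m : ℤ} (h : n = m) :
    f.hom n ≫ (Y.cast h).hom = (X.cast h).hom ≫ f.hom m := by
  subst h; simp

/-- Isomorphisms of spectra. -/
def isoMk {X Y : ShiftSpectrum S} (e : ∀ n, X.obj n ≅ Y.obj n)
    (he : ∀ n, S.map (e n).hom ≫ (Y.iso n).hom = (X.iso n).hom ≫ (e (n + 1)).hom) : X ≅ Y where
  hom := ⟨fun n => (e n).hom, he⟩
  inv := ⟨fun n => (e n).inv, fun n => by
    rw [← cancel_epi (S.map (e n).hom), ← S.map_comp_assoc, Iso.hom_inv_id, S.map_id,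
      Category.id_comp, reassoc_of% he, Iso.hom_inv_id, Category.comp_id]⟩
  hom_inv_id := hom_ext fun n => (e n).hom_inv_id
  inv_hom_id := hom_ext fun n => (e n).inv_hom_id

variable (S) in
/-- The reindexing of spectra. -/
abbrev reindex (k : ℤ) : ShiftSpectrum S ⥤ ShiftSpectrum S where
  obj X :=
    { obj := fun n => X.obj (n + k)
      iso := fun n => X.iso (n + k) ≪≫ X.cast (by ring) }
  map {X Y} f :=
    { hom := fun n => f.hom (n + k)
      comm := fun n => by
        rw [Iso.trans_hom, Iso.trans_hom, Category.assoc, ← hom_cast, reassoc_of% f.comm] }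

variable (S) in
/-- Reindexing by zero. -/
def reindexZero : reindex S 0 ≅ 𝟭 _ :=
  NatIso.ofComponents (fun X => isoMk (fun n => X.cast (add_zero n)) (fun n => by
    change S.map (X.cast (by ring)).hom ≫ (X.iso n).hom =
      ((X.iso (n + 0)).hom ≫ (X.cast (by ring)).hom) ≫ (X.cast (by ring)).hom
    rw [map_cast, Category.assoc, cast_trans])) (fun f => by
      ext n; exact hom_cast f (add_zero n))

variable (S) in
/-- Reindexing by a sum. -/
def reindexAdd (k l : ℤ) : reindex S (k + l) ≅ reindex S k ⋙ reindex S l :=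
  NatIso.ofComponents (fun X => isoMk (fun n => X.cast (by ring : n + (k + l) = n + l + k))
    (fun n => by
      change S.map (X.cast (by ring)).hom ≫ ((X.iso (n + l + k)).hom ≫ (X.cast (by ring)).hom) ≫
        (X.cast (by ring)).hom =
        ((X.iso (n + (k + l))).hom ≫ (X.cast (by ring)).hom) ≫ (X.cast (by ring)).hom
      rw [Category.assoc, reassoc_of% X.map_cast, cast_trans, cast_trans, Category.assoc,
        cast_trans]))
    (fun {X Y} f => by
      ext n
      exact hom_cast f (by ring : n + (k + l) = n + l + k))

lemma reindexAdd_hom_app_hom (k l : ℤ) (X : ShiftSpectrum S) (n : ℤ) :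
    ((reindexAdd S k l).hom.app X).hom n =
      (X.cast (by ring : n + (k + l) = n + l + k)).hom := rfl

variable (S) in
/-- Reindexing as a shift. -/
def shiftMkCore : ShiftMkCore (ShiftSpectrum S) ℤ where
  F := reindex S
  zero := reindexZero S
  add := reindexAdd S
  assoc_hom_app k l m X := by
    ext n
    rw [comp_hom, comp_hom, comp_hom, eqToHom_hom]
    simp only [reindexAdd_hom_app_hom]
    change (X.cast (by ring)).hom ≫ (X.cast (by ring)).hom =
      (X.cast (by ring)).hom ≫ (X.cast (by ring)).hom ≫ (X.cast (by ring)).hom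
    rw [cast_trans, cast_trans, cast_trans]
  zero_add_hom_app k X := by
    ext n
    rw [comp_hom, eqToHom_hom]
    simp only [reindexAdd_hom_app_hom]
    change (X.cast (by ring)).hom = (X.cast (by ring)).hom ≫ (X.cast (by ring)).hom
    rw [cast_trans]
  add_zero_hom_app k X := by
    ext n
    rw [comp_hom, eqToHom_hom]
    simp only [reindexAdd_hom_app_hom]
    change (X.cast (by ring)).hom = (X.cast (by ring)).hom ≫ (X.cast (by ring)).hom
    rw [cast_trans]

instance : HasShift (ShiftSpectrum S) ℤ := hasShiftMk _ _ (shiftMkCore S)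

variable (S) in
/-- Evaluation in degree zero. -/
@[simps]
def ev : ShiftSpectrum S ⥤ T where
  obj X := X.obj 0
  map f := f.hom 0

/-- The components in degrees `n` and `n + 1` determine each other; faithfulness of `S` is needed on
the way down. -/
instance [S.Faithful] : (ev S).Faithful where
  map_injective {X Y} f g h := by
    have key : ∀ n m, m = n + 1 → (f.hom n = g.hom n ↔ f.hom m = g.hom m) := by
      rintro n _ rfl
      refine ⟨fun h => ?_, fun h => S.map_injective ?_⟩
      · rw [← cancel_epi (X.iso n).hom, ← f.comm, ← g.comm, h]
      · rw [← cancel_mono (Y.iso n).hom, f.comm, g.comm, h]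
    ext n
    induction n using Int.induction_on with
    | zero => exact h
    | succ i hi => exact (key _ _ rfl).1 hi
    | pred i hi => exact (key _ _ (by ring)).2 hi

instance [S.Full] [S.Faithful] : (ev S).Full where
  map_surjective {X Y} u := by
    obtain ⟨f, hf, hf'⟩ := Int.exists_section_of_equiv (α := fun n => X.obj n ⟶ Y.obj n)
      (fun n => (Functor.FullyFaithful.ofFullyFaithful S).homEquiv.trans
        ((X.iso n).homCongr (Y.iso n))) u
    exact ⟨⟨f, fun n => by rw [← hf']; simp [Functor.FullyFaithful.homEquiv]⟩, hf⟩

instance [S.IsEquivalence] : (ev S).EssSurj where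
  mem_essImage X := by
    let p : ℕ → T := fun n => Nat.rec X (fun _ Y => S.obj Y) n
    let q : ℕ → T := fun n => Nat.rec (S.inv.obj X) (fun _ Y => S.inv.obj Y) n
    refine ⟨⟨fun n => match n with
      | Int.ofNat n => p n
      | Int.negSucc n => q n, fun n => match n with
      | Int.ofNat n => Iso.refl _
      | Int.negSucc 0 => S.asEquivalence.counitIso.app X
      | Int.negSucc (n + 1) => S.asEquivalence.counitIso.app (q n)⟩, ⟨Iso.refl _⟩⟩

instance [S.IsEquivalence] : (ev S).IsEquivalence where

end ShiftSpectrum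

/-- An autoequivalence extends to a shift by the integers. -/
theorem exists_hasShift {T : Type u} [Category.{v} T] (S : T ⥤ T) [S.IsEquivalence] :
    ∃ _ : HasShift T ℤ, Nonempty (S ≅ shiftFunctor T (1 : ℤ)) := by
  -- On spectra the shift is reindexing, so its coherence only concerns equalities of integers. It
  -- is carried to `T` by evaluation in degree zero; the structure isomorphism in degree zero
  -- identifies `S` with the shift by one.
  let e := (ShiftSpectrum.ev S).asEquivalence
  let s : ℤ → T ⥤ T := fun n => e.inverse ⋙ shiftFunctor (ShiftSpectrum S) n ⋙ e.functor
  let i : ∀ n, e.functor ⋙ s n ≅ shiftFunctor (ShiftSpectrum S) n ⋙ e.functor := fun n =>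
    (Functor.associator _ _ _).symm ≪≫
      Functor.isoWhiskerRight e.unitIso.symm (shiftFunctor (ShiftSpectrum S) n ⋙ e.functor) ≪≫
      Functor.leftUnitor _
  refine ⟨HasShift.induced e.functor ℤ s i, ⟨?_⟩⟩
  let j : e.functor ⋙ S ≅ shiftFunctor (ShiftSpectrum S) (1 : ℤ) ⋙ e.functor :=
    NatIso.ofComponents (fun X => X.iso 0) (fun f => f.comm 0)
  exact (Functor.leftUnitor _).symm ≪≫ Functor.isoWhiskerRight e.counitIso.symm S ≪≫
    Functor.associator _ _ _ ≪≫ Functor.isoWhiskerLeft e.inverse j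

/-! ### The stable category of a Frobenius exact category -/

/-- An exact category `B` with a class `I` of objects which are both projective and injective,
with enough of them on both sides, and the associated stable relation `r`. -/
structure FrobeniusStructure {B : Type u} [Category.{v} B] [Preadditive B] [HasZeroObject B]
    [HasBinaryBiproducts B] (E : ExactStructure B) (r : HomRel B) where
  I : ObjectProperty B
  I_zero : I 0
  I_biprod : ∀ {P Q : B}, I P → I Q → I (P ⊞ Q)
  rel_iff : ∀ {X Y : B} (f g : X ⟶ Y),
    r f g ↔ ∃ (P : B) (t : X ⟶ P) (s : P ⟶ Y), I P ∧ g - f = t ≫ s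
  inj : ∀ {P X Y Z : B} {f : X ⟶ Y} {g : Y ⟶ Z}, I P → E.Conf f g → ∀ u : X ⟶ P,
    ∃ t : Y ⟶ P, f ≫ t = u
  proj : ∀ {P X Y Z : B} {f : X ⟶ Y} {g : Y ⟶ Z}, I P → E.Conf f g → ∀ u : P ⟶ Z,
    ∃ t : P ⟶ Y, t ≫ g = u
  exists_hull : ∀ X : B, ∃ (P Y : B) (j : X ⟶ P) (q : P ⟶ Y), I P ∧ E.Conf j q
  exists_cover : ∀ X : B, ∃ (K P : B) (k : K ⟶ P) (e : P ⟶ X), I P ∧ E.Conf k e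

namespace FrobeniusStructure

variable {B : Type u} [Category.{v} B] [Preadditive B] [HasZeroObject B] [HasBinaryBiproducts B]
  {E : ExactStructure B} {r : HomRel B} (F : FrobeniusStructure E r)

include F in
lemma congruence : Congruence r where
  equivalence {X Y} :=
    { refl := fun f => (F.rel_iff f f).2 ⟨0, 0, 0, F.I_zero, by simp⟩
      symm := fun {f g} h => by
        obtain ⟨P, t, s, hP, h⟩ := (F.rel_iff f g).1 h
        exact (F.rel_iff g f).2 ⟨P, -t, s, hP, by rw [Preadditive.neg_comp, ← h, neg_sub]⟩
      trans := fun {f g k} h h' => by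
        obtain ⟨P, t, s, hP, h⟩ := (F.rel_iff f g).1 h
        obtain ⟨P', t', s', hP', h'⟩ := (F.rel_iff g k).1 h'
        exact (F.rel_iff f k).2 ⟨P ⊞ P', biprod.lift t t', biprod.desc s s', F.I_biprod hP hP', by
          rw [biprod.lift_desc, ← h, ← h']; abel⟩ }
  comp_left f _ _ h := by
    obtain ⟨P, t, s, hP, h⟩ := (F.rel_iff _ _).1 h
    exact (F.rel_iff _ _).2 ⟨P, f ≫ t, s, hP, by
      rw [Category.assoc, ← h, Preadditive.comp_sub]⟩
  comp_right f h := by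
    obtain ⟨P, t, s, hP, h⟩ := (F.rel_iff _ _).1 h
    exact (F.rel_iff _ _).2 ⟨P, t, s ≫ f, hP, by
      rw [← Category.assoc, ← h, Preadditive.sub_comp]⟩

include F in
lemma rel_add ⦃X Y : B⦄ (f₁ f₂ g₁ g₂ : X ⟶ Y) (hf : r f₁ f₂) (hg : r g₁ g₂) :
    r (f₁ + g₁) (f₂ + g₂) := by
  obtain ⟨P, t, s, hP, h⟩ := (F.rel_iff _ _).1 hf
  obtain ⟨P', t', s', hP', h₁⟩ := (F.rel_iff _ _).1 hg
  exact (F.rel_iff _ _).2 ⟨P ⊞ P', biprod.lift t t', biprod.desc s s', F.I_biprod hP hP', by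
    rw [biprod.lift_desc, ← h, ← h₁]; abel⟩

/-- A chosen embedding of `X` in an injective object. -/
noncomputable def hull (X : B) : B := (F.exists_hull X).choose

/-- The cokernel of the chosen embedding. -/
noncomputable def coker (X : B) : B := (F.exists_hull X).choose_spec.choose

/-- The chosen embedding. -/
noncomputable def ι (X : B) : X ⟶ F.hull X := (F.exists_hull X).choose_spec.choose_spec.choose

/-- The projection on the cokernel of the chosen embedding. -/
noncomputable def q (X : B) : F.hull X ⟶ F.coker X :=
  (F.exists_hull X).choose_spec.choose_spec.choose_spec.choose

lemma I_hull (X : B) : F.I (F.hull X) :=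
  (F.exists_hull X).choose_spec.choose_spec.choose_spec.choose_spec.1

lemma conf_hull (X : B) : E.Conf (F.ι X) (F.q X) :=
  (F.exists_hull X).choose_spec.choose_spec.choose_spec.choose_spec.2

variable [Congruence r] [Preadditive (CategoryTheory.Quotient r)] [(Quotient.functor r).Additive]

include F

lemma map_eq_iff {X Y : B} (f g : X ⟶ Y) :
    (Quotient.functor r).map f = (Quotient.functor r).map g ↔
      ∃ (P : B) (t : X ⟶ P) (s : P ⟶ Y), F.I P ∧ f - g = t ≫ s := by
  rw [eq_comm, Quotient.functor_map_eq_iff, F.rel_iff]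

lemma map_eq_zero {X P Y : B} (hP : F.I P) (t : X ⟶ P) (s : P ⟶ Y) :
    (Quotient.functor r).map (t ≫ s) = 0 := by
  rw [← (Quotient.functor r).map_zero, F.map_eq_iff]
  exact ⟨P, t, s, hP, by simp⟩

lemma isZero_of_I {P : B} (hP : F.I P) : IsZero ((Quotient.functor r).obj P) := by
  rw [IsZero.iff_id_eq_zero, ← (Quotient.functor r).map_id, ← Category.comp_id (𝟙 P)]
  exact F.map_eq_zero hP _ _

section

variable {X Y Z X' Y' Z' : B} {f' : X' ⟶ Y'} {g' : Y' ⟶ Z'} {f : X ⟶ Y} {g : Y ⟶ Z}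

omit [Congruence r] [Preadditive (CategoryTheory.Quotient r)] [(Quotient.functor r).Additive] in
lemma exists_desc (h : E.Conf f g) (h' : E.Conf f' g') (hY' : F.I Y') (u : X ⟶ X') :
    ∃ (v : Y ⟶ Y') (w : Z ⟶ Z'), f ≫ v = u ≫ f' ∧ g ≫ w = v ≫ g' := by
  obtain ⟨v, hv⟩ := F.inj hY' h (u ≫ f')
  obtain ⟨w, hw⟩ := h.exists_desc (v ≫ g') (by rw [reassoc_of% hv, h'.zero, comp_zero])
  exact ⟨v, w, hv, hw⟩

omit [Congruence r] [Preadditive (CategoryTheory.Quotient r)] [(Quotient.functor r).Additive] in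
lemma exists_lift (h : E.Conf f g) (h' : E.Conf f' g') (hY : F.I Y) (w : Z ⟶ Z') :
    ∃ (u : X ⟶ X') (v : Y ⟶ Y'), f ≫ v = u ≫ f' ∧ g ≫ w = v ≫ g' := by
  obtain ⟨v, hv⟩ := F.proj hY h' (g ≫ w)
  obtain ⟨u, hu⟩ := h'.exists_lift (f ≫ v) (by
    rw [Category.assoc, hv, reassoc_of% h.zero, zero_comp])
  exact ⟨u, v, hu.symm, hv.symm⟩

/-- This makes the suspension and the connecting morphisms well defined. A factorization of `u₁ -
u₂` through an injective extends along `f`. After this correction `v₁ - v₂` kills `f`, so it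
descends to `k : Z ⟶ Y'`, and `w₁ - w₂` factors as `k ≫ g'` through `Y'`. -/
lemma desc_unique (h : E.Conf f g) (h' : E.Conf f' g') (hY' : F.I Y') {u₁ u₂ : X ⟶ X'}
    {v₁ v₂ : Y ⟶ Y'} {w₁ w₂ : Z ⟶ Z'} (h₁ : f ≫ v₁ = u₁ ≫ f') (h₁' : g ≫ w₁ = v₁ ≫ g')
    (h₂ : f ≫ v₂ = u₂ ≫ f') (h₂' : g ≫ w₂ = v₂ ≫ g')
    (hu : (Quotient.functor r).map u₁ = (Quotient.functor r).map u₂) :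
    (Quotient.functor r).map w₁ = (Quotient.functor r).map w₂ := by
  obtain ⟨P, t, s, hP, hts⟩ := (F.map_eq_iff _ _).1 hu
  obtain ⟨t', ht'⟩ := F.inj hP h t
  obtain ⟨k, hk⟩ := h.exists_desc (v₁ - v₂ - t' ≫ s ≫ f') (by
    simp only [Preadditive.comp_sub, h₁, h₂, reassoc_of% ht', ← reassoc_of% hts]
    simp)
  refine (F.map_eq_iff _ _).2 ⟨Y', k, g', hY', ?_⟩
  have := h.epi
  rw [← cancel_epi g, reassoc_of% hk]
  simp [h₁', h₂', h'.zero]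

lemma lift_unique (h : E.Conf f g) (h' : E.Conf f' g') (hY : F.I Y) {u₁ u₂ : X ⟶ X'}
    {v₁ v₂ : Y ⟶ Y'} {w₁ w₂ : Z ⟶ Z'} (h₁ : f ≫ v₁ = u₁ ≫ f') (h₁' : g ≫ w₁ = v₁ ≫ g')
    (h₂ : f ≫ v₂ = u₂ ≫ f') (h₂' : g ≫ w₂ = v₂ ≫ g')
    (hw : (Quotient.functor r).map w₁ = (Quotient.functor r).map w₂) :
    (Quotient.functor r).map u₁ = (Quotient.functor r).map u₂ := by
  obtain ⟨P, t, s, hP, hts⟩ := (F.map_eq_iff _ _).1 hw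
  obtain ⟨s', hs'⟩ := F.proj hP h' s
  obtain ⟨k, hk⟩ := h'.exists_lift (v₁ - v₂ - g ≫ t ≫ s') (by
    simp only [Preadditive.sub_comp, ← h₁', ← h₂', Category.assoc, hs', ← hts]
    simp)
  refine (F.map_eq_iff _ _).2 ⟨Y, f, k, hY, ?_⟩
  have := h'.mono
  rw [← cancel_mono f', Category.assoc, hk]
  simp [h₁, h₂, reassoc_of% h.zero]

end

/-- The suspension, as a functor on `B`. -/
noncomputable def suspAux : B ⥤ CategoryTheory.Quotient r where
  obj X := (Quotient.functor r).obj (F.coker X)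
  map {X Y} f := (Quotient.functor r).map (F.exists_desc (F.conf_hull X) (F.conf_hull Y)
    (F.I_hull Y) f).choose_spec.choose
  map_id X := by
    have h := (F.exists_desc (F.conf_hull X) (F.conf_hull X) (F.I_hull X) (𝟙 X)).choose_spec
    rw [← (Quotient.functor r).map_id]
    exact F.desc_unique (F.conf_hull X) (F.conf_hull X) (F.I_hull X) h.choose_spec.1
      h.choose_spec.2 (v₂ := 𝟙 _) (u₂ := 𝟙 _) (by simp) (by simp) rfl
  map_comp {X Y Z} f g := by
    have h := (F.exists_desc (F.conf_hull X) (F.conf_hull Z) (F.I_hull Z) (f ≫ g)).choose_spec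
    have h' := (F.exists_desc (F.conf_hull X) (F.conf_hull Y) (F.I_hull Y) f).choose_spec
    have h'' := (F.exists_desc (F.conf_hull Y) (F.conf_hull Z) (F.I_hull Z) g).choose_spec
    rw [← (Quotient.functor r).map_comp]
    refine F.desc_unique (F.conf_hull X) (F.conf_hull Z) (F.I_hull Z) h.choose_spec.1
      h.choose_spec.2 (u₂ := f ≫ g)
      (v₂ := (F.exists_desc (F.conf_hull X) (F.conf_hull Y) (F.I_hull Y) f).choose ≫
        (F.exists_desc (F.conf_hull Y) (F.conf_hull Z) (F.I_hull Z) g).choose) ?_ ?_ rfl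
    · rw [reassoc_of% h'.choose_spec.1, h''.choose_spec.1, Category.assoc]
    · rw [reassoc_of% h'.choose_spec.2, h''.choose_spec.2, Category.assoc]

lemma suspAux_map {X Y : B} {f : X ⟶ Y} {v : F.hull X ⟶ F.hull Y} {w : F.coker X ⟶ F.coker Y}
    (h₁ : F.ι X ≫ v = f ≫ F.ι Y) (h₂ : F.q X ≫ w = v ≫ F.q Y) :
    F.suspAux.map f = (Quotient.functor r).map w := by
  have h := (F.exists_desc (F.conf_hull X) (F.conf_hull Y) (F.I_hull Y) f).choose_spec
  exact F.desc_unique (F.conf_hull X) (F.conf_hull Y) (F.I_hull Y) h.choose_spec.1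
      h.choose_spec.2 h₁ h₂ rfl

/-- The suspension functor. -/
noncomputable def susp : CategoryTheory.Quotient r ⥤ CategoryTheory.Quotient r :=
  CategoryTheory.Quotient.lift r F.suspAux (by
    intro X Y f g hfg
    obtain ⟨v, w, h₁, h₂⟩ := F.exists_desc (F.conf_hull X) (F.conf_hull Y) (F.I_hull Y) f
    obtain ⟨v', w', h₁', h₂'⟩ := F.exists_desc (F.conf_hull X) (F.conf_hull Y) (F.I_hull Y) g
    rw [F.suspAux_map h₁ h₂, F.suspAux_map h₁' h₂']
    exact F.desc_unique (F.conf_hull X) (F.conf_hull Y) (F.I_hull Y) h₁ h₂ h₁' h₂'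
      (CategoryTheory.Quotient.sound r hfg))

lemma susp_map {X Y : B} {f : X ⟶ Y} {v : F.hull X ⟶ F.hull Y} {w : F.coker X ⟶ F.coker Y}
    (h₁ : F.ι X ≫ v = f ≫ F.ι Y) (h₂ : F.q X ≫ w = v ≫ F.q Y) :
    F.susp.map ((Quotient.functor r).map f) = (Quotient.functor r).map w :=
  F.suspAux_map h₁ h₂

section

variable {X Y Z X' Y' Z' : B} {f' : X' ⟶ Y'} {g' : Y' ⟶ Z'} {f : X ⟶ Y} {g : Y ⟶ Z}

/-- The connecting morphism of a conflation. -/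
noncomputable def conn (h : E.Conf f g) :
    (Quotient.functor r).obj Z ⟶ F.susp.obj ((Quotient.functor r).obj X) :=
  (Quotient.functor r).map (F.exists_desc h (F.conf_hull X) (F.I_hull X) (𝟙 X)).choose_spec.choose

lemma conn_eq (h : E.Conf f g) {v : Y ⟶ F.hull X} {w : Z ⟶ F.coker X} (h₁ : f ≫ v = F.ι X)
    (h₂ : g ≫ w = v ≫ F.q X) : F.conn h = (Quotient.functor r).map w := by
  have H := (F.exists_desc h (F.conf_hull X) (F.I_hull X) (𝟙 X)).choose_spec
  exact F.desc_unique h (F.conf_hull X) (F.I_hull X) H.choose_spec.1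
      H.choose_spec.2 (u₂ := 𝟙 X) (by simpa using h₁) h₂ rfl

omit [Congruence r] [Preadditive (CategoryTheory.Quotient r)] [(Quotient.functor r).Additive] in
lemma exists_conn (h : E.Conf f g) : ∃ (v : Y ⟶ F.hull X) (w : Z ⟶ F.coker X),
    f ≫ v = F.ι X ∧ g ≫ w = v ≫ F.q X := by
  obtain ⟨v, w, h₁, h₂⟩ := F.exists_desc h (F.conf_hull X) (F.I_hull X) (𝟙 X)
  exact ⟨v, w, by simpa using h₁, h₂⟩

lemma conn_naturality (h : E.Conf f g) (h' : E.Conf f' g') {u : X ⟶ X'} {v : Y ⟶ Y'}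
    {w : Z ⟶ Z'} (h₁ : f ≫ v = u ≫ f') (h₂ : g ≫ w = v ≫ g') :
    F.conn h ≫ F.susp.map ((Quotient.functor r).map u) =
      (Quotient.functor r).map w ≫ F.conn h' := by
  obtain ⟨v₀, w₀, a₀, b₀⟩ := F.exists_conn h
  obtain ⟨v₁, w₁, a₁, b₁⟩ := F.exists_conn h'
  obtain ⟨v₂, w₂, a₂, b₂⟩ := F.exists_desc (F.conf_hull X) (F.conf_hull X') (F.I_hull X') u
  rw [F.conn_eq h a₀ b₀, F.conn_eq h' a₁ b₁, F.susp_map a₂ b₂]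
  refine ((Quotient.functor r).map_comp _ _).symm.trans
    (Eq.trans ?_ ((Quotient.functor r).map_comp _ _))
  refine F.desc_unique h (F.conf_hull X') (F.I_hull X') (u₁ := u) (u₂ := u) (v₁ := v₀ ≫ v₂)
    (v₂ := v ≫ v₁) ?_ ?_ ?_ ?_ rfl
  · rw [reassoc_of% a₀, a₂]
  · rw [reassoc_of% b₀, b₂, Category.assoc]
  · rw [reassoc_of% h₁, a₁]
  · rw [reassoc_of% h₂, b₁, Category.assoc]

/-- Both `f` and the chosen hull embed `X` in an object of `I`. Comparison morphisms in the two
directions are inverse to each other by `desc_unique`. -/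
lemma isIso_conn (h : E.Conf f g) (hY : F.I Y) : IsIso (F.conn h) := by
  obtain ⟨v, w, a, b⟩ := F.exists_conn h
  obtain ⟨v', w', a', b'⟩ := F.exists_desc (F.conf_hull X) h hY (𝟙 X)
  rw [F.conn_eq h a b]
  refine ⟨(Quotient.functor r).map w', ?_, ?_⟩
  · refine ((Quotient.functor r).map_comp _ _).symm.trans
      (Eq.trans ?_ ((Quotient.functor r).map_id _))
    refine F.desc_unique h h hY (u₁ := 𝟙 X) (u₂ := 𝟙 X) (v₁ := v ≫ v') (v₂ := 𝟙 _) ?_ ?_ (by simp)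
      (by simp) rfl
    · rw [reassoc_of% a, a']
    · rw [reassoc_of% b, b', Category.assoc]
  · refine ((Quotient.functor r).map_comp _ _).symm.trans
      (Eq.trans ?_ ((Quotient.functor r).map_id _))
    refine F.desc_unique (F.conf_hull X) (F.conf_hull X) (F.I_hull X) (u₁ := 𝟙 X) (u₂ := 𝟙 X)
      (v₁ := v' ≫ v) (v₂ := 𝟙 _) ?_ ?_ (by simp)
      ((Category.comp_id _).trans (Category.id_comp _).symm) rfl
    · rw [reassoc_of% a', a, Category.id_comp]
    · rw [reassoc_of% b', b, Category.assoc]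

end

/-- The Frobenius property is essential here: the hulls are also projective, so morphisms of
cokernels lift back to morphisms of the objects, and every object is the cokernel of a monomorphism
into an object of `I`. -/
lemma susp_isEquivalence : F.susp.IsEquivalence where
  faithful := ⟨fun {X Y} f g hfg => by
    obtain ⟨f, rfl⟩ := (Quotient.functor r).map_surjective f
    obtain ⟨g, rfl⟩ := (Quotient.functor r).map_surjective g
    obtain ⟨v, w, h₁, h₂⟩ := F.exists_desc (F.conf_hull X.as) (F.conf_hull Y.as) (F.I_hull Y.as) f
    obtain ⟨v', w', h₁', h₂'⟩ :=
      F.exists_desc (F.conf_hull X.as) (F.conf_hull Y.as) (F.I_hull Y.as) g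
    have hfg : F.susp.map ((Quotient.functor r).map f) =
        F.susp.map ((Quotient.functor r).map g) := hfg
    rw [F.susp_map h₁ h₂, F.susp_map h₁' h₂'] at hfg
    exact F.lift_unique (F.conf_hull X.as) (F.conf_hull Y.as) (F.I_hull X.as) h₁ h₂ h₁' h₂' hfg⟩
  full := ⟨fun {X Y} f => by
    obtain ⟨w, rfl⟩ := (Quotient.functor r).map_surjective (X := F.coker X.as) (Y := F.coker Y.as) f
    obtain ⟨u, v, h₁, h₂⟩ := F.exists_lift (F.conf_hull X.as) (F.conf_hull Y.as) (F.I_hull X.as) w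
    exact ⟨(Quotient.functor r).map u, F.susp_map h₁ h₂⟩⟩
  essSurj := ⟨fun Z => by
    obtain ⟨K, P, k, e, hP, hc⟩ := F.exists_cover Z.as
    have := F.isIso_conn hc hP
    exact ⟨(Quotient.functor r).obj K, ⟨(asIso (F.conn hc)).symm⟩⟩⟩

lemma hasZeroObject : HasZeroObject (CategoryTheory.Quotient r) :=
  ⟨(Quotient.functor r).obj 0, F.isZero_of_I F.I_zero⟩

lemma map_biprod_lift {X P Y : B} (hP : F.I P) (a : X ⟶ P) (b : X ⟶ Y) :
    (Quotient.functor r).map (biprod.lift a b) =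
      (Quotient.functor r).map b ≫ (Quotient.functor r).map biprod.inr := by
  rw [biprod.lift_eq, (Quotient.functor r).map_add, F.map_eq_zero hP, zero_add,
    (Quotient.functor r).map_comp]

lemma map_biprod_desc {X P Y : B} (hP : F.I P) (a : P ⟶ X) (b : Y ⟶ X) :
    (Quotient.functor r).map (biprod.desc a b) =
      (Quotient.functor r).map biprod.snd ≫ (Quotient.functor r).map b := by
  rw [biprod.desc_eq, (Quotient.functor r).map_add, F.map_eq_zero hP, zero_add,
    (Quotient.functor r).map_comp]

/-- Adding a projective-injective summand does not change the stable isomorphism class. -/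
@[simps]
noncomputable def isoBiprod {P : B} (hP : F.I P) (Y : B) :
    (Quotient.functor r).obj Y ≅ (Quotient.functor r).obj (P ⊞ Y) where
  hom := (Quotient.functor r).map biprod.inr
  inv := (Quotient.functor r).map biprod.snd
  hom_inv_id := by rw [← (Quotient.functor r).map_comp, biprod.inr_snd, (Quotient.functor r).map_id]
  inv_hom_id := by
    rw [← F.map_biprod_lift hP biprod.fst, ← (Quotient.functor r).map_id]
    congr 1
    ext <;> simp

end FrobeniusStructure

lemma hasBinaryBiproducts_quotient {B : Type u} [Category.{v} B] [Preadditive B]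
    [HasBinaryBiproducts B] (r : HomRel B) [Preadditive (CategoryTheory.Quotient r)]
    [(Quotient.functor r).Additive] :
    HasBinaryBiproducts (CategoryTheory.Quotient r) where
  has_binary_biproduct X Y := by
    refine hasBinaryBiproduct_of_total
      ((Quotient.functor r).mapBinaryBicone (BinaryBiproduct.bicone X.as Y.as)) ?_
    have : (Quotient.functor r).map (biprod.fst : X.as ⊞ Y.as ⟶ _) ≫
        (Quotient.functor r).map biprod.inl + (Quotient.functor r).map biprod.snd ≫
        (Quotient.functor r).map biprod.inr = 𝟙 _ := by
      rw [← Functor.map_comp, ← Functor.map_comp, ← Functor.map_add, biprod.total,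
        (Quotient.functor r).map_id]
    exact this

section

variable {T : Type u} [Category.{v} T] [HasShift T ℤ] {X' Y' Z' X Y Z : T}

/-- An isomorphism between two triangles, given by its components. -/
def triangleIsoMk {f : X ⟶ Y} {g : Y ⟶ Z} {h : Z ⟶ X⟦(1 : ℤ)⟧} {f' : X' ⟶ Y'} {g' : Y' ⟶ Z'}
    {h' : Z' ⟶ X'⟦(1 : ℤ)⟧} (e₁ : X ≅ X') (e₂ : Y ≅ Y') (e₃ : Z ≅ Z')
    (w₁ : f ≫ e₂.hom = e₁.hom ≫ f') (w₂ : g ≫ e₃.hom = e₂.hom ≫ g')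
    (w₃ : h ≫ e₁.hom⟦(1 : ℤ)⟧' = e₃.hom ≫ h') : Triangle.mk f g h ≅ Triangle.mk f' g' h' :=
  Triangle.isoMk _ _ e₁ e₂ e₃ w₁ w₂ w₃

lemma exists_isos_of_iso {Δ : Triangle T} {f : X ⟶ Y} {g : Y ⟶ Z} {h : Z ⟶ X⟦(1 : ℤ)⟧}
    (e : Δ ≅ Triangle.mk f g h) : ∃ (e₁ : Δ.obj₁ ≅ X) (e₂ : Δ.obj₂ ≅ Y) (e₃ : Δ.obj₃ ≅ Z),
      Δ.mor₁ ≫ e₂.hom = e₁.hom ≫ f ∧ Δ.mor₂ ≫ e₃.hom = e₂.hom ≫ g ∧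
      Δ.mor₃ ≫ e₁.hom⟦(1 : ℤ)⟧' = e₃.hom ≫ h :=
  ⟨Triangle.π₁.mapIso e, Triangle.π₂.mapIso e, Triangle.π₃.mapIso e, e.hom.comm₁, e.hom.comm₂,
    e.hom.comm₃⟩

end

/-! ### The triangulation of the stable category -/

namespace FrobeniusStructure

variable {B : Type u} [Category.{v} B] [Preadditive B] [HasZeroObject B] [HasBinaryBiproducts B]
  {E : ExactStructure B} {r : HomRel B} (F : FrobeniusStructure E r)
  [Congruence r] [Preadditive (CategoryTheory.Quotient r)] [(Quotient.functor r).Additive]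
  [HasShift (CategoryTheory.Quotient r) ℤ]
  (c : F.susp ≅ shiftFunctor (CategoryTheory.Quotient r) (1 : ℤ))
  {X Y Z X' Y' Z' : B} {f' : X' ⟶ Y'} {g' : Y' ⟶ Z'} {f : X ⟶ Y} {g : Y ⟶ Z}

/-- The connecting morphism of a conflation, with values in the shift. -/
noncomputable def delta (h : E.Conf f g) :
    (Quotient.functor r).obj Z ⟶ ((Quotient.functor r).obj X)⟦(1 : ℤ)⟧ :=
  F.conn h ≫ c.hom.app _

/-- The cokernel of the chosen embedding of `X`, as a shift of `X`. -/
noncomputable def cokerIso (X : B) :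
    (Quotient.functor r).obj (F.coker X) ≅ ((Quotient.functor r).obj X)⟦(1 : ℤ)⟧ :=
  c.app ((Quotient.functor r).obj X)

lemma delta_eq (h : E.Conf f g) {v : Y ⟶ F.hull X} {w : Z ⟶ F.coker X} (h₁ : f ≫ v = F.ι X)
    (h₂ : g ≫ w = v ≫ F.q X) :
    F.delta c h = (Quotient.functor r).map w ≫ (F.cokerIso c X).hom := by
  rw [delta, F.conn_eq h h₁ h₂]
  rfl

lemma delta_naturality (h : E.Conf f g) (h' : E.Conf f' g') {u : X ⟶ X'} {v : Y ⟶ Y'}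
    {w : Z ⟶ Z'} (h₁ : f ≫ v = u ≫ f') (h₂ : g ≫ w = v ≫ g') :
    F.delta c h ≫ ((Quotient.functor r).map u)⟦(1 : ℤ)⟧' =
      (Quotient.functor r).map w ≫ F.delta c h' := by
  simp only [delta, Category.assoc]
  rw [← c.hom.naturality, ← reassoc_of% (F.conn_naturality h h' h₁ h₂)]

lemma isIso_delta (h : E.Conf f g) (hY : F.I Y) : IsIso (F.delta c h) := by
  have := F.isIso_conn h hY
  unfold delta
  infer_instance

/-- The standard triangle of a conflation. -/
noncomputable abbrev tri (h : E.Conf f g) : Triangle (CategoryTheory.Quotient r) :=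
  Triangle.mk ((Quotient.functor r).map f) ((Quotient.functor r).map g) (F.delta c h)

/-- The triangles isomorphic to a standard triangle. -/
def dist : Set (Triangle (CategoryTheory.Quotient r)) :=
  {Δ | ∃ (X Y Z : B) (f : X ⟶ Y) (g : Y ⟶ Z) (h : E.Conf f g), Nonempty (Δ ≅ F.tri c h)}

lemma tri_mem (h : E.Conf f g) : F.tri c h ∈ F.dist c := ⟨_, _, _, _, _, h, ⟨Iso.refl _⟩⟩

lemma dist_of_iso {Δ Δ' : Triangle (CategoryTheory.Quotient r)} (h : Δ ∈ F.dist c) (e : Δ' ≅ Δ) :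
    Δ' ∈ F.dist c := by
  obtain ⟨_, _, _, _, _, h, ⟨e'⟩⟩ := h
  exact ⟨_, _, _, _, _, h, ⟨e ≪≫ e'⟩⟩

lemma contractible_mem (X : CategoryTheory.Quotient r) :
    @contractibleTriangle _ _ _ F.hasZeroObject _ X ∈ F.dist c := by
  have := F.hasZeroObject
  refine ⟨_, _, _, _, _, ExactStructure.Conf.id_zero E (X := X.as) (isZero_zero B), ⟨?_⟩⟩
  refine triangleIsoMk (Iso.refl _) (Iso.refl _)
    ((isZero_zero _).iso (F.isZero_of_I F.I_zero)) ?_ ?_ ?_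
  · exact ((Category.comp_id _).trans ((Quotient.functor r).map_id _).symm).trans
      (Category.id_comp _).symm
  · exact (F.isZero_of_I F.I_zero).eq_of_tgt _ _
  · exact (isZero_zero _).eq_of_src _ _

lemma infl_hull (f : X ⟶ Y) : ∃ (Z : B) (p : F.hull X ⊞ Y ⟶ Z),
    E.Conf (biprod.lift (F.ι X) f) p :=
  ExactStructure.Infl.biprodLift ⟨_, _, F.conf_hull X⟩ f

/-- Since the hull is stably zero, `f` may be replaced by the admissible monomorphism `(ι, f)`, and
the cone is the cokernel of the latter. -/
lemma exists_cone {X Y : CategoryTheory.Quotient r} (f : X ⟶ Y) :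
    ∃ (Z : CategoryTheory.Quotient r) (g : Y ⟶ Z) (h : Z ⟶ X⟦(1 : ℤ)⟧),
      Triangle.mk f g h ∈ F.dist c := by
  obtain ⟨f, rfl⟩ := (Quotient.functor r).map_surjective (X := X.as) (Y := Y.as) f
  obtain ⟨Z, p, hp⟩ := F.infl_hull f
  refine ⟨(Quotient.functor r).obj Z,
    (Quotient.functor r).map biprod.inr ≫ (Quotient.functor r).map p, F.delta c hp, _, _, _, _, _,
    hp, ⟨?_⟩⟩
  refine triangleIsoMk (Iso.refl _) (F.isoBiprod (F.I_hull X.as) Y.as) (Iso.refl _) ?_ ?_ ?_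
  · exact (F.map_biprod_lift (F.I_hull X.as) (F.ι X.as) f).symm.trans (Category.id_comp _).symm
  · exact Category.comp_id _
  · exact ((congrArg _ ((shiftFunctor _ (1 : ℤ)).map_id _)).trans (Category.comp_id _)).trans
      (Category.id_comp _).symm

/-- The square commutes only up to a morphism through `I`. Extending its first factor along `f`
gives another representative of `b` for which the square commutes in `B`; then a morphism of
cokernels exists. -/
lemma exists_hom_tri (h : E.Conf f g) (h' : E.Conf f' g')
    (a : (Quotient.functor r).obj X ⟶ (Quotient.functor r).obj X')
    (b : (Quotient.functor r).obj Y ⟶ (Quotient.functor r).obj Y')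
    (hab : (Quotient.functor r).map f ≫ b = a ≫ (Quotient.functor r).map f') :
    ∃ k : (Quotient.functor r).obj Z ⟶ (Quotient.functor r).obj Z',
      (Quotient.functor r).map g ≫ k = b ≫ (Quotient.functor r).map g' ∧
      F.delta c h ≫ a⟦(1 : ℤ)⟧' = k ≫ F.delta c h' := by
  obtain ⟨a, rfl⟩ := (Quotient.functor r).map_surjective a
  obtain ⟨b, rfl⟩ := (Quotient.functor r).map_surjective b
  rw [← (Quotient.functor r).map_comp, ← (Quotient.functor r).map_comp, F.map_eq_iff] at hab
  obtain ⟨P, t, s, hP, hts⟩ := hab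
  obtain ⟨t', ht'⟩ := F.inj hP h t
  have hb : (Quotient.functor r).map b = (Quotient.functor r).map (b - t' ≫ s) :=
    (F.map_eq_iff _ _).2 ⟨P, t', s, hP, by simp⟩
  have hc : f ≫ (b - t' ≫ s) = a ≫ f' := by
    rw [Preadditive.comp_sub, reassoc_of% ht', ← hts]; abel
  obtain ⟨k, hk⟩ := h.exists_desc ((b - t' ≫ s) ≫ g') (by
    rw [reassoc_of% hc, h'.zero, comp_zero])
  refine ⟨(Quotient.functor r).map k, ?_, F.delta_naturality c h h' hc hk⟩
  rw [hb, ← (Quotient.functor r).map_comp, hk, (Quotient.functor r).map_comp]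

lemma exists_hom_dist (Δ Δ' : Triangle (CategoryTheory.Quotient r)) (h : Δ ∈ F.dist c)
    (h' : Δ' ∈ F.dist c) (a : Δ.obj₁ ⟶ Δ'.obj₁) (b : Δ.obj₂ ⟶ Δ'.obj₂)
    (hab : Δ.mor₁ ≫ b = a ≫ Δ'.mor₁) :
    ∃ k : Δ.obj₃ ⟶ Δ'.obj₃, Δ.mor₂ ≫ k = b ≫ Δ'.mor₂ ∧
      Δ.mor₃ ≫ a⟦(1 : ℤ)⟧' = k ≫ Δ'.mor₃ := by
  obtain ⟨_, _, _, _, _, h, ⟨e⟩⟩ := h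
  obtain ⟨_, _, _, _, _, h', ⟨e'⟩⟩ := h'
  obtain ⟨e₁, e₂, e₃, w₁, w₂, w₃⟩ := exists_isos_of_iso e
  obtain ⟨e₁', e₂', e₃', w₁', w₂', w₃'⟩ := exists_isos_of_iso e'
  obtain ⟨k, hk₁, hk₂⟩ := F.exists_hom_tri c h h' (e₁.inv ≫ a ≫ e₁'.hom)
    (e₂.inv ≫ b ≫ e₂'.hom) (by
      rw [← cancel_epi e₁.hom, ← reassoc_of% w₁, e₂.hom_inv_id_assoc, reassoc_of% hab, w₁']
      simp)
  refine ⟨e₃.hom ≫ k ≫ e₃'.inv, ?_, ?_⟩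
  · rw [reassoc_of% w₂, reassoc_of% hk₁, ← cancel_mono e₃'.hom]
    simp [w₂']
  · rw [← cancel_mono (e₁'.hom⟦(1 : ℤ)⟧'), Category.assoc, Category.assoc, Category.assoc, w₃',
      Category.assoc, e₃'.inv_hom_id_assoc, ← hk₂, ← reassoc_of% w₃]
    simp [← Functor.map_comp]

variable [∀ n : ℤ, (shiftFunctor (CategoryTheory.Quotient r) n).Additive]

/-- Comparing the conflation with the hull of `X` gives the conflation `Y ⟶ hull X ⊞ Z ⟶ coker X`,
whose triangle is the rotated one because the hull is stably zero. -/
lemma rotate_tri_mem (h : E.Conf f g) : (F.tri c h).rotate ∈ F.dist c := by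
  obtain ⟨v, w, h₁, h₂⟩ := F.exists_conn h
  have hR := h.mappingCocone (F.conf_hull X) v w h₁ h₂.symm
  have hc : F.delta c hR = (F.cokerIso c X).hom ≫ ((Quotient.functor r).map f)⟦(1 : ℤ)⟧' := by
    have := F.delta_naturality c (F.conf_hull X) hR (u := f) (v := biprod.inl) (w := 𝟙 _)
      (by ext <;> simp [h₁, h.zero]) (by simp)
    rw [(Quotient.functor r).map_id, Category.id_comp] at this
    rw [← this, F.delta_eq c (F.conf_hull X) (v := 𝟙 _) (w := 𝟙 _) (by simp) (by simp)]
    simp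
  have hδ := F.delta_eq c h h₁ h₂
  -- The second morphism of that conflation is `-w` on `Z`, whereas the connecting morphism is given
  -- by `w`. The sign in `k` corrects this and produces the sign of the rotation.
  let k : (Quotient.functor r).obj (F.coker X) ≅ ((Quotient.functor r).obj X)⟦(1 : ℤ)⟧ :=
    { hom := -(F.cokerIso c X).hom
      inv := -(F.cokerIso c X).inv }
  refine F.dist_of_iso c (F.tri_mem c hR) (Iso.symm (triangleIsoMk
    (f' := (Quotient.functor r).map g) (g' := F.delta c h)
    (h' := -((Quotient.functor r).map f)⟦(1 : ℤ)⟧') (Iso.refl _)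
    (F.isoBiprod (F.I_hull X) Z).symm k ?_ ?_ ?_))
  · rw [Iso.symm_hom, isoBiprod_inv, ← (Quotient.functor r).map_comp, biprod.lift_snd]
    exact (Category.id_comp _).symm
  · rw [Iso.symm_hom, isoBiprod_inv]
    dsimp [k]
    rw [hδ, F.map_biprod_desc (F.I_hull X), Functor.map_neg, Preadditive.comp_neg,
      Preadditive.comp_neg, Preadditive.neg_comp, neg_neg, Category.assoc]
  · dsimp [k]
    rw [hc, CategoryTheory.Functor.map_id, Category.comp_id, Preadditive.neg_comp,
      Preadditive.comp_neg, neg_neg]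

/-- With `K` the kernel of an epimorphism `P ⟶ Z` from an object of `I`, the connecting morphism `Z
⟶ K⟦1⟧` is an isomorphism. The triangle of the conflation `K ⟶ P ⊞ X ⟶ Y` then rotates to the given
one. -/
lemma exists_rotate_iso (h : E.Conf f g) : ∃ Δ ∈ F.dist c, Nonempty (F.tri c h ≅ Δ.rotate) := by
  obtain ⟨K, P, k, e, hP, hke⟩ := F.exists_cover Z
  obtain ⟨u, v, h₁, h₂⟩ := F.exists_lift hke h hP (𝟙 Z)
  rw [Category.comp_id] at h₂
  have hD := hke.mappingCone h u v h₁ h₂.symm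
  have hδ : F.delta c hD = (Quotient.functor r).map g ≫ F.delta c hke := by
    have := F.delta_naturality c hD hke (u := 𝟙 _) (v := biprod.fst) (w := g) (by simp)
      (by ext <;> simp [h₂, h.zero])
    rw [← this]
    simp
  have hδ' : F.delta c hke ≫ ((Quotient.functor r).map u)⟦(1 : ℤ)⟧' = F.delta c h := by
    have := F.delta_naturality c hke h h₁ (w := 𝟙 _) (by simpa using h₂)
    rw [this, (Quotient.functor r).map_id, Category.id_comp]
  have := F.isIso_delta c hke hP
  let i : (Quotient.functor r).obj X ≅ (Quotient.functor r).obj (P ⊞ X) :=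
    { hom := -(Quotient.functor r).map biprod.inr
      inv := -(Quotient.functor r).map biprod.snd
      hom_inv_id := by simpa using (F.isoBiprod hP X).hom_inv_id
      inv_hom_id := by simpa using (F.isoBiprod hP X).inv_hom_id }
  refine ⟨_, F.tri_mem c hD, ⟨triangleIsoMk
    (f' := (Quotient.functor r).map (biprod.desc v (-f))) (g' := F.delta c hD)
    (h' := -((Quotient.functor r).map (biprod.lift k u))⟦(1 : ℤ)⟧') i (Iso.refl _)
    (asIso (F.delta c hke)) ?_ ?_ ?_⟩⟩
  · dsimp [i]
    rw [Preadditive.neg_comp, ← (Quotient.functor r).map_comp, biprod.inr_desc, Functor.map_neg,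
      neg_neg, Category.comp_id]
  · dsimp
    rw [hδ, Category.id_comp]
  · dsimp [i]
    rw [F.map_biprod_lift hP, Functor.map_neg, Preadditive.comp_neg, Preadditive.comp_neg,
      Functor.map_comp, reassoc_of% hδ']

lemma rotate_mem_iff (Δ : Triangle (CategoryTheory.Quotient r)) :
    Δ ∈ F.dist c ↔ Δ.rotate ∈ F.dist c := by
  constructor
  · rintro ⟨_, _, _, _, _, h, ⟨e⟩⟩
    exact F.dist_of_iso c (F.rotate_tri_mem c h) ((rotate _).mapIso e)
  · rintro ⟨_, _, _, _, _, h, ⟨e⟩⟩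
    obtain ⟨Δ', hΔ', ⟨e₁⟩⟩ := F.exists_rotate_iso c h
    exact F.dist_of_iso c hΔ' ((triangleRotation (CategoryTheory.Quotient r)).functor.preimageIso
      (e ≪≫ e₁))

/-- The pretriangulated structure of the stable category. -/
noncomputable abbrev pretriangulated [HasZeroObject (CategoryTheory.Quotient r)] :
    Pretriangulated (CategoryTheory.Quotient r) where
  distinguishedTriangles := F.dist c
  isomorphic_distinguished _ h _ e := F.dist_of_iso c h e
  contractible_distinguished X := F.contractible_mem c X
  distinguished_cocone_triangle f := F.exists_cone c f
  rotate_distinguished_triangle Δ := F.rotate_mem_iff c Δ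
  complete_distinguished_triangle_morphism Δ Δ' h h' a b hab :=
    F.exists_hom_dist c Δ Δ' h h' a b hab

/-- The octahedron is Noether's isomorphism theorem. Both morphisms are replaced by stably
isomorphic admissible monomorphisms that can be composed, which is why the second starts at `hull X
⊞ Y`; the conflation of the three cokernels is the required triangle. -/
lemma isTriangulated [HasZeroObject (CategoryTheory.Quotient r)] :
    @IsTriangulated (CategoryTheory.Quotient r) _ _ _ _ _ (F.pretriangulated c) := by
  let := F.pretriangulated c
  refine IsTriangulated.mk' fun X Y Z f g => ?_
  obtain ⟨f, rfl⟩ := (Quotient.functor r).map_surjective (X := X.as) (Y := Y.as) f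
  obtain ⟨g, rfl⟩ := (Quotient.functor r).map_surjective (X := Y.as) (Y := Z.as) g
  obtain ⟨U, p, hp⟩ := F.infl_hull f
  obtain ⟨V, q, hq⟩ := F.infl_hull (biprod.snd ≫ g : F.hull X.as ⊞ Y.as ⟶ _)
  obtain ⟨N, k, hk⟩ := ExactStructure.Infl.comp ⟨_, _, hp⟩ ⟨_, _, hq⟩
  obtain ⟨a, b, hab, h₁, h₂⟩ := hp.noether hq hk
  refine ⟨_, _, _, _, _, _, _, _, Iso.refl ((Quotient.functor r).obj X.as),
    F.isoBiprod (F.I_hull X.as) Y.as, F.isoBiprod (F.I_hull (F.hull X.as ⊞ Y.as)) Z.as, ?_, ?_,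
    _, _, F.tri_mem c hp, _, _, F.tri_mem c hq,
    _, _, F.tri_mem c hk, ⟨?_⟩⟩
  · exact (F.map_biprod_lift (F.I_hull X.as) (F.ι X.as) f).symm.trans (Category.id_comp _).symm
  · rw [F.map_biprod_lift (F.I_hull _), (Quotient.functor r).map_comp]
    exact ((F.isoBiprod (F.I_hull X.as) Y.as).hom_inv_id_assoc _).symm.trans (by simp)
  · refine
      { m₁ := (Quotient.functor r).map a
        m₃ := (Quotient.functor r).map b
        comm₁ := ?_
        comm₂ := ?_
        comm₃ := ?_
        comm₄ := ?_
        mem := ?_ }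
    · rw [← (Quotient.functor r).map_comp, h₁, (Quotient.functor r).map_comp]
    · rw [← F.delta_naturality c hp hk (u := 𝟙 _) (v := biprod.lift (F.ι _) (biprod.snd ≫ g))
        (by simp) h₁]
      simp
    · rw [← (Quotient.functor r).map_comp, h₂]
    · exact F.delta_naturality c hk hq (v := 𝟙 _) (by simp) (by simpa using h₂)
    · have := F.delta_naturality c hq hab (u := p) (v := k) (w := 𝟙 _) h₁.symm
          (by simpa using h₂.symm)
      rw [this, (Quotient.functor r).map_id, Category.id_comp]
      exact F.tri_mem c hab

lemma exists_triangulatedStructure {B : Type u} [Category.{v} B] [Preadditive B] [HasZeroObject B]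
    [HasBinaryBiproducts B] {E : ExactStructure B} {r : HomRel B} (F : FrobeniusStructure E r) :
    ∃ _ : TriangulatedStructure (CategoryTheory.Quotient r),
      IsInducedTriangulation E.conf (Quotient.functor r) := by
  have := F.congruence
  let := Quotient.preadditive r F.rel_add
  have : (Quotient.functor r).Additive := Quotient.functor_additive r F.rel_add
  have := F.susp_isEquivalence
  have := F.hasZeroObject
  obtain ⟨_, ⟨c⟩⟩ := exists_hasShift F.susp
  have := hasBinaryBiproducts_quotient r
  -- Shift functors are equivalences, so they preserve binary products and are additive.
  have : ∀ n : ℤ, (shiftFunctor (CategoryTheory.Quotient r) n).Additive := fun n => by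
    have : PreservesBinaryBiproducts (shiftFunctor (CategoryTheory.Quotient r) n) :=
      preservesBinaryBiproducts_of_preservesBinaryProducts _
    exact Functor.additive_of_preservesBinaryBiproducts _
  refine ⟨{
    preadditive := inferInstance
    hasZeroObject := inferInstance
    hasShift := inferInstance
    shift_additive := inferInstance
    pretriangulated := F.pretriangulated c
    isTriangulated := F.isTriangulated c }, inferInstance,
      fun S hS => F.delta c ((E.conf_iff S).1 hS), ?_, ?_⟩
  · intro S S' hS hS' φ
    exact F.delta_naturality c _ _ φ.comm₁₂.symm φ.comm₂₃.symm
  · intro Δ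
    constructor
    · rintro ⟨X, Y, Z, f, g, h, e⟩
      exact ⟨ShortComplex.mk f g h.zero, (E.conf_mk_iff _).2 h, e⟩
    · rintro ⟨S, hS, e⟩
      exact ⟨_, _, _, _, _, (E.conf_iff S).1 hS, e⟩

end FrobeniusStructure

/-! ### Extension closed subcategories and the Frobenius category of cofibrant objects -/

namespace ExactStructure

variable {A : Type u} [Category.{v} A] [Preadditive A] [HasZeroObject A] [HasBinaryBiproducts A]
variable {E : ExactStructure A}

variable (E) in
/-- Classes of objects which contain the zero objects and are closed under extensions. -/
structure IsExtensionClosed (C : ObjectProperty A) : Prop where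
  zero : C 0
  ext : ∀ {X Y Z : A} {f : X ⟶ Y} {g : Y ⟶ Z}, E.Conf f g → C X → C Z → C Y

namespace IsExtensionClosed

variable {C : ObjectProperty A} (h : E.IsExtensionClosed C)

include h

lemma hasZeroObject : HasZeroObject C.FullSubcategory :=
  ⟨⟨0, h.zero⟩, by
    rw [IsZero.iff_id_eq_zero]
    ext : 1
    exact (isZero_zero A).eq_of_src _ _⟩

lemma hasBinaryBiproducts : HasBinaryBiproducts C.FullSubcategory where
  has_binary_biproduct X Y := hasBinaryBiproduct_of_total
    { pt := ⟨X.obj ⊞ Y.obj, h.ext (Conf.inl_snd E X.obj Y.obj) X.property Y.property⟩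
      fst := ObjectProperty.homMk biprod.fst
      snd := ObjectProperty.homMk biprod.snd
      inl := ObjectProperty.homMk biprod.inl
      inr := ObjectProperty.homMk biprod.inr
      inl_fst := by ext; exact biprod.inl_fst
      inl_snd := by ext; exact biprod.inl_snd
      inr_fst := by ext; exact biprod.inr_fst
      inr_snd := by ext; exact biprod.inr_snd } (by ext : 1; exact biprod.total)

end IsExtensionClosed

lemma confOn_mk_iff {C : ObjectProperty A} {X Y Z : C.FullSubcategory} {f : X ⟶ Y} {g : Y ⟶ Z}
    (w : f ≫ g = 0) : E.confOn C (ShortComplex.mk f g w) ↔ E.Conf f.hom g.hom :=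
  E.conf_iff _

/-- The exact structure of an extension closed full subcategory. -/
def restrict {C : ObjectProperty A} (h : E.IsExtensionClosed C) [HasZeroObject C.FullSubcategory]
    [HasBinaryBiproducts C.FullSubcategory] : ExactStructure C.FullSubcategory where
  conf := E.confOn C
  isKernel S hS := by
    have hS := (E.conf_iff _).1 hS
    have : Mono S.f.hom := hS.mono
    choose l hl using fun (X : A) (k : X ⟶ S.X₂.obj) (hk : k ≫ S.g.hom = 0) =>
      hS.exists_lift k hk
    exact ⟨KernelFork.IsLimit.ofι _ _
      (fun {X} k hk => ObjectProperty.homMk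
        (l X.obj k.hom (congrArg InducedCategory.Hom.hom hk)))
      (fun {X} k hk => by ext; exact hl _ _ _)
      (fun {X} k hk m hm => by
        ext
        exact (cancel_mono S.f.hom).1
          ((congrArg InducedCategory.Hom.hom hm).trans (hl _ _ _).symm))⟩
  isCokernel S hS := by
    have hS := (E.conf_iff _).1 hS
    have : Epi S.g.hom := hS.epi
    choose l hl using fun (X : A) (k : S.X₂.obj ⟶ X) (hk : S.f.hom ≫ k = 0) =>
      hS.exists_desc k hk
    exact ⟨CokernelCofork.IsColimit.ofπ _ _
      (fun {X} k hk => ObjectProperty.homMk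
        (l X.obj k.hom (congrArg InducedCategory.Hom.hom hk)))
      (fun {X} k hk => by ext; exact hl _ _ _)
      (fun {X} k hk m hm => by
        ext
        exact (cancel_epi S.g.hom).1
          ((congrArg InducedCategory.Hom.hom hm).trans (hl _ _ _).symm))⟩
  conf_of_iso e hS := E.conf_of_iso (C.ι.mapShortComplex.mapIso e) hS
  conf_of_splitting S s := E.conf_of_splitting _ (s.map C.ι)
  mono_comp := by
    rintro X Y Z f g ⟨U, p, w, hp⟩ ⟨V, q, w', hq⟩
    rw [confOn_mk_iff] at hp hq
    obtain ⟨N, n, hn⟩ := hp.infl.comp hq.infl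
    -- The cokernel of the composite is an extension of `V` by `U`, so it stays in `C`.
    obtain ⟨c, d, hcd, -, -⟩ := hp.noether hq hn
    exact ⟨⟨N, h.ext hcd U.property V.property⟩, ObjectProperty.homMk n,
      by ext; exact hn.zero, (confOn_mk_iff _).2 hn⟩
  epi_comp := by
    rintro X Y Z f g ⟨U, p, w, hp⟩ ⟨V, q, w', hq⟩
    rw [confOn_mk_iff] at hp hq
    obtain ⟨N, n, hn⟩ := hp.defl.comp hq.defl
    obtain ⟨c, d, hcd, -, -⟩ := hp.noether' hq hn
    exact ⟨⟨N, h.ext hcd U.property V.property⟩, ObjectProperty.homMk n,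
      by ext; exact hn.zero, (confOn_mk_iff _).2 hn⟩
  mono_pushout := by
    rintro X Y X' f a ⟨Z, p, w, hp⟩
    rw [confOn_mk_iff] at hp
    obtain ⟨Y', a', f', p', hpo, hc, -⟩ := hp.exists_pushout a.hom
    refine ⟨⟨Y', h.ext hc X'.property Z.property⟩, ObjectProperty.homMk a',
      ObjectProperty.homMk f', IsPushout.of_map C.ι (by ext; exact hpo.w) hpo, Z,
      ObjectProperty.homMk p', by ext; exact hc.zero, (confOn_mk_iff _).2 hc⟩
  epi_pullback := by
    rintro X Y X' f a ⟨Z, p, w, hp⟩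
    rw [confOn_mk_iff] at hp
    obtain ⟨Y', a', f', p', hpo, hc, -⟩ := hp.exists_pullback a.hom
    refine ⟨⟨Y', h.ext hc Z.property X'.property⟩, ObjectProperty.homMk a',
      ObjectProperty.homMk f', IsPullback.of_map C.ι (by ext; exact hpo.w) hpo, Z,
      ObjectProperty.homMk p', by ext; exact hc.zero, (confOn_mk_iff _).2 hc⟩

lemma restrict_conf_iff {C : ObjectProperty A} (h : E.IsExtensionClosed C)
    [HasZeroObject C.FullSubcategory] [HasBinaryBiproducts C.FullSubcategory]
    {X Y Z : C.FullSubcategory} {f : X ⟶ Y} {g : Y ⟶ Z} :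
    (restrict h).Conf f g ↔ E.Conf f.hom g.hom :=
  ⟨fun ⟨w, hw⟩ => (confOn_mk_iff w).1 hw, fun hw => ⟨by ext; exact hw.zero,
    (confOn_mk_iff _).2 hw⟩⟩

namespace IsProjectiveCotorsionPair

variable {C W : ObjectProperty A} (h : E.IsProjectiveCotorsionPair C W)

include h

lemma isExtensionClosed : E.IsExtensionClosed C where
  zero := h.projectives_le _ (projectives_of_isZero (isZero_zero A))
  ext hfg hX hZ := h.left_ext hfg hX hZ

/-- The cofibrant objects of a projective cotorsion pair form a Frobenius category. -/
def frobeniusStructure (hE : E.HasEnoughProjectives) [HasZeroObject C.FullSubcategory]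
    [HasBinaryBiproducts C.FullSubcategory] :
    FrobeniusStructure (restrict h.isExtensionClosed) (E.stableRel C) where
  I X := E.projectives X.obj
  I_zero := projectives_of_isZero (C.ι.map_isZero (isZero_zero _))
  I_biprod {P Q} hP hQ := projectives_of_retract
    { i := biprod.lift (biprod.fst : P ⊞ Q ⟶ P).hom (biprod.snd : P ⊞ Q ⟶ Q).hom
      r := biprod.desc (biprod.inl : P ⟶ P ⊞ Q).hom (biprod.inr : Q ⟶ P ⊞ Q).hom
      retract := by
        rw [biprod.lift_desc]
        exact congrArg InducedCategory.Hom.hom (biprod.total (X := P) (Y := Q)) }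
    (projectives_biprod hP hQ)
  rel_iff f g := by
    constructor
    · rintro ⟨P, t, s, hP, hts⟩
      exact ⟨⟨P, h.projectives_le _ hP⟩, ObjectProperty.homMk t, ObjectProperty.homMk s, hP,
        by ext; exact hts⟩
    · rintro ⟨P, t, s, hP, hts⟩
      exact ⟨P.obj, t.hom, s.hom, hP, congrArg InducedCategory.Hom.hom hts⟩
  inj {P X Y Z f g} hP hfg u := by
    -- Projectives are injective relative to conflations in `C` because they lie in `W = C⊥`.
    obtain ⟨t, ht⟩ := ExtVanishes.exists_extension ((restrict_conf_iff _).1 hfg)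
      (h.ext Z.property (h.projectives_le_right _ hP)) u.hom
    exact ⟨ObjectProperty.homMk t, by ext; exact ht⟩
  proj {P X Y Z f g} hP hfg u := by
    obtain ⟨t, ht⟩ := projectives.exists_lift hP ((restrict_conf_iff _).1 hfg).defl u.hom
    exact ⟨ObjectProperty.homMk t, by ext; exact ht⟩
  exists_hull X := by
    obtain ⟨P, Y, j, q, hP, hY, hjq⟩ := h.exists_embedding X.property
    exact ⟨⟨P, h.projectives_le _ hP⟩, ⟨Y, hY⟩, ObjectProperty.homMk j, ObjectProperty.homMk q, hP,
      (restrict_conf_iff _).2 hjq⟩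
  exists_cover X := by
    obtain ⟨K, P, k, e, hP, hke⟩ := hE.exists_conf X.obj
    exact ⟨⟨K, h.left_X₁ hke (h.projectives_le _ hP) X.property⟩, ⟨P, h.projectives_le _ hP⟩,
      ObjectProperty.homMk k, ObjectProperty.homMk e, hP, (restrict_conf_iff _).2 hke⟩

theorem exists_triangulatedStructure (hE : E.HasEnoughProjectives) :
    ∃ _ : TriangulatedStructure (E.StableCat C),
      IsInducedTriangulation (E.confOn C) (E.toStable C) := by
  have := h.isExtensionClosed.hasZeroObject
  have := h.isExtensionClosed.hasBinaryBiproducts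
  exact (h.frobeniusStructure hE).exists_triangulatedStructure

end IsProjectiveCotorsionPair

end ExactStructure

/-! ### Transport of triangulated structures -/

section

variable {T' : Type u'} [Category.{v'} T'] {T : Type u} [Category.{v} T]

lemma exists_hasShift_of_fullyFaithful (F : T' ⥤ T) [F.Full] [F.Faithful] [HasShift T ℤ]
    (hF : ∀ (n : ℤ) (X : T'), F.essImage ((F.obj X)⟦n⟧)) :
    ∃ _ : HasShift T' ℤ, Nonempty (F.CommShift ℤ) := by
  have hf := Functor.FullyFaithful.ofFullyFaithful F
  choose o ho using hF
  let e (n : ℤ) (X : T') : F.obj (o n X) ≅ (F.obj X)⟦n⟧ := (ho n X).some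
  let s (n : ℤ) : T' ⥤ T' :=
    { obj := o n
      map := fun {X Y} f => F.preimage ((e n X).hom ≫ (F.map f)⟦n⟧' ≫ (e n Y).inv)
      map_id := fun X => F.map_injective (by simp)
      map_comp := fun f g => F.map_injective (by simp) }
  let i (n : ℤ) : s n ⋙ F ≅ F ⋙ shiftFunctor T n :=
    NatIso.ofComponents (fun X => e n X) (fun f => by simp [s])
  exact ⟨hf.hasShift s i, ⟨Functor.CommShift.ofHasShiftOfFullyFaithful hf s i⟩⟩

variable [Preadditive T'] [HasZeroObject T'] [HasShift T' ℤ]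
  [∀ n : ℤ, (shiftFunctor T' n).Additive] [Preadditive T] [HasZeroObject T] [HasShift T ℤ]
  [∀ n : ℤ, (shiftFunctor T n).Additive] [Pretriangulated T]

/-- The pretriangulated structure on a full triangulated subcategory. -/
noncomputable abbrev pretriangulatedOfFullyFaithful (F : T' ⥤ T) [F.Full] [F.Faithful] [F.Additive]
    [F.CommShift ℤ] [F.essImage.IsTriangulated] : Pretriangulated T' where
  distinguishedTriangles := F.mapTriangle.obj ⁻¹' (distTriang T)
  isomorphic_distinguished T₁ hT₁ T₂ e :=
    isomorphic_distinguished _ hT₁ _ (F.mapTriangle.mapIso e)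
  contractible_distinguished X :=
    isomorphic_distinguished _ (contractible_distinguished (F.obj X)) _
      (triangleIsoMk (f := F.map (𝟙 X)) (g := F.map 0)
        (h := F.map 0 ≫ (F.commShiftIso (1 : ℤ)).hom.app X) (Iso.refl _) (Iso.refl _)
        F.mapZeroObject (by simp) ((isZero_zero T).eq_of_tgt _ _)
        ((F.map_isZero (isZero_zero T')).eq_of_src _ _))
  distinguished_cocone_triangle {X Y} f := by
    obtain ⟨Z', g', h', mem⟩ := distinguished_cocone_triangle (F.map f)
    obtain ⟨Z, ⟨e : F.obj Z ≅ Z'⟩⟩ := F.essImage.ext_of_isTriangulatedClosed₃ _ mem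
      (F.obj_mem_essImage X)
      (F.obj_mem_essImage Y)
    refine ⟨Z, F.preimage (g' ≫ e.inv),
      F.preimage (e.hom ≫ h' ≫ (F.commShiftIso (1 : ℤ)).inv.app X),
      isomorphic_distinguished _ mem _ (triangleIsoMk (f := F.map f)
        (g := F.map (F.preimage (g' ≫ e.inv)))
        (h := F.map (F.preimage (e.hom ≫ h' ≫ (F.commShiftIso (1 : ℤ)).inv.app X)) ≫
          (F.commShiftIso (1 : ℤ)).hom.app X) (Iso.refl _) (Iso.refl _) e ?_ ?_ ?_)⟩
    all_goals simp
  rotate_distinguished_triangle Δ :=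
    (rotate_distinguished_triangle (F.mapTriangle.obj Δ)).trans
      (distinguished_iff_of_iso (F.mapTriangleRotateIso.app Δ))
  complete_distinguished_triangle_morphism T₁ T₂ hT₁ hT₂ a b comm := by
    obtain ⟨c, ⟨hc₁, hc₂⟩⟩ := complete_distinguished_triangle_morphism (F.mapTriangle.obj T₁)
      (F.mapTriangle.obj T₂) hT₁ hT₂ (F.map a) (F.map b)
      ((F.map_comp _ _).symm.trans ((F.congr_map comm).trans (F.map_comp _ _)))
    obtain ⟨c, rfl⟩ := F.map_surjective (X := T₁.obj₃) (Y := T₂.obj₃) c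
    refine ⟨c, F.map_injective ?_, F.map_injective ?_⟩
    · exact (F.map_comp _ _).trans (Eq.trans hc₁ (F.map_comp _ _).symm)
    · have hc₂ : (F.map T₁.mor₃ ≫ (F.commShiftIso (1 : ℤ)).hom.app T₁.obj₁) ≫ (F.map a)⟦(1 : ℤ)⟧' =
          F.map c ≫ F.map T₂.mor₃ ≫ (F.commShiftIso (1 : ℤ)).hom.app T₂.obj₁ := hc₂
      have := F.commShiftIso_hom_naturality a (1 : ℤ)
      rw [← cancel_mono ((Functor.commShiftIso F (1 : ℤ)).hom.app T₂.obj₁), F.map_comp, F.map_comp,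
        Category.assoc, Category.assoc, ← hc₂, this, Category.assoc]

end

section

attribute [local instance] TriangulatedStructure.preadditive TriangulatedStructure.hasZeroObject
  TriangulatedStructure.hasShift TriangulatedStructure.shift_additive
  TriangulatedStructure.pretriangulated TriangulatedStructure.isTriangulated

variable {T' : Type u'} [Category.{v'} T'] {T : Type u} [Category.{v} T] [TriangulatedStructure T]

/-- All structure is pulled back along `F`; shifts and cones stay in the essential image, and the
octahedral axiom is reflected by the embedding. -/
theorem exists_triangulatedStructure_of_fullyFaithful (F : T' ⥤ T) [F.Full] [F.Faithful]
    [F.essImage.IsTriangulated] :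
    ∃ (_ : TriangulatedStructure T') (_ : F.CommShift ℤ), F.Additive ∧
      ∀ Δ : Triangle T', Δ ∈ distTriang T' ↔ F.mapTriangle.obj Δ ∈ distTriang T := by
  let := Preadditive.ofFullyFaithful (Functor.FullyFaithful.ofFullyFaithful F)
  have : F.Additive := (Functor.FullyFaithful.ofFullyFaithful F).additive_ofFullyFaithful
  obtain ⟨_, ⟨_⟩⟩ := exists_hasShift_of_fullyFaithful F fun n X =>
    F.essImage.le_shift n _ (F.obj_mem_essImage X)
  have : HasZeroObject T' := by
    obtain ⟨Z, hZ, X, ⟨e⟩⟩ := F.essImage.exists_prop_of_containsZero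
    refine ⟨X, ?_⟩
    rw [IsZero.iff_id_eq_zero]
    exact F.map_injective ((hZ.of_iso e).eq_of_src _ _)
  have (n : ℤ) : (shiftFunctor T' n).Additive := by
    have : (shiftFunctor T' n ⋙ F).Additive :=
      Functor.additive_of_iso (F.commShiftIso n).symm
    exact ⟨fun {X Y f g} => F.map_injective (by
      rw [F.map_add]
      exact (shiftFunctor T' n ⋙ F).map_add)⟩
  let := pretriangulatedOfFullyFaithful F
  have : F.IsTriangulated := ⟨fun _ h => h⟩
  exact ⟨{
    preadditive := inferInstance
    hasZeroObject := inferInstance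
    hasShift := inferInstance
    shift_additive := inferInstance
    pretriangulated := inferInstance
    isTriangulated := IsTriangulated.of_fully_faithful_triangulated_functor F },
    inferInstance, inferInstance, fun Δ => Iff.rfl⟩

end

namespace ExactStructure

variable {A : Type u} [Category.{v} A] [Preadditive A] [HasZeroObject A] [HasBinaryBiproducts A]
variable {E : ExactStructure A}

/-! ### Stable categories -/

instance stableRel_congruence (D : ObjectProperty A) : Congruence (E.stableRel D) where
  equivalence {X Y} :=
    { refl := fun f => ⟨0, 0, 0, projectives_of_isZero (isZero_zero A), by simp⟩
      symm := by
        rintro f g ⟨P, t, s, hP, h⟩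
        exact ⟨P, -t, s, hP, by rw [Preadditive.neg_comp, ← h, neg_sub]⟩
      trans := by
        rintro f g k ⟨P, t, s, hP, h⟩ ⟨P', t', s', hP', h'⟩
        exact ⟨P ⊞ P', biprod.lift t t', biprod.desc s s', projectives_biprod hP hP', by
          rw [biprod.lift_desc, ← h, ← h']; abel⟩ }
  comp_left := by
    rintro X Y Z f g g' ⟨P, t, s, hP, h⟩
    exact ⟨P, f.hom ≫ t, s, hP, by
      rw [Category.assoc, ← h, Preadditive.comp_sub]; rfl⟩
  comp_right := by
    rintro X Y Z f f' g ⟨P, t, s, hP, h⟩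
    exact ⟨P, t, s ≫ g.hom, hP, by
      rw [← Category.assoc, ← h, Preadditive.sub_comp]; rfl⟩

lemma toStable_map_eq_iff {D : ObjectProperty A} {X Y : D.FullSubcategory} (f g : X ⟶ Y) :
    (E.toStable D).map f = (E.toStable D).map g ↔
      ∃ (P : A) (t : X.obj ⟶ P) (s : P ⟶ Y.obj), E.projectives P ∧ f.hom - g.hom = t ≫ s := by
  rw [eq_comm]
  exact Quotient.functor_map_eq_iff _ _ _

section

variable {C D : ObjectProperty A} (h : C ≤ D)

instance full_stableIncl : (E.stableIncl h).Full where
  map_surjective {X Y} f := by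
    obtain ⟨f, rfl⟩ := (E.toStable D).map_surjective
      (X := (ObjectProperty.ιOfLE h).obj X.as) (Y := (ObjectProperty.ιOfLE h).obj Y.as) f
    exact ⟨(E.toStable C).map (ObjectProperty.homMk f.hom), rfl⟩

instance faithful_stableIncl : (E.stableIncl h).Faithful where
  map_injective {X Y} f g hfg := by
    obtain ⟨f, rfl⟩ := (E.toStable C).map_surjective (X := X.as) (Y := Y.as) f
    obtain ⟨g, rfl⟩ := (E.toStable C).map_surjective (X := X.as) (Y := Y.as) g
    obtain ⟨P, t, s, hP, hts⟩ := (toStable_map_eq_iff ((ObjectProperty.ιOfLE h).map f)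
      ((ObjectProperty.ιOfLE h).map g)).1 hfg
    exact (toStable_map_eq_iff f g).2 ⟨P, t, s, hP, hts⟩

end

namespace IsProjectiveCotorsionPair

variable {C W : ObjectProperty A} (h : E.IsProjectiveCotorsionPair C W)
  (hE : E.HasEnoughProjectives)

/-! ### The coreflection given by special precovers -/

/-- The object of a chosen special precover. -/
noncomputable def cov (X : A) : C.FullSubcategory :=
  ⟨(h.precover X).choose, (h.precover X).choose_spec.choose_spec.1⟩

/-- A chosen special precover. -/
noncomputable def covMap (X : A) : (h.cov X).obj ⟶ X := (h.precover X).choose_spec.choose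

lemma covMap_admEpi (X : A) : E.admEpi W (h.covMap X) :=
  (h.precover X).choose_spec.choose_spec.2

include h in
lemma exists_lift_precover {X Y Z : A} {p : Y ⟶ X} (hp : E.admEpi W p) (hZ : C Z) (f : Z ⟶ X) :
    ∃ g : Z ⟶ Y, g ≫ p = f := by
  obtain ⟨K, i, hc, hK⟩ := admEpi_iff.1 hp
  exact ExtVanishes.exists_lift hc (h.ext hZ hK) f

include h hE in
-- The projective factor of the difference lifts along `p`. What remains lands in the kernel, which
-- is in `W`, so it factors through a projective as well. Hence special precovers are functorial in
-- the stable category.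
lemma lift_precover_unique {X Y Z : A} {p : Y ⟶ X} (hp : E.admEpi W p) (hZ : C Z) (f g : Z ⟶ Y)
    (hfg : ∃ (P : A) (t : Z ⟶ P) (s : P ⟶ X), E.projectives P ∧ f ≫ p - g ≫ p = t ≫ s) :
    ∃ (P : A) (t : Z ⟶ P) (s : P ⟶ Y), E.projectives P ∧ f - g = t ≫ s := by
  obtain ⟨K, i, hc, hK⟩ := admEpi_iff.1 hp
  obtain ⟨P, t, s, hP, hts⟩ := hfg
  obtain ⟨s', rfl⟩ := projectives.exists_lift hP hc.defl s
  obtain ⟨k, hk⟩ := hc.exists_lift (f - g - t ≫ s') (by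
    rw [Preadditive.sub_comp, Preadditive.sub_comp, hts]; simp)
  obtain ⟨P', t', s'', hP', rfl⟩ := h.exists_factor hE hZ hK k
  refine ⟨P ⊞ P', biprod.lift t t', biprod.desc s' (s'' ≫ i), projectives_biprod hP hP', ?_⟩
  rw [biprod.lift_desc, ← Category.assoc t', hk]
  abel

section

variable {D : ObjectProperty A} (hD : C ≤ D)

include h hE in
lemma precover_bijective {Z : C.FullSubcategory} {Y : C.FullSubcategory} {X : D.FullSubcategory}
    (p : Y.obj ⟶ X.obj) (hp : E.admEpi W p) : Function.Bijective
      (fun f : (E.toStable C).obj Z ⟶ (E.toStable C).obj Y => (E.stableIncl hD).map f ≫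
        (E.toStable D).map (ObjectProperty.homMk p : (ObjectProperty.ιOfLE hD).obj Y ⟶ X)) := by
  constructor
  · intro f g hfg
    obtain ⟨f, rfl⟩ := (E.toStable C).map_surjective f
    obtain ⟨g, rfl⟩ := (E.toStable C).map_surjective g
    refine (toStable_map_eq_iff f g).2 ?_
    exact h.lift_precover_unique hE hp Z.property _ _ ((toStable_map_eq_iff
      ((ObjectProperty.ιOfLE hD).map f ≫ ObjectProperty.homMk p)
      ((ObjectProperty.ιOfLE hD).map g ≫ ObjectProperty.homMk p)).1 hfg)
  · intro f
    obtain ⟨f, rfl⟩ := (E.toStable D).map_surjective (X := (ObjectProperty.ιOfLE hD).obj Z) f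
    obtain ⟨g, hg⟩ := h.exists_lift_precover hp Z.property f.hom
    refine ⟨(E.toStable C).map (ObjectProperty.homMk g), ?_⟩
    exact congrArg (E.toStable D).map (ObjectProperty.hom_ext _ hg)

/-- The class of a chosen special precover. -/
noncomputable def covHom (X : D.FullSubcategory) :
    (E.stableIncl hD).obj ((E.toStable C).obj (h.cov X.obj)) ⟶ (E.toStable D).obj X :=
  (E.toStable D).map (ObjectProperty.homMk (h.covMap X.obj) :
    (ObjectProperty.ιOfLE hD).obj (h.cov X.obj) ⟶ X)

/-- The universal property of a special precover in the stable category. -/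
noncomputable def precoverEquiv (Z : E.StableCat C) (X : E.StableCat D) :
    ((E.stableIncl hD).obj Z ⟶ X) ≃ (Z ⟶ (E.toStable C).obj (h.cov X.as.obj)) :=
  (Equiv.ofBijective _ (h.precover_bijective hE hD (Z := Z.as) (h.covMap X.as.obj)
    (h.covMap_admEpi X.as.obj))).symm

lemma precoverEquiv_symm_apply (Z : E.StableCat C) (X : E.StableCat D)
    (f : Z ⟶ (E.toStable C).obj (h.cov X.as.obj)) :
    (h.precoverEquiv hE hD Z X).symm f = (E.stableIncl hD).map f ≫ h.covHom hD X.as := rfl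

lemma precoverEquiv_naturality (Z Z' : E.StableCat C) (X : E.StableCat D) (f : Z ⟶ Z')
    (g : (E.stableIncl hD).obj Z' ⟶ X) :
    h.precoverEquiv hE hD Z X ((E.stableIncl hD).map f ≫ g) =
      f ≫ h.precoverEquiv hE hD Z' X g := by
  obtain ⟨g, rfl⟩ := (h.precoverEquiv hE hD Z' X).symm.surjective g
  rw [Equiv.apply_symm_apply, ← Equiv.eq_symm_apply, precoverEquiv_symm_apply,
    precoverEquiv_symm_apply, Functor.map_comp, Category.assoc]

/-- The right adjoint of the inclusion, given by special precovers. -/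
noncomputable def precoverFunctor : E.StableCat D ⥤ E.StableCat C :=
  Adjunction.rightAdjointOfEquiv (h.precoverEquiv hE hD) (h.precoverEquiv_naturality hE hD)

/-- Special precovers are coreflections. -/
noncomputable def precoverAdjunction : E.stableIncl hD ⊣ h.precoverFunctor hE hD :=
  Adjunction.adjunctionOfEquivRight (h.precoverEquiv hE hD) (h.precoverEquiv_naturality hE hD)

lemma precoverFunctor_map {X Y : D.FullSubcategory} (f : X ⟶ Y) (g : h.cov X.obj ⟶ h.cov Y.obj)
    (hg : g.hom ≫ h.covMap Y.obj = h.covMap X.obj ≫ f.hom) :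
    (h.precoverFunctor hE hD).map ((E.toStable D).map f) = (E.toStable C).map g := by
  refine (h.precoverEquiv hE hD _ _).symm.injective ?_
  refine ((h.precoverEquiv hE hD _ _).symm_apply_apply _).trans ?_
  have h₁ : (h.precoverEquiv hE hD ((E.toStable C).obj (h.cov X.obj))
      ((E.toStable D).obj X)).symm (𝟙 _) = h.covHom hD X := by
    rw [precoverEquiv_symm_apply, CategoryTheory.Functor.map_id, Category.id_comp]
    rfl
  refine (congrArg (fun k => k ≫ (E.toStable D).map f) h₁).trans ?_
  exact congrArg (E.toStable D).map (ObjectProperty.hom_ext _ hg.symm)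

lemma precoverFunctor_map_spec {X Y : E.StableCat D} (f : X ⟶ Y) :
    (E.stableIncl hD).map ((h.precoverFunctor hE hD).map f) ≫ h.covHom hD Y.as =
      h.covHom hD X.as ≫ f := by
  obtain ⟨f, rfl⟩ := (E.toStable D).map_surjective (X := X.as) (Y := Y.as) f
  obtain ⟨g, hg⟩ := h.exists_lift_precover (h.covMap_admEpi Y.as.obj) (h.cov X.as.obj).property
    (h.covMap X.as.obj ≫ f.hom)
  have := h.precoverFunctor_map hE hD f (ObjectProperty.homMk g) hg
  refine (congrArg (fun k => (E.stableIncl hD).map k ≫ h.covHom hD Y.as) this).trans ?_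
  exact congrArg (E.toStable D).map (ObjectProperty.hom_ext _ hg)

end

/-! ### The reflection given by special preenvelopes -/

section

variable {C₁ W₁ : ObjectProperty A} (h₁ : E.IsProjectiveCotorsionPair C₁ W₁) (hC : C ≤ C₁)

/-- The object of a chosen special preenvelope of an object of `C₁`. -/
noncomputable def env (X : C₁.FullSubcategory) : (W ⊓ C₁).FullSubcategory :=
  ⟨(h.preenvelope X.obj).choose, (h.preenvelope X.obj).choose_spec.choose_spec.1, by
    -- The preenvelope is an extension of an object of `C ≤ C₁` by `X`, so it stays in `C₁`.
    obtain ⟨Z, p, hc, hZ⟩ := admMono_iff.1 (h.preenvelope X.obj).choose_spec.choose_spec.2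
    exact h₁.left_ext hc X.property (hC _ hZ)⟩

/-- A chosen special preenvelope. -/
noncomputable def envMap (X : C₁.FullSubcategory) : X.obj ⟶ (h.env h₁ hC X).obj :=
  (h.preenvelope X.obj).choose_spec.choose

lemma envMap_admMono (X : C₁.FullSubcategory) : E.admMono C (h.envMap h₁ hC X) :=
  (h.preenvelope X.obj).choose_spec.choose_spec.2

include h in
lemma exists_extension_preenvelope {X Y Z : A} {j : X ⟶ Y} (hj : E.admMono C j) (hZ : W Z)
    (f : X ⟶ Z) : ∃ g : Y ⟶ Z, j ≫ g = f := by
  obtain ⟨K, i, hc, hK⟩ := admMono_iff.1 hj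
  exact ExtVanishes.exists_extension hc (h.ext hK hZ) f

include h hE in
-- Dual to `lift_precover_unique`. The projective factor extends along `j` because projectives lie
-- in `W`; the rest descends to the cokernel in `C`, whose morphisms to `W` factor through
-- projectives.
lemma extension_preenvelope_unique {X Y Z : A} {j : X ⟶ Y} (hj : E.admMono C j) (hZ : W Z)
    (f g : Y ⟶ Z)
    (hfg : ∃ (P : A) (t : X ⟶ P) (s : P ⟶ Z), E.projectives P ∧ j ≫ f - j ≫ g = t ≫ s) :
    ∃ (P : A) (t : Y ⟶ P) (s : P ⟶ Z), E.projectives P ∧ f - g = t ≫ s := by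
  obtain ⟨P, t, s, hP, hts⟩ := hfg
  obtain ⟨t', rfl⟩ := h.exists_extension_preenvelope hj (h.projectives_le_right _ hP) t
  obtain ⟨K, i, hc, hK⟩ := admMono_iff.1 hj
  obtain ⟨k, hk⟩ := hc.exists_desc (f - g - t' ≫ s) (by
    rw [Preadditive.comp_sub, Preadditive.comp_sub, hts]; simp)
  obtain ⟨P', t'', s', hP', rfl⟩ := h.exists_factor hE hK hZ k
  refine ⟨P ⊞ P', biprod.lift t' (i ≫ t''), biprod.desc s s', projectives_biprod hP hP', ?_⟩
  rw [biprod.lift_desc, Category.assoc, hk]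
  abel

include h hE in
lemma preenvelope_bijective {X : C₁.FullSubcategory} {Y Z : (W ⊓ C₁).FullSubcategory}
    (j : X.obj ⟶ Y.obj) (hj : E.admMono C j) : Function.Bijective
      (fun f : (E.toStable (W ⊓ C₁)).obj Y ⟶ (E.toStable (W ⊓ C₁)).obj Z =>
        (E.toStable C₁).map (ObjectProperty.homMk j :
          X ⟶ (ObjectProperty.ιOfLE (inf_le_right : W ⊓ C₁ ≤ C₁)).obj Y) ≫
        (E.stableIncl inf_le_right).map f) := by
  constructor
  · intro f g hfg
    obtain ⟨f, rfl⟩ := (E.toStable (W ⊓ C₁)).map_surjective f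
    obtain ⟨g, rfl⟩ := (E.toStable (W ⊓ C₁)).map_surjective g
    refine (toStable_map_eq_iff f g).2 ?_
    exact h.extension_preenvelope_unique hE hj Z.property.1 _ _ ((toStable_map_eq_iff
      ((ObjectProperty.homMk j : X ⟶ (ObjectProperty.ιOfLE (inf_le_right : W ⊓ C₁ ≤ C₁)).obj Y) ≫
        (ObjectProperty.ιOfLE (inf_le_right : W ⊓ C₁ ≤ C₁)).map f)
      ((ObjectProperty.homMk j : X ⟶ (ObjectProperty.ιOfLE (inf_le_right : W ⊓ C₁ ≤ C₁)).obj Y) ≫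
        (ObjectProperty.ιOfLE (inf_le_right : W ⊓ C₁ ≤ C₁)).map g)).1 hfg)
  · intro f
    obtain ⟨f, rfl⟩ := (E.toStable C₁).map_surjective
      (Y := (ObjectProperty.ιOfLE (inf_le_right : W ⊓ C₁ ≤ C₁)).obj Z) f
    obtain ⟨g, hg⟩ := h.exists_extension_preenvelope hj Z.property.1 f.hom
    refine ⟨(E.toStable (W ⊓ C₁)).map (ObjectProperty.homMk g), ?_⟩
    exact congrArg (E.toStable C₁).map (ObjectProperty.hom_ext _ hg)

/-- The class of a chosen special preenvelope. -/
noncomputable def envHom (X : C₁.FullSubcategory) : (E.toStable C₁).obj X ⟶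
    (E.stableIncl inf_le_right).obj ((E.toStable (W ⊓ C₁)).obj (h.env h₁ hC X)) :=
  (E.toStable C₁).map (ObjectProperty.homMk (h.envMap h₁ hC X) :
    X ⟶ (ObjectProperty.ιOfLE (inf_le_right : W ⊓ C₁ ≤ C₁)).obj (h.env h₁ hC X))

/-- The universal property of a special preenvelope in the stable category. -/
noncomputable def preenvelopeEquiv (X : E.StableCat C₁) (Z : E.StableCat (W ⊓ C₁)) :
    ((E.toStable (W ⊓ C₁)).obj (h.env h₁ hC X.as) ⟶ Z) ≃
      (X ⟶ (E.stableIncl inf_le_right).obj Z) :=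
  Equiv.ofBijective _ (h.preenvelope_bijective hE (Z := Z.as) (h.envMap h₁ hC X.as)
    (h.envMap_admMono h₁ hC X.as))

lemma preenvelopeEquiv_apply (X : E.StableCat C₁) (Z : E.StableCat (W ⊓ C₁))
    (f : (E.toStable (W ⊓ C₁)).obj (h.env h₁ hC X.as) ⟶ Z) :
    h.preenvelopeEquiv hE h₁ hC X Z f =
      h.envHom h₁ hC X.as ≫ (E.stableIncl inf_le_right).map f := rfl

lemma preenvelopeEquiv_naturality (X : E.StableCat C₁) (Z Z' : E.StableCat (W ⊓ C₁)) (g : Z ⟶ Z')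
    (f : (E.toStable (W ⊓ C₁)).obj (h.env h₁ hC X.as) ⟶ Z) :
    h.preenvelopeEquiv hE h₁ hC X Z' (f ≫ g) =
      h.preenvelopeEquiv hE h₁ hC X Z f ≫ (E.stableIncl inf_le_right).map g := by
  rw [preenvelopeEquiv_apply, preenvelopeEquiv_apply, Functor.map_comp, Category.assoc]

/-- The left adjoint of the inclusion, given by special preenvelopes. -/
noncomputable def preenvelopeFunctor : E.StableCat C₁ ⥤ E.StableCat (W ⊓ C₁) :=
  Adjunction.leftAdjointOfEquiv (h.preenvelopeEquiv hE h₁ hC)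
    (h.preenvelopeEquiv_naturality hE h₁ hC)

/-- Special preenvelopes are reflections. -/
noncomputable def preenvelopeAdjunction :
    h.preenvelopeFunctor hE h₁ hC ⊣ E.stableIncl (inf_le_right : W ⊓ C₁ ≤ C₁) :=
  Adjunction.adjunctionOfEquivLeft (h.preenvelopeEquiv hE h₁ hC)
    (h.preenvelopeEquiv_naturality hE h₁ hC)

lemma preenvelopeAdjunction_unit_app (X : E.StableCat C₁) :
    (h.preenvelopeAdjunction hE h₁ hC).unit.app X = h.envHom h₁ hC X.as := by
  have : (h.preenvelopeAdjunction hE h₁ hC).unit.app X =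
      h.preenvelopeEquiv hE h₁ hC X _ (𝟙 _) := rfl
  rw [this, preenvelopeEquiv_apply, CategoryTheory.Functor.map_id, Category.comp_id]

lemma preenvelopeFunctor_map {X Y : C₁.FullSubcategory} (f : X ⟶ Y)
    (g : h.env h₁ hC X ⟶ h.env h₁ hC Y)
    (hg : h.envMap h₁ hC X ≫ g.hom = f.hom ≫ h.envMap h₁ hC Y) :
    (h.preenvelopeFunctor hE h₁ hC).map ((E.toStable C₁).map f) =
      (E.toStable (W ⊓ C₁)).map g := by
  refine (h.preenvelopeEquiv hE h₁ hC _ _).injective ?_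
  refine ((h.preenvelopeEquiv hE h₁ hC _ _).apply_symm_apply _).trans ?_
  have h' : h.preenvelopeEquiv hE h₁ hC ((E.toStable C₁).obj Y)
      ((E.toStable (W ⊓ C₁)).obj (h.env h₁ hC Y)) (𝟙 _) = h.envHom h₁ hC Y := by
    rw [preenvelopeEquiv_apply, CategoryTheory.Functor.map_id, Category.comp_id]
    rfl
  refine (congrArg (fun k => (E.toStable C₁).map f ≫ k) h').trans ?_
  exact congrArg (E.toStable C₁).map (ObjectProperty.hom_ext _ hg.symm)

end

end IsProjectiveCotorsionPair

end ExactStructure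

/-! ### Special precovers and the localization `A / W` -/

namespace ExactStructure

variable {A : Type u} [Category.{v} A] [Preadditive A] [HasZeroObject A] [HasBinaryBiproducts A]
variable {E : ExactStructure A}

lemma IsThick.admEpi_comp {W : ObjectProperty A} (hW : E.IsThick W) {X Y Z : A} {f : X ⟶ Y}
    {g : Y ⟶ Z} (hf : E.admEpi W f) (hg : E.admEpi W g) : E.admEpi W (f ≫ g) := by
  obtain ⟨K, k, hk, hK⟩ := admEpi_iff.1 hf
  obtain ⟨L, l, hl, hL⟩ := admEpi_iff.1 hg
  obtain ⟨N, n, hn⟩ := hk.defl.comp hl.defl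
  obtain ⟨c, d, hcd, -, -⟩ := hk.noether' hl hn
  exact admEpi_iff.2 ⟨N, n, hn, hW.X₂ hcd hK hL⟩

variable (E) in
/-- The functor from the exact category to the stable category of all its objects. -/
def toStableTop : A ⥤ E.StableCat ⊤ :=
  ObjectProperty.lift ⊤ (𝟭 A) (fun _ => trivial) ⋙ E.toStable ⊤

namespace IsProjectiveCotorsionPair

variable {C W : ObjectProperty A} (h : E.IsProjectiveCotorsionPair C W)
  (hE : E.HasEnoughProjectives)

/-- The functor that takes special precovers. -/
noncomputable def covFunctor : A ⥤ E.StableCat C :=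
  E.toStableTop ⋙ h.precoverFunctor hE le_top

lemma covFunctor_map {X Y : A} (f : X ⟶ Y) (g : h.cov X ⟶ h.cov Y)
    (hg : g.hom ≫ h.covMap Y = h.covMap X ≫ f) :
    (h.covFunctor hE).map f = (E.toStable C).map g :=
  h.precoverFunctor_map hE le_top (X := ⟨X, trivial⟩) (Y := ⟨Y, trivial⟩)
    (ObjectProperty.homMk f) g hg

include h hE in
lemma toStable_map_eq_of_comp_eq {X : A} {Y Z : C.FullSubcategory} {p : Y.obj ⟶ X}
    (hp : E.admEpi W p) (f g : Z ⟶ Y) (hfg : f.hom ≫ p = g.hom ≫ p) :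
    (E.toStable C).map f = (E.toStable C).map g :=
  (toStable_map_eq_iff f g).2 (h.lift_precover_unique hE hp Z.property _ _
    ⟨0, 0, 0, projectives_of_isZero (isZero_zero A), by simp [hfg]⟩)

/-- By thickness, a special precover of `X` followed by `p` is a special precover of `Y`; two
special precovers of `Y` are stably isomorphic over it. -/
lemma isIso_covFunctor_map_of_admEpi {X Y : A} (p : X ⟶ Y) (hp : E.admEpi W p) :
    IsIso ((h.covFunctor hE).map p) := by
  have hq := h.thick.admEpi_comp (h.covMap_admEpi X) hp
  obtain ⟨g, hg⟩ := h.exists_lift_precover (h.covMap_admEpi Y) (h.cov X).property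
    (h.covMap X ≫ p)
  obtain ⟨k, hk⟩ := h.exists_lift_precover hq (h.cov Y).property (h.covMap Y)
  rw [h.covFunctor_map hE p (ObjectProperty.homMk g) hg]
  refine ⟨(E.toStable C).map (ObjectProperty.homMk k), ?_, ?_⟩
  · refine Eq.trans (h.toStable_map_eq_of_comp_eq hE hq
      (ObjectProperty.homMk g ≫ ObjectProperty.homMk k) (𝟙 _) ?_) ((E.toStable C).map_id _)
    exact (Category.assoc _ _ _).trans ((congrArg (g ≫ ·) hk).trans
      (hg.trans (Category.id_comp _).symm))
  · refine Eq.trans (h.toStable_map_eq_of_comp_eq hE (h.covMap_admEpi Y)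
      (ObjectProperty.homMk k ≫ ObjectProperty.homMk g) (𝟙 _) ?_) ((E.toStable C).map_id _)
    exact (Category.assoc _ _ _).trans ((congrArg (k ≫ ·) hg).trans
      (hk.trans (Category.id_comp _).symm))

/-- In a weak equivalence the monomorphic factor has projective cokernel and splits. Its retraction
is an admissible epimorphism with kernel in `W`, so both factors reduce to
`isIso_covFunctor_map_of_admEpi`. -/
lemma covFunctor_isInvertedBy :
    (E.model (projTriple C W)).weq.IsInvertedBy (h.covFunctor hE) := by
  rintro X Y f ⟨Z, i, p, hi, hp, rfl⟩
  obtain ⟨K, k, hk, -, hK⟩ := admEpi_iff.1 hp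
  have := h.isIso_covFunctor_map_of_admEpi hE p (admEpi_iff.2 ⟨K, k, hk, hK⟩)
  obtain ⟨P, q, hq, hP⟩ := admMono_iff.1 hi
  have hP : E.projectives P := by
    rw [← h.inf_eq]; exact hP
  obtain ⟨s, hs⟩ := projectives.exists_lift hP hq.defl (𝟙 P)
  obtain ⟨r, hr, hsr, hrs⟩ := hq.exists_retraction hs
  have := h.isIso_covFunctor_map_of_admEpi hE r (admEpi_iff.2 ⟨P, s,
    Conf.of_splitting hsr q i hs hr (by rw [add_comm, hrs]), h.projectives_le_right _ hP⟩)
  have : (h.covFunctor hE).map i = inv ((h.covFunctor hE).map r) := by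
    rw [← cancel_mono ((h.covFunctor hE).map r), ← Functor.map_comp, hr]
    simp
  rw [Functor.map_comp, this]
  infer_instance

/-- The functor `A / W ⥤ C/∼` that takes special precovers. -/
noncomputable def hoCov : E.HoCat C W ⥤ E.StableCat C :=
  Localization.Construction.lift (h.covFunctor hE) (h.covFunctor_isInvertedBy hE)

lemma toHo_comp_hoCov : E.toHo C W ⋙ h.hoCov hE = h.covFunctor hE :=
  Localization.Construction.fac _ _

lemma hoCov_map {X Y : A} (f : X ⟶ Y) :
    (h.hoCov hE).map ((E.toHo C W).map f) = (h.covFunctor hE).map f := by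
  have := Functor.congr_hom (h.toHo_comp_hoCov hE) f
  exact this.trans ((Category.id_comp _).trans (Category.comp_id _))

include h hE in
lemma isIso_toHo_map_of_admEpi {X Y : A} (p : X ⟶ Y) (hp : E.admEpi W p) :
    IsIso ((E.toHo C W).map p) := by
  refine (E.model (projTriple C W)).weq.Q_inverts _ ?_
  obtain ⟨K, k, hk, hK⟩ := admEpi_iff.1 hp
  rw [h.weq_eq hE]
  exact (h.thick.relEquiv_defl_iff h.projectives_le_right hk).2 hK

include h hE in
lemma isIso_toHo_map_of_admMono {X Y : A} (j : X ⟶ Y) (hj : E.admMono W j) :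
    IsIso ((E.toHo C W).map j) := by
  refine (E.model (projTriple C W)).weq.Q_inverts _ ?_
  obtain ⟨K, k, hk, hK⟩ := admMono_iff.1 hj
  rw [h.weq_eq hE]
  exact (h.thick.relEquiv_infl_iff hE h.projectives_le_right hk).2 hK

/-- Special precovers are isomorphisms in `A / W`. -/
noncomputable def covIso (X : A) :
    (E.toHo C W).obj (h.cov X).obj ≅ (E.toHo C W).obj X :=
  @asIso _ _ _ _ ((E.toHo C W).map (h.covMap X))
    (h.isIso_toHo_map_of_admEpi hE (h.covMap X) (h.covMap_admEpi X))

@[simp]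
lemma covIso_hom (X : A) : (h.covIso hE X).hom = (E.toHo C W).map (h.covMap X) := rfl

section

variable {D : ObjectProperty A} (hD : C ≤ D)

/-- Special precovers as a functor to a larger stable category. -/
noncomputable abbrev hoCovIncl : E.HoCat C W ⥤ E.StableCat D := h.hoCov hE ⋙ E.stableIncl hD

/-- The counit of the adjunction between special precovers and the quotient functor. -/
noncomputable def hoCovCounit : E.quotientFunctor h D ⋙ h.hoCovIncl hE hD ⟶ 𝟭 _ where
  app X := h.covHom hD X.as
  naturality {X Y} f := by
    obtain ⟨f, rfl⟩ := (E.toStable D).map_surjective (X := X.as) (Y := Y.as) f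
    refine Eq.trans ?_ (h.precoverFunctor_map_spec hE hD ((E.toStable D).map f))
    have h₁ := h.hoCov_map hE f.hom
    obtain ⟨g, hg⟩ := h.exists_lift_precover (h.covMap_admEpi Y.as.obj) (h.cov X.as.obj).property
      (h.covMap X.as.obj ≫ f.hom)
    have h₂ := h.covFunctor_map hE f.hom (ObjectProperty.homMk g) hg
    have h₃ := h.precoverFunctor_map hE hD f (ObjectProperty.homMk g) hg
    exact congrArg (fun k => (E.stableIncl hD).map k ≫ h.covHom hD Y.as)
      (h₁.trans (h₂.trans h₃.symm))

/-- The unit of the adjunction between special precovers and the quotient functor. -/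
noncomputable def hoCovUnit : 𝟭 _ ⟶ h.hoCovIncl hE hD ⋙ E.quotientFunctor h D :=
  Localization.Construction.natTransExtension
    { app := fun X => (h.covIso hE X).inv
      naturality := fun X Y f => by
        obtain ⟨g, hg⟩ := h.exists_lift_precover (h.covMap_admEpi Y) (h.cov X).property
          (h.covMap X ≫ f)
        have h₁ : (E.quotientFunctor h D).map ((h.hoCovIncl hE hD).map ((E.toHo C W).map f)) =
            (E.toHo C W).map g :=
          congrArg (fun k => (E.quotientFunctor h D).map ((E.stableIncl hD).map k))
            ((h.hoCov_map hE f).trans (h.covFunctor_map hE f (ObjectProperty.homMk g) hg))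
        have h₂ : (E.toHo C W).map f ≫ (h.covIso hE Y).inv =
            (h.covIso hE X).inv ≫ (E.toHo C W).map g := by
          rw [Iso.eq_inv_comp, ← Category.assoc, Iso.comp_inv_eq, covIso_hom, covIso_hom,
            ← Functor.map_comp, ← Functor.map_comp, hg]
        exact h₂.trans (congrArg (fun k => (h.covIso hE X).inv ≫ k) h₁.symm) }

lemma hoCovUnit_app (X : A) :
    (h.hoCovUnit hE hD).app ((E.toHo C W).obj X) = (h.covIso hE X).inv :=
  Localization.Construction.NatTransExtension.app_eq _ _

/-- Special precovers are left adjoint to the quotient functor. -/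
noncomputable def hoCovAdjunction : h.hoCovIncl hE hD ⊣ E.quotientFunctor h D where
  unit := h.hoCovUnit hE hD
  counit := h.hoCovCounit hE hD
  left_triangle_components X := by
    obtain ⟨X, rfl⟩ := (Localization.Construction.objEquiv _).surjective X
    have h₁ := (h.hoCov_map hE (h.covMap X)).trans
      (h.covFunctor_map hE (h.covMap X) (ObjectProperty.homMk (h.covMap (h.cov X).obj)) rfl)
    have h₂ : (h.hoCovIncl hE hD).map ((E.toHo C W).map (h.covMap X)) =
        (h.hoCovCounit hE hD).app ((h.hoCovIncl hE hD).obj ((E.toHo C W).obj X)) :=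
      congrArg (E.stableIncl hD).map h₁
    refine (congrArg₂ (fun a b => a ≫ b) (congrArg (h.hoCovIncl hE hD).map
      (h.hoCovUnit_app hE hD X)) h₂.symm).trans ?_
    exact ((h.hoCovIncl hE hD).mapIso (h.covIso hE X)).inv_hom_id
  right_triangle_components Y :=
    (congrArg (fun k => k ≫ (h.covIso hE Y.as.obj).hom) (h.hoCovUnit_app hE hD Y.as.obj)).trans
      (h.covIso hE Y.as.obj).inv_hom_id

/-- On objects of `A`, which are all objects of the localization, the unit is the inverse of the
image of a special precover. Invertibility of the unit makes the left adjoint fully faithful. -/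
lemma isIso_hoCovUnit : IsIso (h.hoCovAdjunction hE hD).unit := by
  have (X : E.HoCat C W) : IsIso ((h.hoCovAdjunction hE hD).unit.app X) := by
    obtain ⟨X, rfl⟩ := (Localization.Construction.objEquiv _).surjective X
    have h₁ : IsIso ((h.hoCovUnit hE hD).app ((E.toHo C W).obj X)) := by
      rw [h.hoCovUnit_app hE hD X]
      exact (h.covIso hE X).isIso_inv
    exact h₁
  exact NatIso.isIso_of_isIso_app _

lemma full_hoCovIncl : (h.hoCovIncl hE hD).Full :=
  have := h.isIso_hoCovUnit hE hD
  (h.hoCovAdjunction hE hD).fullyFaithfulLOfIsIsoUnit.full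

lemma faithful_hoCovIncl : (h.hoCovIncl hE hD).Faithful :=
  have := h.isIso_hoCovUnit hE hD
  (h.hoCovAdjunction hE hD).fullyFaithfulLOfIsIsoUnit.faithful

end

/-- Full faithfulness is the case `D = C` of the embedding. An object of `C` is stably its own
special precover, which is the unit of the coreflection of the inclusion in all objects. -/
lemma hoCov_isEquivalence : (h.hoCov hE).IsEquivalence where
  faithful := by
    have := h.faithful_hoCovIncl hE (le_refl C)
    exact Functor.Faithful.of_comp (h.hoCov hE) (E.stableIncl (le_refl C))
  full := by
    have := h.full_hoCovIncl hE (le_refl C)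
    exact Functor.Full.of_comp_faithful (h.hoCov hE) (E.stableIncl (le_refl C))
  essSurj := ⟨fun X => ⟨(E.toHo C W).obj X.as.obj,
    ⟨((asIso (h.precoverAdjunction hE le_top).unit).app X).symm⟩⟩⟩

variable (E) in
/-- The inclusion of a stable category in itself. -/
def stableInclRefl (C : ObjectProperty A) : E.stableIncl (le_refl C) ≅ 𝟭 _ :=
  NatIso.ofComponents (fun X => Iso.refl _) (fun {X Y} f => by
    obtain ⟨f, rfl⟩ := (E.toStable C).map_surjective (X := X.as) (Y := Y.as) f
    exact (Category.comp_id _).trans (Category.id_comp _).symm)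

/-- The quotient functor `C/∼ ⥤ A / W` is a quasi-inverse of the special precover functor. -/
noncomputable def hoCovInverseIso :
    have := h.hoCov_isEquivalence hE
    (h.hoCov hE).asEquivalence.inverse ≅ E.quotientFunctor h C :=
  have := h.hoCov_isEquivalence hE
  Adjunction.rightAdjointUniq (h.hoCov hE).asEquivalence.toAdjunction
    ((h.hoCovAdjunction hE (le_refl C)).ofNatIsoLeft
      (Functor.isoWhiskerLeft (h.hoCov hE) (stableInclRefl E C) ≪≫ Functor.rightUnitor _))

end IsProjectiveCotorsionPair

end ExactStructure

/-! ### Exactness of adjoints and triangulated essential images -/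

section

attribute [local instance] TriangulatedStructure.preadditive TriangulatedStructure.hasZeroObject
  TriangulatedStructure.hasShift TriangulatedStructure.shift_additive
  TriangulatedStructure.pretriangulated TriangulatedStructure.isTriangulated

lemma IsExactFunctor.of_rightAdjoint {T : Type u} [Category.{v} T] [TriangulatedStructure T]
    {T' : Type u'} [Category.{v'} T'] [TriangulatedStructure T'] {F : T ⥤ T'} {G : T' ⥤ T}
    (adj : F ⊣ G) (hF : IsExactFunctor F) : IsExactFunctor G := by
  obtain ⟨_, _⟩ := hF
  let := adj.rightAdjointCommShift ℤ
  have := adj.commShift_of_leftAdjoint ℤ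
  exact ⟨inferInstance, adj.isTriangulated_rightAdjoint⟩

lemma IsExactFunctor.of_leftAdjoint {T : Type u} [Category.{v} T] [TriangulatedStructure T]
    {T' : Type u'} [Category.{v'} T'] [TriangulatedStructure T'] {F : T ⥤ T'} {G : T' ⥤ T}
    (adj : F ⊣ G) (hG : IsExactFunctor G) : IsExactFunctor F := by
  obtain ⟨_, _⟩ := hG
  let := adj.leftAdjointCommShift ℤ
  have := adj.commShift_of_rightAdjoint ℤ
  exact ⟨inferInstance, adj.isTriangulated_leftAdjoint⟩

/-- A distinguished triangle is determined up to isomorphism by its first morphism, so it suffices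
that conflations give distinguished triangles and that every morphism is isomorphic to the image of
an admissible monomorphism. -/
lemma isInducedTriangulation_of_arrows {D : Type u'} [Category.{v'} D] [Preadditive D]
    {conf : ObjectProperty (ShortComplex D)} {T : Type u} [Category.{v} T]
    [TriangulatedStructure T] {γ : D ⥤ T} (hγ : γ.Additive)
    (δ : ∀ S : ShortComplex D, conf S → (γ.obj S.X₃ ⟶ (γ.obj S.X₁)⟦(1 : ℤ)⟧))
    (hδ : ∀ (S S' : ShortComplex D) (hS : conf S) (hS' : conf S') (φ : S ⟶ S'),
      δ S hS ≫ (γ.map φ.τ₁)⟦(1 : ℤ)⟧' = γ.map φ.τ₃ ≫ δ S' hS')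
    (hd : ∀ (S : ShortComplex D) (hS : conf S),
      Triangle.mk (γ.map S.f) (γ.map S.g) (δ S hS) ∈ distTriang T)
    (ha : ∀ {X Y : T} (f : X ⟶ Y), ∃ (S : ShortComplex D) (_ : conf S),
      Nonempty (Arrow.mk f ≅ Arrow.mk (γ.map S.f))) : IsInducedTriangulation conf γ := by
  refine ⟨hγ, δ, hδ, fun Δ => ⟨fun hΔ => ?_, ?_⟩⟩
  · obtain ⟨S, hS, ⟨e⟩⟩ := ha Δ.mor₁
    obtain ⟨e', -⟩ := exists_iso_of_arrow_iso Δ _ hΔ (hd S hS) e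
    exact ⟨S, hS, ⟨e'⟩⟩
  · rintro ⟨S, hS, ⟨e⟩⟩
    exact isomorphic_distinguished _ (hd S hS) _ e

lemma prop_shift_of_shift_one {T : Type u} [Category.{v} T] [HasShift T ℤ] (P : ObjectProperty T)
    [P.IsClosedUnderIsomorphisms] (h₁ : ∀ X, P X → P (X⟦(1 : ℤ)⟧))
    (h₂ : ∀ X, P X → P (X⟦(-1 : ℤ)⟧)) (n : ℤ) (X : T) (hX : P X) : P (X⟦n⟧) := by
  induction n using Int.induction_on with
  | zero => exact P.prop_of_iso ((shiftFunctorZero T ℤ).app X).symm hX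
  | succ n hn => exact P.prop_of_iso ((shiftFunctorAdd T (n : ℤ) 1).app X).symm (h₁ _ hn)
  | pred n hn =>
    exact P.prop_of_iso ((shiftFunctorAdd' T (-(n : ℤ)) (-1) (-(n : ℤ) - 1) (by ring)).app X).symm
      (h₂ _ hn)

namespace ExactStructure

variable {A : Type u} [Category.{v} A] [Preadditive A] [HasZeroObject A] [HasBinaryBiproducts A]
variable {E : ExactStructure A}

namespace IsProjectiveCotorsionPair

variable {C W C₁ W₁ : ObjectProperty A} (h : E.IsProjectiveCotorsionPair C W)
  (hE : E.HasEnoughProjectives) (h₁ : E.IsProjectiveCotorsionPair C₁ W₁) (hC : C ≤ C₁)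

include h in
-- For inverse stable isomorphisms `f` and `g`, the difference of `f ≫ g` and the identity factors
-- through a projective `P`; hence `X` is a retract of `Y ⊞ P`.
lemma left_of_stable_iso {D : ObjectProperty A} {X Y : D.FullSubcategory}
    (e : (E.toStable D).obj X ≅ (E.toStable D).obj Y) (hY : C Y.obj) : C X.obj := by
  obtain ⟨f, hf⟩ := (E.toStable D).map_surjective e.hom
  obtain ⟨g, hg⟩ := (E.toStable D).map_surjective e.inv
  have hfg : (E.toStable D).map (𝟙 X) = (E.toStable D).map (f ≫ g) := by
    rw [Functor.map_comp, hf, hg, e.hom_inv_id, CategoryTheory.Functor.map_id]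
  obtain ⟨P, t, s, hP, hts⟩ := (toStable_map_eq_iff _ _).1 hfg
  exact h.left_of_retract
    { i := biprod.lift f.hom t
      r := biprod.desc g.hom s
      retract := by
        rw [biprod.lift_desc, ← hts]
        exact add_sub_cancel _ _ } (h.left_biprod hY (h.projectives_le _ hP))

include h in
lemma essImage_stableIncl_iff (X : E.StableCat C₁) :
    (E.stableIncl hC).essImage X ↔ C X.as.obj := by
  constructor
  · rintro ⟨Y, ⟨e⟩⟩
    exact h.left_of_stable_iso (D := C₁) (X := X.as) (Y := (ObjectProperty.ιOfLE hC).obj Y.as)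
      e.symm Y.as.property
  · intro hX
    exact ⟨(E.toStable C).obj ⟨X.as.obj, hX⟩, ⟨Iso.refl _⟩⟩

lemma isZero_toStable {D : ObjectProperty A} {X : D.FullSubcategory}
    (hX : E.projectives X.obj) [Preadditive (E.StableCat D)] [(E.toStable D).Additive] :
    IsZero ((E.toStable D).obj X) := by
  rw [IsZero.iff_id_eq_zero, ← CategoryTheory.Functor.map_id, ← (E.toStable D).map_zero,
    toStable_map_eq_iff]
  exact ⟨X.obj, 𝟙 _, 𝟙 _, hX, by simp⟩

variable [TriangulatedStructure (E.StableCat C₁)]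
  (hI : IsInducedTriangulation (E.confOn C₁) (E.toStable C₁))

include h hE h₁ hI in
lemma essImage_stableIncl_isTriangulated : (E.stableIncl hC).essImage.IsTriangulated := by
  obtain ⟨_, δ, hδ, hd⟩ := hI
  -- A conflation with projective middle term has a stably zero middle term, so its connecting
  -- morphism is invertible and `Y` is the shift of `X`.
  have key {X P Y : A} {j : X ⟶ P} {q : P ⟶ Y} (hc : E.Conf j q) (hX : C₁ X) (hP : E.projectives P)
      (hY : C₁ Y) : Nonempty ((E.toStable C₁).obj ⟨Y, hY⟩ ≅
        ((E.toStable C₁).obj ⟨X, hX⟩)⟦(1 : ℤ)⟧) := by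
    let X' : C₁.FullSubcategory := ⟨X, hX⟩
    let P' : C₁.FullSubcategory := ⟨P, h₁.projectives_le _ hP⟩
    let Y' : C₁.FullSubcategory := ⟨Y, hY⟩
    let S : ShortComplex C₁.FullSubcategory :=
      ShortComplex.mk (ObjectProperty.homMk j : X' ⟶ P') (ObjectProperty.homMk q : P' ⟶ Y')
        (by ext; exact hc.zero)
    have hS : E.confOn C₁ S := (confOn_mk_iff _).2 hc
    have := (hd _).2 ⟨S, hS, ⟨Iso.refl _⟩⟩
    have : IsIso (δ S hS) := (Triangle.isZero₂_iff_isIso₃ _ this).1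
      (isZero_toStable (E := E) (X := P') hP)
    exact ⟨asIso (δ S hS)⟩
  have h0 := (h₁.isExtensionClosed.zero)
  refine
    { exists_zero := ?_
      isStableUnderShiftBy := fun n => ⟨fun X hX => ?_⟩
      toIsTriangulatedClosed₂ := .mk' fun Δ hΔ hX hZ => ?_ }
  · refine ⟨(E.toStable C₁).obj ⟨0, h0⟩, isZero_toStable (E := E)
      (projectives_of_isZero (isZero_zero A)), ?_⟩
    exact (h.essImage_stableIncl_iff hC _).2 h.isExtensionClosed.zero
  -- The shift by `1` is the cokernel of an embedding in a projective, the shift by `-1` the kernel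
  -- of an epimorphism from a projective; both can be taken in `C`.
  · refine prop_shift_of_shift_one _ (fun X hX => ?_) (fun X hX => ?_) n X hX
    · rw [h.essImage_stableIncl_iff] at hX
      obtain ⟨P, Y, j, q, hP, hY, hc⟩ := h.exists_embedding hX
      obtain ⟨e⟩ := key hc X.as.property hP (hC _ hY)
      exact (E.stableIncl hC).essImage.prop_of_iso e ((h.essImage_stableIncl_iff hC _).2 hY)
    · rw [h.essImage_stableIncl_iff] at hX
      obtain ⟨K, P, i, p, hP, hc⟩ := hE.exists_conf X.as.obj
      have hK := h.left_X₁ hc (h.projectives_le _ hP) hX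
      obtain ⟨e⟩ := key hc (hC _ hK) hP X.as.property
      exact (E.stableIncl hC).essImage.prop_of_iso
        ((shiftFunctorCompIsoId (E.StableCat C₁) (1 : ℤ) (-1) (by ring)).symm.app _ ≪≫
          (shiftFunctor _ (-1 : ℤ)).mapIso e.symm)
        ((h.essImage_stableIncl_iff hC ((E.toStable C₁).obj ⟨K, hC _ hK⟩)).2 hK)
  · obtain ⟨S, hS, ⟨e⟩⟩ := (hd Δ).1 hΔ
    obtain ⟨e₁, e₂, e₃, -⟩ := exists_isos_of_iso e
    have hX' := (h.essImage_stableIncl_iff hC _).1 ((E.stableIncl hC).essImage.prop_of_iso e₁ hX)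
    have hZ' := (h.essImage_stableIncl_iff hC _).1 ((E.stableIncl hC).essImage.prop_of_iso e₃ hZ)
    exact (E.stableIncl hC).essImage.prop_of_iso e₂.symm ((h.essImage_stableIncl_iff hC _).2
      (h.left_ext ((E.conf_iff _).1 hS) hX' hZ'))

end IsProjectiveCotorsionPair

end ExactStructure

end

/-! ### The induced triangulation on a smaller stable category -/

section

attribute [local instance] TriangulatedStructure.preadditive TriangulatedStructure.hasZeroObject
  TriangulatedStructure.hasShift TriangulatedStructure.shift_additive
  TriangulatedStructure.pretriangulated TriangulatedStructure.isTriangulated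

namespace ExactStructure

variable {A : Type u} [Category.{v} A] [Preadditive A] [HasZeroObject A] [HasBinaryBiproducts A]
variable {E : ExactStructure A}

lemma exists_arrow_iso {C : ObjectProperty A} [TriangulatedStructure (E.StableCat C)]
    (hI : IsInducedTriangulation (E.confOn C) (E.toStable C)) {X Y : E.StableCat C} (f : X ⟶ Y) :
    ∃ (S : ShortComplex C.FullSubcategory) (_ : E.confOn C S) (e₁ : X ≅ (E.toStable C).obj S.X₁)
      (e₂ : Y ≅ (E.toStable C).obj S.X₂), f ≫ e₂.hom = e₁.hom ≫ (E.toStable C).map S.f := by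
  obtain ⟨_, δ, hδ, hd⟩ := hI
  obtain ⟨Z, g, k, hΔ⟩ := distinguished_cocone_triangle f
  obtain ⟨S, hS, ⟨e⟩⟩ := (hd _).1 hΔ
  obtain ⟨e₁, e₂, e₃, w, -⟩ := exists_isos_of_iso e
  exact ⟨S, hS, e₁, e₂, w⟩

namespace IsProjectiveCotorsionPair

variable {C W C₁ W₁ : ObjectProperty A} (h : E.IsProjectiveCotorsionPair C W)
  (hE : E.HasEnoughProjectives) (h₁ : E.IsProjectiveCotorsionPair C₁ W₁) (hC : C ≤ C₁)
  [TriangulatedStructure (E.StableCat C₁)]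
  (hI : IsInducedTriangulation (E.confOn C₁) (E.toStable C₁))

include h h₁ hI in
-- Full faithfulness pulls the connecting morphisms back from `C₁/∼`. The point is that a morphism
-- of `C/∼` is represented by a conflation with all terms in `C`, not just in `C₁`.
lemma isInducedTriangulation_of_stableIncl [TriangulatedStructure (E.StableCat C)]
    [(E.stableIncl hC).CommShift ℤ] [(E.stableIncl hC).Additive]
    (hd : ∀ Δ : Triangle (E.StableCat C), Δ ∈ distTriang (E.StableCat C) ↔
      (E.stableIncl hC).mapTriangle.obj Δ ∈ distTriang (E.StableCat C₁)) :
    IsInducedTriangulation (E.confOn C) (E.toStable C) := by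
  have hI' := hI
  obtain ⟨hadd, δ, hδ, hd₁⟩ := hI'
  let F := E.stableIncl hC
  obtain ⟨δ', hδ', hd'⟩ : ∃ δ' : ∀ S : ShortComplex C.FullSubcategory, E.confOn C S →
      (F.obj ((E.toStable C).obj S.X₃) ⟶ (F.obj ((E.toStable C).obj S.X₁))⟦(1 : ℤ)⟧),
      (∀ (S S' : ShortComplex C.FullSubcategory) (hS : E.confOn C S) (hS' : E.confOn C S')
        (φ : S ⟶ S'), δ' S hS ≫ (F.map ((E.toStable C).map φ.τ₁))⟦(1 : ℤ)⟧' =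
          F.map ((E.toStable C).map φ.τ₃) ≫ δ' S' hS') ∧
      ∀ (S : ShortComplex C.FullSubcategory) (hS : E.confOn C S),
        Triangle.mk (F.map ((E.toStable C).map S.f)) (F.map ((E.toStable C).map S.g)) (δ' S hS) ∈
          distTriang (E.StableCat C₁) := by
    let G (S : ShortComplex C.FullSubcategory) : ShortComplex C₁.FullSubcategory :=
      ShortComplex.mk ((ObjectProperty.ιOfLE hC).map S.f) ((ObjectProperty.ιOfLE hC).map S.g)
        (by
          have hz : S.f.hom ≫ S.g.hom = 0 := congrArg (fun k => InducedCategory.Hom.hom k) S.zero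
          ext : 1
          exact hz)
    refine ⟨fun S hS => δ (G S) hS, fun S S' hS hS' φ => ?_, fun S hS =>
      (hd₁ _).2 ⟨G S, hS, ⟨Iso.refl _⟩⟩⟩
    let ψ : G S ⟶ G S' :=
      { τ₁ := (ObjectProperty.ιOfLE hC).map φ.τ₁
        τ₂ := (ObjectProperty.ιOfLE hC).map φ.τ₂
        τ₃ := (ObjectProperty.ιOfLE hC).map φ.τ₃
        comm₁₂ := by
          have hz : φ.τ₁.hom ≫ S'.f.hom = S.f.hom ≫ φ.τ₂.hom :=
            congrArg (fun k => InducedCategory.Hom.hom k) φ.comm₁₂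
          ext : 1
          exact hz
        comm₂₃ := by
          have hz : φ.τ₂.hom ≫ S'.g.hom = S.g.hom ≫ φ.τ₃.hom :=
            congrArg (fun k => InducedCategory.Hom.hom k) φ.comm₂₃
          ext : 1
          exact hz }
    exact hδ (G S) (G S') hS hS' ψ
  let d (S : ShortComplex C.FullSubcategory) (hS : E.confOn C S) :
      (E.toStable C).obj S.X₃ ⟶ ((E.toStable C).obj S.X₁)⟦(1 : ℤ)⟧ :=
    F.preimage (δ' S hS ≫ (F.commShiftIso (1 : ℤ)).inv.app ((E.toStable C).obj S.X₁))
  have hdS (S : ShortComplex C.FullSubcategory) (hS : E.confOn C S) : F.map (d S hS) =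
      δ' S hS ≫ (F.commShiftIso (1 : ℤ)).inv.app ((E.toStable C).obj S.X₁) :=
    F.map_preimage _
  refine isInducedTriangulation_of_arrows ⟨fun {X Y f g} => F.map_injective ?_⟩ d ?_ ?_ ?_
  · rw [F.map_add]
    exact hadd.map_add (f := (ObjectProperty.ιOfLE hC).map f)
      (g := (ObjectProperty.ιOfLE hC).map g)
  · intro S S' hS hS' φ
    apply F.map_injective
    have hn := (F.commShiftIso (1 : ℤ)).inv.naturality ((E.toStable C).map φ.τ₁)
    dsimp at hn
    rw [F.map_comp, F.map_comp, hdS, hdS, Category.assoc, ← hn, reassoc_of% (hδ' S S' hS hS' φ)]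
  · intro S hS
    refine (hd _).2 (isomorphic_distinguished _ (hd' S hS) _ ?_)
    refine triangleIsoMk (f := F.map ((E.toStable C).map S.f))
      (g := F.map ((E.toStable C).map S.g))
      (h := F.map (d S hS) ≫ (F.commShiftIso (1 : ℤ)).hom.app ((E.toStable C).obj S.X₁))
      (Iso.refl _) (Iso.refl _) (Iso.refl _) ?_ ?_ ?_
    · simp
    · simp
    · simp [hdS]
  · intro X Y f
    obtain ⟨S, hS, e₁, e₂, w⟩ := exists_arrow_iso hI (F.map f)
    have hX₁ : C S.X₁.obj := (h.essImage_stableIncl_iff hC _).1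
      (F.essImage.prop_of_iso e₁ (F.obj_mem_essImage X))
    have hX₂ : C S.X₂.obj := (h.essImage_stableIncl_iff hC _).1
      (F.essImage.prop_of_iso e₂ (F.obj_mem_essImage Y))
    have hc : E.Conf S.f.hom S.g.hom := (E.conf_iff _).1 hS
    -- The first two terms are in `C` because they are stably isomorphic to objects of `C`; the
    -- cokernel, being in `C₁`, is then in `C` too.
    have hX₃ : C S.X₃.obj := h.left_X₃ h₁ hc hX₁ hX₂ S.X₃.property
    let Y₁ : C.FullSubcategory := ⟨S.X₁.obj, hX₁⟩
    let Y₂ : C.FullSubcategory := ⟨S.X₂.obj, hX₂⟩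
    let Y₃ : C.FullSubcategory := ⟨S.X₃.obj, hX₃⟩
    let e₁' : F.obj X ≅ F.obj ((E.toStable C).obj Y₁) := e₁
    let e₂' : F.obj Y ≅ F.obj ((E.toStable C).obj Y₂) := e₂
    refine ⟨ShortComplex.mk (ObjectProperty.homMk S.f.hom : Y₁ ⟶ Y₂)
      (ObjectProperty.homMk S.g.hom : Y₂ ⟶ Y₃) (by ext : 1; exact hc.zero),
      (confOn_mk_iff _).2 hc, ⟨Arrow.isoMk (F.preimageIso e₁') (F.preimageIso e₂') ?_⟩⟩
    apply F.map_injective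
    refine (F.map_comp _ _).trans (Eq.trans ?_ (F.map_comp _ _).symm)
    refine (congrArg (fun k => k ≫ _) (F.map_preimage e₁'.hom)).trans (w.symm.trans ?_)
    exact (congrArg (fun k => F.map f ≫ k) (F.map_preimage e₂'.hom)).symm

include h hE h₁ hI in
theorem exists_triangulatedStructure_stableIncl :
    ∃ _ : TriangulatedStructure (E.StableCat C), IsExactFunctor (E.stableIncl hC) ∧
      IsInducedTriangulation (E.confOn C) (E.toStable C) := by
  have := h.essImage_stableIncl_isTriangulated hE h₁ hC hI
  obtain ⟨_, _, _, hd⟩ := exists_triangulatedStructure_of_fullyFaithful (E.stableIncl hC)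
  exact ⟨inferInstance, ⟨inferInstance, ⟨fun Δ => (hd Δ).1⟩⟩,
    h.isInducedTriangulation_of_stableIncl h₁ hC hI hd⟩

end IsProjectiveCotorsionPair

end ExactStructure

end

/-! ### The triangulation of `A / W` -/

section

attribute [local instance] TriangulatedStructure.preadditive TriangulatedStructure.hasZeroObject
  TriangulatedStructure.hasShift TriangulatedStructure.shift_additive
  TriangulatedStructure.pretriangulated TriangulatedStructure.isTriangulated

namespace ExactStructure

variable {A : Type u} [Category.{v} A] [Preadditive A] [HasZeroObject A] [HasBinaryBiproducts A]
variable {E : ExactStructure A}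

namespace IsProjectiveCotorsionPair

variable {C W C₁ W₁ : ObjectProperty A} (h : E.IsProjectiveCotorsionPair C W)
  (hE : E.HasEnoughProjectives) (hA : WeaklyIdempotentComplete A)
  (h₁ : E.IsProjectiveCotorsionPair C₁ W₁) (hC : C ≤ C₁)

include h in
/-- Morphisms of conflations lift to special precovers. -/
lemma exists_lift_conf {X Y Z X' Y' Z' U V T : A} {f : X ⟶ Y} {g : Y ⟶ Z}
    (hc : E.Conf f g) (hX : C X) (hZ : C Z) {f' : X' ⟶ Y'} {g' : Y' ⟶ Z'} (hc' : E.Conf f' g')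
    {a' : X' ⟶ U} {b' : Y' ⟶ V} {c' : Z' ⟶ T} {k : U ⟶ V} {l : V ⟶ T}
    (ha' : E.admEpi W a') (hb' : E.admEpi W b') (hk : f' ≫ b' = a' ≫ k) (hl : g' ≫ c' = b' ≫ l)
    (α : X ⟶ U) (β : Y ⟶ V) (ζ : Z ⟶ T) (hαβ : f ≫ β = α ≫ k) (hβζ : g ≫ ζ = β ≫ l) :
    ∃ (t₁ : X ⟶ X') (t₂ : Y ⟶ Y') (t₃ : Z ⟶ Z'), t₁ ≫ f' = f ≫ t₂ ∧ t₂ ≫ g' = g ≫ t₃ ∧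
      t₁ ≫ a' = α ∧ t₃ ≫ c' = ζ := by
  obtain ⟨t₁, ht₁⟩ := h.exists_lift_precover ha' hX α
  obtain ⟨K, i, hi, hK⟩ := admEpi_iff.1 hb'
  obtain ⟨t₂, h₂, h₂'⟩ := ExtVanishes.exists_diagonal hc hi (h.ext hZ hK) (t₁ ≫ f') β (by
    rw [Category.assoc, hk, reassoc_of% ht₁, hαβ])
  obtain ⟨t₃, ht₃⟩ := hc.exists_desc (t₂ ≫ g') (by rw [reassoc_of% h₂, hc'.zero, comp_zero])
  have := hc.epi
  exact ⟨t₁, t₂, t₃, h₂.symm, ht₃.symm, ht₁, by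
    rw [← cancel_epi g, reassoc_of% ht₃, hl, reassoc_of% h₂', hβζ]⟩

include h hE hA in
lemma exists_resolution (hC : C ≤ C₁) (S : ShortComplex A) (hS : E.conf S) :
    ∃ (R : ShortComplex C₁.FullSubcategory) (a : R.X₁.obj ⟶ S.X₁) (b : R.X₂.obj ⟶ S.X₂)
      (c : R.X₃.obj ⟶ S.X₃), E.confOn C₁ R ∧ C R.X₁.obj ∧ C R.X₃.obj ∧
        R.f.hom ≫ b = a ≫ S.f ∧ R.g.hom ≫ c = b ≫ S.g ∧
        E.admEpi W a ∧ E.admEpi W b ∧ E.admEpi W c := by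
  obtain ⟨X', Y', Z', f', g', a, b, c, hc, hX', hY', hZ', h₁, h₂, ha, hb, hc'⟩ :=
    h.exists_horseshoe hE hA ((conf_iff S).1 hS)
  let X : C₁.FullSubcategory := ⟨X', hC _ hX'⟩
  let Y : C₁.FullSubcategory := ⟨Y', hC _ hY'⟩
  let Z : C₁.FullSubcategory := ⟨Z', hC _ hZ'⟩
  exact ⟨ShortComplex.mk (ObjectProperty.homMk f' : X ⟶ Y) (ObjectProperty.homMk g' : Y ⟶ Z)
    (by ext : 1; exact hc.zero), a, b, c, (confOn_mk_iff _).2 hc, hX', hZ', h₁, h₂, ha, hb, hc'⟩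

variable [TriangulatedStructure (E.StableCat C₁)]
  (hI : IsInducedTriangulation (E.confOn C₁) (E.toStable C₁))

include hE hC hI in
-- Special precovers are invertible in `A / W`, so sums can be computed on precovers in `C ≤ C₁`,
-- where the localization functor agrees with the additive functor from `C₁/∼`.
lemma toHo_additive [Preadditive (E.HoCat C W)] [(E.quotientFunctor h C₁).Additive] :
    (E.toHo C W).Additive where
  map_add {X Y f g} := by
    obtain ⟨hadd, -⟩ := hI
    obtain ⟨f', hf'⟩ := h.exists_lift_precover (h.covMap_admEpi Y) (h.cov X).property
      (h.covMap X ≫ f)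
    obtain ⟨g', hg'⟩ := h.exists_lift_precover (h.covMap_admEpi Y) (h.cov X).property
      (h.covMap X ≫ g)
    have key : (E.toHo C W).map (f' + g') = (E.toHo C W).map f' + (E.toHo C W).map g' := by
      let F : (ObjectProperty.ιOfLE hC).obj (h.cov X) ⟶ (ObjectProperty.ιOfLE hC).obj (h.cov Y) :=
        ObjectProperty.homMk f'
      let G : (ObjectProperty.ιOfLE hC).obj (h.cov X) ⟶ (ObjectProperty.ιOfLE hC).obj (h.cov Y) :=
        ObjectProperty.homMk g'
      exact (congrArg (E.quotientFunctor h C₁).map (hadd.map_add (f := F) (g := G))).trans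
        ((E.quotientFunctor h C₁).map_add)
    have := h.isIso_toHo_map_of_admEpi hE (h.covMap X) (h.covMap_admEpi X)
    rw [← cancel_epi ((E.toHo C W).map (h.covMap X)), ← Functor.map_comp, Preadditive.comp_add,
      ← hf', ← hg', ← Preadditive.add_comp, Functor.map_comp, key, Preadditive.comp_add,
      ← Functor.map_comp, ← Functor.map_comp, ← hf', ← hg', Functor.map_comp, Functor.map_comp,
      Preadditive.add_comp]

include hE hA hC hI in
-- A conflation of `A` is isomorphic in `A / W` to a resolution by objects of `C`, given by the
-- horseshoe lemma. Its connecting morphism is that of the resolution, conjugated by these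
-- isomorphisms.
theorem isInducedTriangulation_toHo [TriangulatedStructure (E.HoCat C W)]
    (hj : IsExactFunctor (E.quotientFunctor h C₁)) :
    IsInducedTriangulation E.conf (E.toHo C W) := by
  obtain ⟨_, _⟩ := hj
  let J := E.quotientFunctor h C₁
  let γ := E.toHo C W
  have hγ : γ.Additive := h.toHo_additive hE hC hI
  obtain ⟨δ', hδ', hd'⟩ : ∃ δ' : ∀ R : ShortComplex C₁.FullSubcategory, E.confOn C₁ R →
      (γ.obj R.X₃.obj ⟶ (γ.obj R.X₁.obj)⟦(1 : ℤ)⟧),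
      (∀ (R R' : ShortComplex C₁.FullSubcategory) (hR : E.confOn C₁ R) (hR' : E.confOn C₁ R')
        (φ : R ⟶ R'), δ' R hR ≫ (γ.map φ.τ₁.hom)⟦(1 : ℤ)⟧' = γ.map φ.τ₃.hom ≫ δ' R' hR') ∧
      ∀ (R : ShortComplex C₁.FullSubcategory) (hR : E.confOn C₁ R),
        Triangle.mk (γ.map R.f.hom) (γ.map R.g.hom) (δ' R hR) ∈ distTriang (E.HoCat C W) := by
    obtain ⟨_, δ, hδ, hd⟩ := hI
    refine ⟨fun R hR => J.map (δ R hR) ≫ (J.commShiftIso (1 : ℤ)).hom.app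
      ((E.toStable C₁).obj R.X₁), fun R R' hR hR' φ => ?_, fun R hR => ?_⟩
    · have hn := (J.commShiftIso (1 : ℤ)).hom.naturality ((E.toStable C₁).map φ.τ₁)
      have h₂ := congrArg J.map (hδ R R' hR hR' φ)
      rw [J.map_comp, J.map_comp] at h₂
      refine (Category.assoc _ _ _).trans
        ((congrArg (fun k => J.map (δ R hR) ≫ k) hn.symm).trans ?_)
      refine (Category.assoc _ _ _).symm.trans ?_
      exact (congrArg (fun k => k ≫ (J.commShiftIso (1 : ℤ)).hom.app
        ((E.toStable C₁).obj R'.X₁)) h₂).trans (Category.assoc _ _ _)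
    · exact J.map_distinguished _ ((hd _).2 ⟨R, hR, ⟨Iso.refl _⟩⟩)
  choose R a b c hR hR₁ hR₃ hf hg ha hb hc using h.exists_resolution hE hA hC
  have hRc (S) (hS : E.conf S) : E.Conf (R S hS).f.hom (R S hS).g.hom :=
    (E.conf_iff _).1 (hR S hS)
  have ia (S) (hS : E.conf S) : IsIso (γ.map (a S hS)) :=
    h.isIso_toHo_map_of_admEpi hE _ (ha S hS)
  have ib (S) (hS : E.conf S) : IsIso (γ.map (b S hS)) :=
    h.isIso_toHo_map_of_admEpi hE _ (hb S hS)
  have ic (S) (hS : E.conf S) : IsIso (γ.map (c S hS)) :=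
    h.isIso_toHo_map_of_admEpi hE _ (hc S hS)
  refine isInducedTriangulation_of_arrows hγ (fun S hS => inv (γ.map (c S hS)) ≫ δ' _ (hR S hS) ≫
    (γ.map (a S hS))⟦(1 : ℤ)⟧') ?_ ?_ ?_
  · intro S S' hS hS' φ
    -- Naturality comes from a lift to the resolutions. Only the outer terms of the lift have to
    -- match, since connecting morphisms do not involve the middle term.
    obtain ⟨t₁, t₂, t₃, h₁₂, h₂₃, ht₁, ht₃⟩ := h.exists_lift_conf (hRc S hS) (hR₁ S hS) (hR₃ S hS)
      (hRc S' hS') (ha S' hS') (hb S' hS') (hf S' hS') (hg S' hS') (a S hS ≫ φ.τ₁) (b S hS ≫ φ.τ₂)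
      (c S hS ≫ φ.τ₃) (by rw [reassoc_of% hf S hS, Category.assoc, φ.comm₁₂])
      (by rw [reassoc_of% hg S hS, Category.assoc, φ.comm₂₃])
    let ψ : R S hS ⟶ R S' hS' :=
      { τ₁ := ObjectProperty.homMk t₁
        τ₂ := ObjectProperty.homMk t₂
        τ₃ := ObjectProperty.homMk t₃
        comm₁₂ := by ext : 1; exact h₁₂
        comm₂₃ := by ext : 1; exact h₂₃ }
    have hn : δ' _ (hR S hS) ≫ (γ.map t₁)⟦(1 : ℤ)⟧' = γ.map t₃ ≫ δ' _ (hR S' hS') :=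
      hδ' _ _ (hR S hS) (hR S' hS') ψ
    change _ = γ.map φ.τ₃ ≫ _
    rw [Category.assoc, Category.assoc, IsIso.inv_comp_eq, ← Functor.map_comp, ← γ.map_comp,
      ← ht₁, γ.map_comp, Functor.map_comp, reassoc_of% hn, ← γ.map_comp_assoc, ← ht₃, γ.map_comp,
      Category.assoc, IsIso.hom_inv_id_assoc]
  · intro S hS
    refine isomorphic_distinguished _ (hd' _ (hR S hS)) _ (triangleIsoMk
      (asIso (γ.map (a S hS))).symm (asIso (γ.map (b S hS))).symm (asIso (γ.map (c S hS))).symm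
      ?_ ?_ ?_)
    · rw [Iso.symm_hom, Iso.symm_hom, Iso.comp_inv_eq, Category.assoc, Iso.eq_inv_comp, asIso_hom,
        asIso_hom, ← γ.map_comp, ← γ.map_comp, hf S hS]
    · rw [Iso.symm_hom, Iso.symm_hom, Iso.comp_inv_eq, Category.assoc, Iso.eq_inv_comp, asIso_hom,
        asIso_hom, ← γ.map_comp, ← γ.map_comp, hg S hS]
    · simp
  · intro X Y f
    -- The arrow is moved to `C₁/∼`, represented there by an admissible monomorphism, and moved back
    -- along the invertible unit.
    obtain ⟨S, hS, e₁, e₂, w⟩ := exists_arrow_iso hI ((h.hoCovIncl hE hC).map f)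
    have := h.isIso_hoCovUnit hE hC
    let η := (h.hoCovAdjunction hE hC).unit
    refine ⟨S.map C₁.ι, hS, ⟨Arrow.isoMk ((asIso η).app X ≪≫ J.mapIso e₁)
      ((asIso η).app Y ≪≫ J.mapIso e₂) ?_⟩⟩
    have h₂ := congrArg J.map w
    rw [J.map_comp, J.map_comp] at h₂
    refine (Category.assoc _ _ _).trans ((congrArg (fun k => η.app X ≫ k) h₂.symm).trans ?_)
    refine (Category.assoc _ _ _).symm.trans ?_
    exact (congrArg (fun k => k ≫ J.map e₂.hom) (η.naturality f).symm).trans (Category.assoc _ _ _)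

lemma essImage_hoCovIncl :
    (h.hoCovIncl hE hC).essImage = (E.stableIncl hC).essImage := by
  have := h.hoCov_isEquivalence hE
  ext X
  constructor
  · rintro ⟨Y, ⟨e⟩⟩
    exact ⟨_, ⟨e⟩⟩
  · rintro ⟨Y, ⟨e⟩⟩
    exact ⟨(h.hoCov hE).objPreimage Y,
      ⟨(E.stableIncl hC).mapIso ((h.hoCov hE).objObjPreimageIso Y) ≪≫ e⟩⟩

include hA h₁ hI in
-- The triangulation is pulled back along the embedding by special precovers, which is thereby
-- exact; its right adjoint, the quotient functor, is then exact too.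
theorem exists_triangulatedStructure_hoCat :
    ∃ _ : TriangulatedStructure (E.HoCat C W), IsExactFunctor (h.hoCovIncl hE hC) ∧
      IsExactFunctor (E.quotientFunctor h C₁) ∧ IsInducedTriangulation E.conf (E.toHo C W) := by
  have : (h.hoCovIncl hE hC).essImage.IsTriangulated := by
    rw [h.essImage_hoCovIncl hE hC]
    exact h.essImage_stableIncl_isTriangulated hE h₁ hC hI
  have := h.full_hoCovIncl hE hC
  have := h.faithful_hoCovIncl hE hC
  obtain ⟨_, _, _, hd⟩ := exists_triangulatedStructure_of_fullyFaithful (h.hoCovIncl hE hC)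
  have hL : IsExactFunctor (h.hoCovIncl hE hC) := ⟨inferInstance, ⟨fun Δ => (hd Δ).1⟩⟩
  have hj := hL.of_rightAdjoint (h.hoCovAdjunction hE hC)
  exact ⟨inferInstance, hL, hj, h.isInducedTriangulation_toHo hE hA hC hI hj⟩

end IsProjectiveCotorsionPair

end ExactStructure

end

/-! ### Presentations of the adjoints and comparison in `A / W₃` -/

namespace ExactStructure

variable {A : Type u} [Category.{v} A] [Preadditive A] [HasZeroObject A] [HasBinaryBiproducts A]
variable {E : ExactStructure A}

namespace IsProjectiveCotorsionPair

variable {C W C₁ W₁ : ObjectProperty A} (h : E.IsProjectiveCotorsionPair C W)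
  (hE : E.HasEnoughProjectives) (h₁ : E.IsProjectiveCotorsionPair C₁ W₁) (hC : C ≤ C₁)

/-- The presentation of `preenvelopeFunctor` by special preenvelopes. -/
noncomputable def preenvelopePresentation :
    E.PreenvelopePresentation W C C₁.ι (E.toStable C₁ ⋙ h.preenvelopeFunctor hE h₁ hC) where
  env := h.env h₁ hC
  env_mem X := (h.env h₁ hC X).property.1
  j := h.envMap h₁ hC
  j_adm := h.envMap_admMono h₁ hC
  iso X := Iso.refl ((E.toStable (W ⊓ C₁)).obj (h.env h₁ hC X))
  map_eq f g hg := (Category.comp_id _).trans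
    ((h.preenvelopeFunctor_map hE h₁ hC f g hg).trans (Category.id_comp _).symm)

/-- The presentation of `precoverFunctor` by special precovers. -/
noncomputable def precoverPresentation :
    E.PrecoverPresentation C W C₁.ι (E.toStable C₁ ⋙ h.precoverFunctor hE hC) where
  cov X := h.cov X.obj
  cov_mem X := (h.cov X.obj).property
  p X := h.covMap X.obj
  p_adm X := h.covMap_admEpi X.obj
  iso X := Iso.refl ((E.toStable C).obj (h.cov X.obj))
  map_eq f g hg := (Category.comp_id _).trans
    ((h.precoverFunctor_map hE hC f g hg).trans (Category.id_comp _).symm)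

/-- The presentation of `covFunctor` by special precovers. -/
noncomputable def covPresentation : E.PrecoverPresentation C W (𝟭 A) (h.covFunctor hE) where
  cov X := h.cov X
  cov_mem X := (h.cov X).property
  p X := h.covMap X
  p_adm X := h.covMap_admEpi X
  iso X := Iso.refl ((E.toStable C).obj (h.cov X))
  map_eq f g hg := (Category.comp_id _).trans
    ((h.covFunctor_map hE f g hg).trans (Category.id_comp _).symm)

/-- The presentation of `hoCovIncl` by special precovers. -/
noncomputable def hoCovInclPresentation :
    E.PrecoverPresentation C W (𝟭 A) (E.toHo C W ⋙ h.hoCovIncl hE hC) where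
  cov X := (ObjectProperty.ιOfLE hC).obj (h.cov X)
  cov_mem X := (h.cov X).property
  p X := h.covMap X
  p_adm X := h.covMap_admEpi X
  iso X := Iso.refl ((E.toStable C₁).obj ((ObjectProperty.ιOfLE hC).obj (h.cov X)))
  map_eq f g hg := (Category.comp_id _).trans ((congrArg (E.stableIncl hC).map
    ((h.hoCov_map hE f).trans (h.covFunctor_map hE f (ObjectProperty.homMk g.hom) hg))).trans
      (Category.id_comp _).symm)

end IsProjectiveCotorsionPair

section

variable {C₁ W₁ C₂ W₂ C₃ W₃ : ObjectProperty A}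
    (h₁ : E.IsProjectiveCotorsionPair C₁ W₁) (h₂ : E.IsProjectiveCotorsionPair C₂ W₂)
    (h₃ : E.IsProjectiveCotorsionPair C₃ W₃) (h₂₁ : C₂ ≤ C₁) (h₃₁ : C₃ ≤ C₁)
    (hE : E.HasEnoughProjectives) (h : W₃ ⊓ C₁ = C₂)

include h₃ hE in
lemma toHo_isIso_envMap (h₂₃ : C₂ ≤ W₃) (X : C₁.FullSubcategory) :
    IsIso ((E.toHo C₃ W₃).map (h₂.envMap h₁ h₂₁ X)) := by
  obtain ⟨K, q, hc, hK⟩ := admMono_iff.1 (h₂.envMap_admMono h₁ h₂₁ X)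
  exact h₃.isIso_toHo_map_of_admMono hE _ (admMono_iff.2 ⟨K, q, hc, h₂₃ _ hK⟩)

include h₃ hE in
lemma toHo_isIso_covMap (h₁₃ : W₁ ≤ W₃) (X : A) :
    IsIso ((E.toHo C₃ W₃).map (h₁.covMap X)) := by
  obtain ⟨K, q, hc, hK⟩ := admEpi_iff.1 (h₁.covMap_admEpi X)
  exact h₃.isIso_toHo_map_of_admEpi hE _ (admEpi_iff.2 ⟨K, q, hc, h₁₃ _ hK⟩)

/-- Special preenvelopes do not change the image in `A / W₃`. -/
noncomputable def quotientFunctorIso (h₂₃ : C₂ ≤ W₃) : E.quotientFunctor h₃ C₁ ≅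
    h₂.preenvelopeFunctor hE h₁ h₂₁ ⋙ E.stableIncl inf_le_right ⋙ E.quotientFunctor h₃ C₁ :=
  have (X : E.StableCat C₁) : IsIso ((E.quotientFunctor h₃ C₁).map
      ((h₂.preenvelopeAdjunction hE h₁ h₂₁).unit.app X)) := by
    rw [h₂.preenvelopeAdjunction_unit_app]
    exact toHo_isIso_envMap h₁ h₂ h₃ h₂₁ hE h₂₃ X.as
  NatIso.ofComponents (fun X => asIso ((E.quotientFunctor h₃ C₁).map
      ((h₂.preenvelopeAdjunction hE h₁ h₂₁).unit.app X))) fun {X Y} f => by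
    have := congrArg (E.quotientFunctor h₃ C₁).map
      ((h₂.preenvelopeAdjunction hE h₁ h₂₁).unit.naturality f)
    rw [Functor.map_comp, Functor.map_comp] at this
    exact this

/-- Special precovers do not change the image in `A / W₃`. -/
noncomputable def toHoIso (h₁₃ : W₁ ≤ W₃) :
    E.toHo C₃ W₃ ≅ h₁.covFunctor hE ⋙ E.quotientFunctor h₃ C₁ :=
  Iso.symm (NatIso.ofComponents (fun X => @asIso _ _ _ _ ((E.toHo C₃ W₃).map (h₁.covMap X))
    (toHo_isIso_covMap h₁ h₃ hE h₁₃ X))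
    fun {X Y} f => by
      obtain ⟨g, hg⟩ := h₁.exists_lift_precover (h₁.covMap_admEpi Y) (h₁.cov X).property
        (h₁.covMap X ≫ f)
      have h₄ : (E.quotientFunctor h₃ C₁).map ((h₁.covFunctor hE).map f) =
          (E.toHo C₃ W₃).map g :=
        congrArg (E.quotientFunctor h₃ C₁).map (h₁.covFunctor_map hE f (ObjectProperty.homMk g) hg)
      refine (congrArg (fun k => k ≫ (E.toHo C₃ W₃).map (h₁.covMap Y)) h₄).trans ?_
      exact ((E.toHo C₃ W₃).map_comp _ _).symm.trans
        ((congrArg (E.toHo C₃ W₃).map hg).trans ((E.toHo C₃ W₃).map_comp _ _)))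

end

end ExactStructure

/-! ### The right adjoint and the kernel of the quotient functor -/

section

attribute [local instance] TriangulatedStructure.preadditive TriangulatedStructure.hasZeroObject
  TriangulatedStructure.hasShift TriangulatedStructure.shift_additive
  TriangulatedStructure.pretriangulated TriangulatedStructure.isTriangulated

namespace ExactStructure

variable {A : Type u} [Category.{v} A] [Preadditive A] [HasZeroObject A] [HasBinaryBiproducts A]
variable {E : ExactStructure A} {C₁ W₁ C₂ W₂ C₃ W₃ : ObjectProperty A}
    (h₁ : E.IsProjectiveCotorsionPair C₁ W₁) (h₂ : E.IsProjectiveCotorsionPair C₂ W₂)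
    (h₃ : E.IsProjectiveCotorsionPair C₃ W₃) (h₂₁ : C₂ ≤ C₁) (h₃₁ : C₃ ≤ C₁)
    (hE : E.HasEnoughProjectives) (h : W₃ ⊓ C₁ = C₂)

include h₂ hE in
-- The stable form of the orthogonality of `C₂` and `W₂`, which drives the construction of `ρ`.
lemma stable_hom_eq_zero [Preadditive (E.StableCat C₁)] [(E.toStable C₁).Additive]
    {X Y : E.StableCat C₁} (hX : C₂ X.as.obj) (hY : W₂ Y.as.obj) (f : X ⟶ Y) : f = 0 := by
  obtain ⟨f, rfl⟩ := (E.toStable C₁).map_surjective (X := X.as) (Y := Y.as) f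
  refine Eq.trans ?_ ((E.toStable C₁).map_zero _ _)
  obtain ⟨P, t, s, hP, hts⟩ := h₂.exists_factor hE hX hY f.hom
  exact (toStable_map_eq_iff _ _).2 ⟨P, t, s, hP, (sub_zero _).trans hts⟩

variable [TriangulatedStructure (E.StableCat C₁)]
  (hI : IsInducedTriangulation (E.confOn C₁) (E.toStable C₁))

include h₁ h₂ h₂₁ hE h hI in
/-- Homs into objects of `W₂` do not change under special `C₃`-precovers. -/
lemma covHom_comp_bijective (X : C₁.FullSubcategory) (V : E.StableCat C₁) (hV : W₂ V.as.obj) :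
    Function.Bijective (fun f : (E.toStable C₁).obj X ⟶ V => h₃.covHom h₃₁ X ≫ f) := by
  have ht := h₂.essImage_stableIncl_isTriangulated hE h₁ h₂₁ hI
  obtain ⟨hadd, δ, hδ, hd⟩ := hI
  obtain ⟨K, i, hc, hK⟩ := admEpi_iff.1 (h₃.covMap_admEpi X.obj)
  have hK₁ : C₁ K := h₁.left_X₁ hc (h₃₁ _ (h₃.cov X.obj).property) X.property
  -- This is where the hypothesis enters: the kernel of a special `C₃`-precover of an object of `C₁`
  -- lies in `W₃ ⊓ C₁ = C₂`. Neither it nor its shift has nonzero morphisms to `V`, so the long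
  -- exact sequence gives the bijection.
  have hK₂ : C₂ K := h ▸ ⟨hK, hK₁⟩
  let K' : C₁.FullSubcategory := ⟨K, hK₁⟩
  let Y : C₁.FullSubcategory := (ObjectProperty.ιOfLE h₃₁).obj (h₃.cov X.obj)
  let S : ShortComplex C₁.FullSubcategory := ShortComplex.mk (ObjectProperty.homMk i : K' ⟶ Y)
    (ObjectProperty.homMk (h₃.covMap X.obj) : Y ⟶ X) (by ext : 1; exact hc.zero)
  have hS : E.confOn C₁ S := (confOn_mk_iff _).2 hc
  have hΔ := (hd _).2 ⟨S, hS, ⟨Iso.refl _⟩⟩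
  constructor
  · intro f g hfg
    rw [← sub_eq_zero]
    obtain ⟨k, hk⟩ := Triangle.yoneda_exact₃ _ hΔ (f - g)
      ((Preadditive.comp_sub _ _ _).trans (sub_eq_zero.2 hfg))
    have hK' : (E.stableIncl h₂₁).essImage (((E.toStable C₁).obj K')⟦(1 : ℤ)⟧) :=
      (E.stableIncl h₂₁).essImage.le_shift (1 : ℤ) _
        ((h₂.essImage_stableIncl_iff h₂₁ _).2 hK₂)
    have hk0 : k = 0 := stable_hom_eq_zero h₂ hE ((h₂.essImage_stableIncl_iff h₂₁ _).1 hK') hV k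
    exact hk.trans ((congrArg (fun l => _ ≫ l) hk0).trans comp_zero)
  · intro f
    obtain ⟨k, hk⟩ := Triangle.yoneda_exact₂ _ hΔ f
      (stable_hom_eq_zero h₂ hE (X := (E.toStable C₁).obj K') hK₂ hV _)
    exact ⟨k, hk.symm⟩

include h₁ h₂ h₂₁ h₃₁ hE h hI in
-- Under the adjunction of `λ` and `Q`, the action of `Q` on morphisms becomes precomposition with
-- the counit, which is the class of a special `C₃`-precover.
lemma quotientFunctor_map_bijective (X V : E.StableCat C₁) (hV : W₂ V.as.obj) :
    Function.Bijective (fun f : X ⟶ V => (E.quotientFunctor h₃ C₁).map f) := by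
  let adj := h₃.hoCovAdjunction hE h₃₁
  have key (f : X ⟶ V) : (adj.homEquiv _ _).symm ((E.quotientFunctor h₃ C₁).map f) =
      h₃.covHom h₃₁ X.as ≫ f := by
    rw [adj.homEquiv_counit]
    exact adj.counit.naturality f
  rw [← Function.Bijective.of_comp_iff' (adj.homEquiv _ _).symm.bijective]
  have h' := covHom_comp_bijective h₁ h₂ h₃ h₂₁ h₃₁ hE h hI X.as V hV
  rw [← funext key] at h'
  exact h'

include h₁ h₂ h₂₁ h₃₁ hE h hI in
-- Full faithfulness is the previous bijection. For essential surjectivity, an object is isomorphic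
-- in `A / W₃` to its special `C₁`-precover, and this to its special `W₂`-preenvelope, an object of
-- `W₂ ⊓ C₁`.
lemma quotientFunctor_isEquivalence :
    (E.stableIncl (inf_le_right : W₂ ⊓ C₁ ≤ C₁) ⋙ E.quotientFunctor h₃ C₁).IsEquivalence where
  faithful := ⟨fun {X Y} f g hfg => (E.stableIncl _).map_injective
    ((quotientFunctor_map_bijective h₁ h₂ h₃ h₂₁ h₃₁ hE h hI _ ((E.stableIncl _).obj Y)
      Y.as.property.1).1 hfg)⟩
  full := ⟨fun {X Y} f => by
    obtain ⟨g, hg⟩ := (quotientFunctor_map_bijective h₁ h₂ h₃ h₂₁ h₃₁ hE h hI _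
      ((E.stableIncl _).obj Y) Y.as.property.1).2 f
    obtain ⟨g, rfl⟩ := (E.stableIncl _).map_surjective g
    exact ⟨g, hg⟩⟩
  essSurj := ⟨fun X => by
    obtain ⟨X, rfl⟩ := (Localization.Construction.objEquiv _).surjective X
    exact ⟨(h₂.preenvelopeFunctor hE h₁ h₂₁).obj ((h₁.covFunctor hE).obj X),
      ⟨((quotientFunctorIso h₁ h₂ h₃ h₂₁ hE (h ▸ inf_le_left)).app _).symm ≪≫
        ((toHoIso h₁ h₃ hE (h₁.right_anti h₃ h₃₁)).app X).symm⟩⟩⟩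

include h₁ h₂ hE h in
-- If `Q X = 0`, the special `C₃`-precover of `X` is stably zero, hence in `C₂ ≤ W₃`. As its kernel
-- is in `W₃`, so is `X`, which therefore lies in `W₃ ⊓ C₁ = C₂`. Conversely, for `X` in `W₃` the
-- morphism `X ⟶ 0` is a weak equivalence.
lemma isZero_quotientFunctor_obj_iff (hadd : (E.toStable C₁).Additive)
    [TriangulatedStructure (E.HoCat C₃ W₃)] (hγ : (E.toHo C₃ W₃).Additive)
    (hL : IsExactFunctor (h₃.hoCovIncl hE h₃₁)) (X : E.StableCat C₁) :
    IsZero ((E.quotientFunctor h₃ C₁).obj X) ↔ (E.stableIncl h₂₁).essImage X := by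
  obtain ⟨_, _⟩ := hL
  rw [h₂.essImage_stableIncl_iff]
  constructor
  · intro hX
    have hZ := (h₃.hoCovIncl hE h₃₁).map_isZero hX
    have h0 : E.projectives (0 : A) := projectives_of_isZero (isZero_zero A)
    let Z : C₁.FullSubcategory := ⟨0, h₁.projectives_le _ h0⟩
    have hZ' := IsProjectiveCotorsionPair.isZero_toStable (E := E) (X := Z) h0
    have hcov : C₂ (h₃.cov X.as.obj).obj := h₂.left_of_stable_iso (D := C₁)
      (X := (ObjectProperty.ιOfLE h₃₁).obj (h₃.cov X.as.obj)) (Y := Z) (hZ.iso hZ')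
      (h₂.projectives_le _ h0)
    obtain ⟨K, i, hc, hK⟩ := admEpi_iff.1 (h₃.covMap_admEpi X.as.obj)
    rw [← h] at hcov ⊢
    exact ⟨h₃.thick.X₃ hc hK hcov.1, X.as.property⟩
  · intro hX
    rw [← h] at hX
    exact ((E.toHo C₃ W₃).map_isZero (isZero_zero A)).of_iso
      (@asIso _ _ _ _ ((E.toHo C₃ W₃).map (0 : X.as.obj ⟶ 0))
        (h₃.isIso_toHo_map_of_admEpi hE _ (admEpi_iff.2 ⟨X.as.obj, 𝟙 _,
        Conf.of_splitting (by simp) (𝟙 _) 0 (by simp) (by simp) (by simp), hX.1⟩)))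

include h hI in
/-- The right adjoint of the quotient functor, from a quasi-inverse of the restriction of the
quotient functor to `W₂ ∩ C₁`. -/
theorem exists_rightAdjoint_quotientFunctor :
    ∃ jR : E.HoCat C₃ W₃ ⥤ E.StableCat C₁, Nonempty (E.quotientFunctor h₃ C₁ ⊣ jR) ∧
      jR.Full ∧ jR.Faithful ∧
      Nonempty (E.toHo C₃ W₃ ⋙ jR ≅ h₁.covFunctor hE ⋙ h₂.preenvelopeFunctor hE h₁ h₂₁ ⋙
        E.stableIncl inf_le_right) ∧
      jR.essImage = (E.stableIncl (inf_le_right : W₂ ⊓ C₁ ≤ C₁)).essImage ∧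
      ∃ eqv : E.StableCat (W₂ ⊓ C₁) ≌ E.StableCat C₃,
        Nonempty (eqv.functor ⋙ E.stableIncl h₃₁ ≅
          E.stableIncl inf_le_right ⋙ E.quotientFunctor h₃ C₁ ⋙ h₃.hoCovIncl hE h₃₁) ∧
        Nonempty (eqv.inverse ⋙ E.stableIncl inf_le_right ≅
          E.stableIncl h₃₁ ⋙ E.quotientFunctor h₃ C₁ ⋙ jR) := by
  let ι := E.stableIncl (inf_le_right : W₂ ⊓ C₁ ≤ C₁)
  let J := E.quotientFunctor h₃ C₁
  have := quotientFunctor_isEquivalence h₁ h₂ h₃ h₂₁ h₃₁ hE h hI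
  have := h₃.hoCov_isEquivalence hE
  let K := (ι ⋙ J).asEquivalence
  let κ := quotientFunctorIso h₁ h₂ h₃ h₂₁ hE (h ▸ inf_le_left)
  let L := (h₃.hoCov hE).asEquivalence
  -- By `κ` the quotient functor is the reflection followed by the equivalence `K`; its right
  -- adjoint is the inverse of `K` followed by the inclusion.
  refine ⟨K.inverse ⋙ ι, ⟨((h₂.preenvelopeAdjunction hE h₁ h₂₁).comp K.toAdjunction).ofNatIsoLeft
    κ.symm⟩, inferInstance, inferInstance, ⟨?_⟩, ?_, K.trans L, ⟨?_⟩, ⟨?_⟩⟩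
  · exact Functor.isoWhiskerRight (toHoIso h₁ h₃ hE (h₁.right_anti h₃ h₃₁)) _ ≪≫
      Functor.isoWhiskerLeft (h₁.covFunctor hE) (Functor.isoWhiskerRight κ (K.inverse ⋙ ι) ≪≫
        Functor.isoWhiskerLeft (h₂.preenvelopeFunctor hE h₁ h₂₁)
          (Functor.isoWhiskerRight K.unitIso.symm ι))
  · ext X
    constructor
    · rintro ⟨Y, ⟨e⟩⟩
      exact ⟨_, ⟨e⟩⟩
    · rintro ⟨Y, ⟨e⟩⟩
      exact ⟨K.functor.obj Y, ⟨ι.mapIso (K.unitIso.app Y).symm ≪≫ e⟩⟩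
  · exact Iso.refl _
  · let σ : E.quotientFunctor h₃ C₃ ≅ E.stableIncl h₃₁ ⋙ J :=
      NatIso.ofComponents (fun X => Iso.refl _) (fun {X Y} f => by
        obtain ⟨f, rfl⟩ := (E.toStable C₃).map_surjective (X := X.as) (Y := Y.as) f
        exact (Category.comp_id _).trans (Category.id_comp _).symm)
    exact Functor.isoWhiskerRight (h₃.hoCovInverseIso hE ≪≫ σ) (K.inverse ⋙ ι)

end ExactStructure

end
-- The projective recollement theorem
theorem mainTheorem2 {A : Type u} [Category.{v} A] [Preadditive A] [HasZeroObject A]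
    [HasBinaryBiproducts A] (E : ExactStructure A) (hA : WeaklyIdempotentComplete A)
    (hE : E.HasEnoughProjectives) (C₁ W₁ C₂ W₂ C₃ W₃ : ObjectProperty A)
    (h₁ : E.IsProjectiveCotorsionPair C₁ W₁) (h₂ : E.IsProjectiveCotorsionPair C₂ W₂)
    (h₃ : E.IsProjectiveCotorsionPair C₃ W₃) (h₂₁ : C₂ ≤ C₁) (h₃₁ : C₃ ≤ C₁) :
    (W₃ ⊓ C₁ = C₂ ↔ (W₂ ⊓ W₃ = W₁ ∧ C₂ ≤ W₃)) ∧
    (W₃ ⊓ C₁ = C₂ →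
      -- `M₂ \ M₁` and `M₃ \ M₁` are Hovey triples, Quillen equivalent to `M₃` and `M₂`
      E.IsHoveyTriple (E.leftLocalization C₂ W₂ C₁ W₁) ∧
      E.IsHoveyTriple (E.leftLocalization C₃ W₃ C₁ W₁) ∧
      IsQuillenEquivalence (E.model (projTriple C₃ W₃))
        (E.model (E.leftLocalization C₂ W₂ C₁ W₁)) (Adjunction.id (C := A)) ∧
      IsQuillenEquivalence (E.model (projTriple C₂ W₂))
        (E.model (E.leftLocalization C₃ W₃ C₁ W₁)) (Adjunction.id (C := A)) ∧
      -- the triangulated structures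
      ∃ (_ : TriangulatedStructure (E.StableCat C₂)) (_ : TriangulatedStructure (E.StableCat C₁))
        (_ : TriangulatedStructure (E.HoCat C₃ W₃)),
      IsInducedTriangulation (E.confOn C₂) (E.toStable C₂) ∧
      IsInducedTriangulation (E.confOn C₁) (E.toStable C₁) ∧
      IsInducedTriangulation E.conf (E.toHo C₃ W₃) ∧
      -- the recollement
      ∃ (iL iR : E.StableCat C₁ ⥤ E.StableCat C₂) (jL jR : E.HoCat C₃ W₃ ⥤ E.StableCat C₁),
      IsRecollement (E.stableIncl h₂₁) iL iR (E.quotientFunctor h₃ C₁) jL jR ∧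
      -- `iL = E(M₃)`, `iR = C(M₂)`, `jL = λ = C(M₃)`, `jR = ρ = E(M₂) ∘ C(M₁)`
      Nonempty (E.PreenvelopePresentation W₃ C₃ C₁.ι (E.toStable C₁ ⋙ iL)) ∧
      Nonempty (E.PrecoverPresentation C₂ W₂ C₁.ι (E.toStable C₁ ⋙ iR)) ∧
      Nonempty (E.PrecoverPresentation C₃ W₃ (𝟭 A) (E.toHo C₃ W₃ ⋙ jL)) ∧
      (∃ (c : A ⥤ E.StableCat C₁) (e : E.StableCat C₁ ⥤ E.StableCat (W₂ ⊓ C₁)),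
        Nonempty (E.PrecoverPresentation C₁ W₁ (𝟭 A) c) ∧
        Nonempty (E.PreenvelopePresentation W₂ C₂ C₁.ι (E.toStable C₁ ⋙ e)) ∧
        Nonempty (E.toHo C₃ W₃ ⋙ jR ≅ c ⋙ e ⋙ E.stableIncl inf_le_right)) ∧
      -- the essential images of `λ` and `ρ` and the equivalence between them
      jL.essImage = (E.stableIncl h₃₁).essImage ∧
      jR.essImage = (E.stableIncl (inf_le_right : W₂ ⊓ C₁ ≤ C₁)).essImage ∧
      ∃ eqv : E.StableCat (W₂ ⊓ C₁) ≌ E.StableCat C₃,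
        Nonempty (eqv.functor ⋙ E.stableIncl h₃₁ ≅
          E.stableIncl inf_le_right ⋙ E.quotientFunctor h₃ C₁ ⋙ jL) ∧
        Nonempty (eqv.inverse ⋙ E.stableIncl inf_le_right ≅
          E.stableIncl h₃₁ ⋙ E.quotientFunctor h₃ C₁ ⋙ jR)) := by
  refine ⟨ExactStructure.inf_eq_iff h₁ h₂ h₃ h₂₁ h₃₁, fun h => ?_⟩
  refine ⟨ExactStructure.leftLocalization_isHoveyTriple h₁ h₂ hE hA h₂₁,
    ExactStructure.leftLocalization_isHoveyTriple h₁ h₃ hE hA h₃₁,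
    ExactStructure.quillenEquivalence₃ h₁ h₂ h₃ h₂₁ h₃₁ hE hA h,
    ExactStructure.quillenEquivalence₂ h₁ h₂ h₃ h₂₁ h₃₁ hE hA h, ?_⟩
  obtain ⟨_, hI₁⟩ := h₁.exists_triangulatedStructure hE
  -- The triangulation of `C₂/∼` is pulled back from `C₁/∼` instead of being built from the
  -- Frobenius structure of `C₂`, so that the inclusion is exact by construction.
  obtain ⟨_, hi, hI₂⟩ := h₂.exists_triangulatedStructure_stableIncl hE h₁ h₂₁ hI₁
  obtain ⟨_, hjL, hj, hI₃⟩ := h₃.exists_triangulatedStructure_hoCat hE hA h₁ h₃₁ hI₁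
  refine ⟨inferInstance, inferInstance, inferInstance, hI₂, hI₁, hI₃, ?_⟩
  obtain ⟨jR, ⟨adjR⟩, fR, fR', hρ, himR, heqv⟩ :=
    ExactStructure.exists_rightAdjoint_quotientFunctor h₁ h₂ h₃ h₂₁ h₃₁ hE h hI₁
  -- Special `W₃`-preenvelopes of objects of `C₁` land in `W₃ ⊓ C₁`; substituting this class for
  -- `C₂` makes the targets of the functors coincide.
  have key : ∃ iL : E.StableCat C₁ ⥤ E.StableCat C₂, Nonempty (iL ⊣ E.stableIncl h₂₁) ∧
      Nonempty (E.PreenvelopePresentation W₃ C₃ C₁.ι (E.toStable C₁ ⋙ iL)) := by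
    subst h
    exact ⟨h₃.preenvelopeFunctor hE h₁ h₃₁, ⟨h₃.preenvelopeAdjunction hE h₁ h₃₁⟩,
      ⟨h₃.preenvelopePresentation hE h₁ h₃₁⟩⟩
  obtain ⟨iL, ⟨adjL⟩, hiL⟩ := key
  refine ⟨iL, h₂.precoverFunctor hE h₂₁, h₃.hoCovIncl hE h₃₁, jR, ?_, hiL,
    ⟨h₂.precoverPresentation hE h₂₁⟩, ⟨h₃.hoCovInclPresentation hE h₃₁⟩,
    ⟨h₁.covFunctor hE, h₂.preenvelopeFunctor hE h₁ h₂₁, ⟨h₁.covPresentation hE⟩,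
      ⟨h₂.preenvelopePresentation hE h₁ h₂₁⟩, hρ⟩,
    h₃.essImage_hoCovIncl hE h₃₁, himR, heqv⟩
  exact
    { exact_i := hi
      exact_iL := hi.of_leftAdjoint adjL
      exact_iR := hi.of_rightAdjoint (h₂.precoverAdjunction hE h₂₁)
      exact_j := hj
      exact_jL := hjL
      exact_jR := hj.of_rightAdjoint adjR
      adj_iL := ⟨adjL⟩
      adj_iR := ⟨h₂.precoverAdjunction hE h₂₁⟩
      adj_jL := ⟨h₃.hoCovAdjunction hE h₃₁⟩
      adj_jR := ⟨adjR⟩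
      full_i := inferInstance
      faithful_i := inferInstance
      full_jL := h₃.full_hoCovIncl hE h₃₁
      faithful_jL := h₃.faithful_hoCovIncl hE h₃₁
      full_jR := fR
      faithful_jR := fR'
      isZero_iff := ExactStructure.isZero_quotientFunctor_obj_iff h₁ h₂ h₃ h₂₁ h₃₁ hE h hI₁.1
        hI₃.1 hjL }
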